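/- **Setting.** Let $(X,d,\mathfrak m)$ be a metric measure space: $(X,d)$ is a complete separable metric space and $\mathfrak m$ is a nonnegative Borel measure that is finite on bounded Borel sets. Let $q\in(1,\infty]$ and let $p\in[1,\infty)$ be its conjugate exponent, $1/p+1/q=1$. $L^0(\mathfrak m)$ denotes the measurable functions $X\to\mathbb R$ modulo $\mathfrak m$-a.e. equality, with the a.e. order. *Upper gradients.* For $\rho\colon X\to[0,\infty]$ Borel and a curve $\gamma\colon[a,b]\to X$ (continuous, $a<b$), let $\int_\gamma\rho\,ds$ be $\ell(\gamma)\int_0^1\rho(\gamma^{cs}(t))\,dt$ if $\gamma$ is rectifiable, where $\ell(\gamma)$ is the length and $\gamma^{cs}$ the constant-speed reparametrisation, and $+\infty$ otherwise. Let $\mathrm{Mod}_p(\Gamma)=\inf\{\int\rho^p\,d\mathfrak m : \rho\ge0 \text{ Borel},\ \int_\gamma\rho\,ds\ge1\ \forall\gamma\in\Gamma\}$. A Borel $\rho\colon X\to[0,\infty]$ with $\int\rho^p\,d\mathfrak m<\infty$ is a weak $p$-upper gradient of $f\colon X\to\mathbb R$ if $|f(\gamma(b))-f(\gamma(a))|\le\int_\gamma\rho\,ds$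 for $\mathrm{Mod}_p$-a.e. nonconstant rectifiable $\gamma$. $D^{1,p}_{\mathfrak m}(X)\subseteq L^0(\mathfrak m)$ is the space of classes of $\mathfrak m$-measurable functions having a weak $p$-upper gradient; $|Df|\in L^p(\mathfrak m)$ is the a.e. smallest weak $p$-upper gradient of $f$; and $W^{1,p}(X)=D^{1,p}_{\mathfrak m}(X)\cap L^p(\mathfrak m)$. *Banach modules.* For $r\in[1,\infty]$, an $L^r(\mathfrak m)$-Banach $L^\infty(\mathfrak m)$-module is an $L^\infty(\mathfrak m)$-module $M$ with a map $|\cdot|\colon M\to L^r(\mathfrak m)$, $|\cdot|\ge0$, such that $|v|\ne0$ for $v\neq0$, $|v+w|\le|v|+|w|$, $|fv|=|f||v|$ for $f\in L^\infty(\mathfrak m)$; such that the norm $\||v|\|_{L^r(\mathfrak m)}$ is complete; and such that for every countable Borel partition $(E_n)$ of $X$ and $(v_n)\subseteq M$ with $(\||1_{E_n}v_n|\|_{L^r})_n\in\ell^r$ there is $v\in M$ (written $\sum_n1_{E_n}v_n$) with $1_{E_n}v=1_{E_n}v_n$ for all $n$. A subset generates $M$ if the elements $\sum_n 1_{E_n}v_n$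 of this form, with all $v_n$ in its linear span, are dense in $M$. An isomorphism of such modules is a bijective $L^\infty(\mathfrak m)$-linear map $T$ with $|T(v)|=|v|$ for all $v$. *Cotangent and tangent module.* $(L^p(T^*X),\mathrm d)$ is the couple, unique up to unique isomorphism, consisting of an $L^p(\mathfrak m)$-Banach $L^\infty(\mathfrak m)$-module and a linear map $\mathrm d\colon D^{1,p}_{\mathfrak m}(X)\to L^p(T^*X)$ such that $|\mathrm df|=|Df|$ for all $f$ and the image of $\mathrm d$ generates $L^p(T^*X)$. The tangent module $L^q(TX)$ is the space of all continuous $L^\infty(\mathfrak m)$-linear maps $v\colon L^p(T^*X)\to L^1(\mathfrak m)$, with pointwise operations and pointwise norm $|v|=\bigvee\{v(\omega):\omega\in L^p(T^*X),\ |\omega|\le1\}$ (supremum in $L^0(\mathfrak m)$). *Sobolev derivations.* A Sobolev $q$-derivation is a linear map $\delta\colon W^{1,p}(X)\to L^1(\mathfrak m)$ for which there is $g\in L^q(\mathfrak m)$, $g\ge0$, with $|\delta(f)|\le g|Df|$ for all $f\in W^{1,p}(X)$. These maps form the space $L^q_{\rm Sob}(TX)$, with operations $(\delta+\delta')(f)=\delta(f)+\delta'(f)$,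 $(h\delta)(f)=h\,\delta(f)$ for $h\in L^\infty(\mathfrak m)$, and pointwise norm $|\delta|$ equal to the infimum in $L^0(\mathfrak m)$ of all such $g$. **Theorem.** All the above objects are well defined: each $|Df|$ exists; the couple $(L^p(T^*X),\mathrm d)$ exists; the above supremum $|v|$ and infimum $|\delta|$ exist; and $L^q(TX)$ and $L^q_{\rm Sob}(TX)$ are $L^q(\mathfrak m)$-Banach $L^\infty(\mathfrak m)$-modules. For every $\delta\in L^q_{\rm Sob}(TX)$ there exists a unique $\mathrm I(\delta)\in L^q(TX)$ such that $$\mathrm I(\delta)(\mathrm df)=\delta(f)\qquad\text{for every }f\in W^{1,p}(X),$$ and the resulting map $\mathrm I\colon L^q_{\rm Sob}(TX)\to L^q(TX)$ is an isomorphism of $L^q(\mathfrak m)$-Banach $L^\infty(\mathfrak m)$-modules: it is $L^\infty(\mathfrak m)$-linear, bijective, and satisfies $|\mathrm I(\delta)|=|\delta|$ for all $\delta$. -/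

import Mathlib

open MeasureTheory Set Filter Topology
open scoped ENNReal NNReal TensorProduct

namespace SobolevTangent

noncomputable section

/-! ### The algebra of measurable functions modulo null sets, and Lebesgue spaces inside it -/

section Lebesgue

variable {X : Type*} [MeasurableSpace X]

/-- The space `L⁰(m)` of real-valued measurable functions modulo `m`-a.e. equality is a commutative
ring for the pointwise operations (Mathlib's additive and multiplicative structures combined). -/
instance instCommRingAEEqFun (m : Measure X) : CommRing (X →ₘ[m] ℝ) :=
  { AEEqFun.instAddCommGroup, AEEqFun.instCommMonoid with
    left_distrib := fun a b c =>
      AEEqFun.induction_on₃ a b c fun f _ g _ h _ =>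
        AEEqFun.mk_eq_mk.2 (Eventually.of_forall fun x => mul_add (f x) (g x) (h x))
    right_distrib := fun a b c =>
      AEEqFun.induction_on₃ a b c fun f _ g _ h _ =>
        AEEqFun.mk_eq_mk.2 (Eventually.of_forall fun x => add_mul (f x) (g x) (h x))
    zero_mul := fun a =>
      AEEqFun.induction_on a fun f _ =>
        AEEqFun.mk_eq_mk.2 (Eventually.of_forall fun x => zero_mul (f x))
    mul_zero := fun a =>
      AEEqFun.induction_on a fun f _ =>
        AEEqFun.mk_eq_mk.2 (Eventually.of_forall fun x => mul_zero (f x)) }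

instance instAlgebraAEEqFun (m : Measure X) : Algebra ℝ (X →ₘ[m] ℝ) :=
  Algebra.ofModule
    (fun r a b => AEEqFun.induction_on₂ a b fun f _ g _ =>
      AEEqFun.mk_eq_mk.2 (Eventually.of_forall fun x => smul_mul_assoc r (f x) (g x)))
    (fun r a b => AEEqFun.induction_on₂ a b fun f _ g _ =>
      AEEqFun.mk_eq_mk.2 (Eventually.of_forall fun x => mul_smul_comm r (f x) (g x)))

/-- The `L^p(m)`-norm of (the class of) a measurable function, as a real number. It is only used
for elements of `L^p(m)`. -/
def normLp {m : Measure X} (p : ℝ≥0∞) (f : X →ₘ[m] ℝ) : ℝ := (eLpNorm f p m).toReal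

lemma mul_mem_Lp {m : Measure X} {p : ℝ≥0∞} {f g : X →ₘ[m] ℝ}
    (hf : f ∈ Lp ℝ ∞ m) (hg : g ∈ Lp ℝ p m) : f * g ∈ Lp ℝ p m := by
  rw [Lp.mem_Lp_iff_memLp] at *
  exact (hg.mul (r := p) hf).ae_eq (AEEqFun.coeFn_mul f g).symm

lemma normLp_mul_le {m : Measure X} {p : ℝ≥0∞} {f g : X →ₘ[m] ℝ}
    (hf : f ∈ Lp ℝ ∞ m) (hg : g ∈ Lp ℝ p m) :
    normLp p (f * g) ≤ normLp ∞ f * normLp p g := by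
  rw [Lp.mem_Lp_iff_memLp] at *
  unfold normLp
  rw [← ENNReal.toReal_mul]
  refine ENNReal.toReal_mono (ENNReal.mul_ne_top hf.2.ne hg.2.ne) ?_
  refine (eLpNorm_congr_ae (AEEqFun.coeFn_mul f g)).trans_le ?_
  have h := eLpNorm_smul_le_mul_eLpNorm (p := ∞) (q := p) (r := p) hg.1 hf.1
  simpa only [smul_eq_mul] using h

lemma normLp_add_le {m : Measure X} {p : ℝ≥0∞} (hp : 1 ≤ p) {f g : X →ₘ[m] ℝ}
    (hf : f ∈ Lp ℝ p m) (hg : g ∈ Lp ℝ p m) :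
    normLp p (f + g) ≤ normLp p f + normLp p g := by
  rw [Lp.mem_Lp_iff_memLp] at *
  unfold normLp
  rw [← ENNReal.toReal_add hf.2.ne hg.2.ne]
  refine ENNReal.toReal_mono (ENNReal.add_ne_top.2 ⟨hf.2.ne, hg.2.ne⟩) ?_
  rw [eLpNorm_congr_ae (AEEqFun.coeFn_add f g)]
  exact eLpNorm_add_le hf.1 hg.1 hp

lemma normLp_nonneg {m : Measure X} (p : ℝ≥0∞) (f : X →ₘ[m] ℝ) : 0 ≤ normLp p f :=
  ENNReal.toReal_nonneg

lemma abs_mem_Lp {m : Measure X} {p : ℝ≥0∞} {f : X →ₘ[m] ℝ} (hf : f ∈ Lp ℝ p m) :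
    |f| ∈ Lp ℝ p m := by
  rw [Lp.mem_Lp_iff_memLp] at *
  exact hf.abs.ae_eq (AEEqFun.coeFn_abs f).symm

/-- The algebra `L^∞(m)` of essentially bounded measurable functions modulo a.e. equality. -/
def Linfty (m : Measure X) : Subalgebra ℝ (X →ₘ[m] ℝ) where
  carrier := {f | f ∈ Lp ℝ ∞ m}
  mul_mem' := fun hf hg => mul_mem_Lp hf hg
  add_mem' := fun hf hg => (Lp ℝ ∞ m).add_mem hf hg
  algebraMap_mem' := fun r => by
    change algebraMap ℝ (X →ₘ[m] ℝ) r ∈ Lp ℝ ∞ m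
    rw [Algebra.algebraMap_eq_smul_one, Lp.mem_Lp_iff_memLp]
    refine MemLp.ae_eq ?_ (memLp_top_const (μ := m) r)
    filter_upwards [AEEqFun.coeFn_smul r (1 : X →ₘ[m] ℝ), AEEqFun.coeFn_one (β := ℝ) (μ := m)]
      with x hx h1
    simp [hx, h1]

/-- The Lebesgue space `L^p(m)`, as an `L^∞(m)`-submodule of `L⁰(m)`. -/
def LpModule (p : ℝ≥0∞) (m : Measure X) : Submodule (Linfty m) (X →ₘ[m] ℝ) where
  carrier := {f | f ∈ Lp ℝ p m}
  add_mem' := fun hf hg => (Lp ℝ p m).add_mem hf hg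
  zero_mem' := (Lp ℝ p m).zero_mem
  smul_mem' := fun h _ hf => mul_mem_Lp h.2 hf

instance instModuleRealLpModule (p : ℝ≥0∞) (m : Measure X) : Module ℝ (LpModule p m) :=
  Submodule.module' _

instance instSMulCommClassRealLpModule (p : ℝ≥0∞) (m : Measure X) :
    SMulCommClass ℝ (Linfty m) (LpModule p m) :=
  IsScalarTower.to_smulCommClass

instance instAddCommGroupLpModule (p : ℝ≥0∞) (m : Measure X) : AddCommGroup (LpModule p m) :=
  Submodule.addCommGroup _

instance instAddCommGroupLinearMapReal (p : ℝ≥0∞) (m : Measure X) {V : Type*} [AddCommGroup V]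
    [Module ℝ V] : AddCommGroup (V →ₗ[ℝ] LpModule p m) :=
  LinearMap.addCommGroup

instance instAddCommGroupLinearMapLinfty (p : ℝ≥0∞) (m : Measure X) {M : Type*}
    [AddCommGroup M] [Module (Linfty m) M] : AddCommGroup (M →ₗ[Linfty m] LpModule p m) :=
  LinearMap.addCommGroup

instance instModuleLinearMapLinfty (p : ℝ≥0∞) (m : Measure X) {M : Type*}
    [AddCommGroup M] [Module (Linfty m) M] : Module (Linfty m) (M →ₗ[Linfty m] LpModule p m) :=
  LinearMap.module

/-- The pointwise `L^∞(m)`-module structure `(hδ)(f) = h δ(f)` on linear maps with values in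
`L^p(m)`. -/
instance instModuleLinearMapLpModule (p : ℝ≥0∞) (m : Measure X) {V : Type*} [AddCommGroup V]
    [Module ℝ V] : Module (Linfty m) (V →ₗ[ℝ] LpModule p m) :=
  LinearMap.module

/-- The characteristic function of a measurable set, as an element of `L^∞(m)`. -/
def charFun (m : Measure X) (E : Set X) (hE : MeasurableSet E) : Linfty m :=
  ⟨AEEqFun.mk (E.indicator fun _ => (1 : ℝ)) (aestronglyMeasurable_const.indicator hE), by
    change _ ∈ Lp ℝ ∞ m
    rw [Lp.mem_Lp_iff_memLp]
    exact ((memLp_top_const (1 : ℝ)).indicator hE).ae_eq (AEEqFun.coeFn_mk _ _).symm⟩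

end Lebesgue

/-! ### `L^p`-Banach `L^∞`-modules -/

section BanachModules

variable {X : Type*} [MeasurableSpace X]

/-- `M`, together with the functional `nrm`, is an `L^p(m)`-Banach `L^∞(m)`-module: `nrm` is a
pointwise norm with values in the nonnegative elements of `L^p(m)`, the norm `‖nrm v‖_{L^p}` is
complete, and countable families can be glued along measurable partitions. -/
structure IsLpBanachModule (p : ℝ≥0∞) (m : Measure X) (M : Type*) [AddCommGroup M]
    [Module (Linfty m) M] (nrm : M → (X →ₘ[m] ℝ)) : Prop where
  mem_Lp : ∀ v, nrm v ∈ Lp ℝ p m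
  nonneg : ∀ v, 0 ≤ nrm v
  ne_zero : ∀ v, v ≠ 0 → nrm v ≠ 0
  triangle : ∀ v w, nrm (v + w) ≤ nrm v + nrm w
  smul : ∀ (f : Linfty m) (v : M), nrm (f • v) = |(f : X →ₘ[m] ℝ)| * nrm v
  complete : ∀ u : ℕ → M,
    (∀ ε : ℝ, 0 < ε → ∃ N, ∀ i ≥ N, ∀ j ≥ N, normLp p (nrm (u i - u j)) < ε) →
    ∃ v, Tendsto (fun i => normLp p (nrm (u i - v))) atTop (𝓝 0)
  glueing : ∀ (E : ℕ → Set X) (hE : ∀ n, MeasurableSet (E n)) (v : ℕ → M),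
    Pairwise (fun i j => Disjoint (E i) (E j)) → (⋃ n, E n) = univ →
    Memℓp (fun n => normLp p (nrm (charFun m (E n) (hE n) • v n))) p →
    ∃ w : M, ∀ n, charFun m (E n) (hE n) • w = charFun m (E n) (hE n) • v n

/-- `V` generates the `L^p(m)`-Banach `L^∞(m)`-module `M`: the elements `w = ∑ₙ 1_{Eₙ} vₙ`, glued
from admissible sequences with all `vₙ` in the linear span of `V`, are dense in `M`. -/
def Generates (p : ℝ≥0∞) (m : Measure X) {M : Type*} [AddCommGroup M] [Module ℝ M]
    [Module (Linfty m) M] (nrm : M → (X →ₘ[m] ℝ)) (V : Set M) : Prop :=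
  ∀ ω : M, ∀ ε : ℝ, 0 < ε →
    ∃ (E : ℕ → Set X) (hE : ∀ n, MeasurableSet (E n)) (v : ℕ → M) (w : M),
      Pairwise (fun i j => Disjoint (E i) (E j)) ∧ (⋃ n, E n) = univ ∧
      (∀ n, v n ∈ Submodule.span ℝ V) ∧
      Memℓp (fun n => normLp p (nrm (charFun m (E n) (hE n) • v n))) p ∧
      (∀ n, charFun m (E n) (hE n) • w = charFun m (E n) (hE n) • v n) ∧
      normLp p (nrm (ω - w)) < ε

/-- The dual of an `L^p(m)`-Banach `L^∞(m)`-module `M`: all `L^∞(m)`-linear maps `M → L¹(m)` that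
are continuous, i.e. bounded, with the pointwise operations. -/
def dualModule (p : ℝ≥0∞) (m : Measure X) {M : Type*} [AddCommGroup M] [Module (Linfty m) M]
    (nrm : M → (X →ₘ[m] ℝ)) : Submodule (Linfty m) (M →ₗ[Linfty m] LpModule 1 m) where
  carrier := {T | ∃ C : ℝ, ∀ v : M, normLp 1 (T v : X →ₘ[m] ℝ) ≤ C * normLp p (nrm v)}
  add_mem' := by
    rintro S T ⟨C, hC⟩ ⟨D, hD⟩
    refine ⟨C + D, fun v => ?_⟩
    have h := normLp_add_le (le_refl (1 : ℝ≥0∞)) (S v).2 (T v).2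
    have h1 := hC v
    have h2 := hD v
    change normLp 1 ((S v : X →ₘ[m] ℝ) + (T v : X →ₘ[m] ℝ)) ≤ _
    linarith
  zero_mem' := by
    refine ⟨0, fun v => ?_⟩
    have : normLp 1 (0 : X →ₘ[m] ℝ) = 0 := by
      unfold normLp
      rw [eLpNorm_congr_ae AEEqFun.coeFn_zero]
      simp
    change normLp 1 (0 : X →ₘ[m] ℝ) ≤ _
    rw [this, zero_mul]
  smul_mem' := by
    rintro h T ⟨C, hC⟩
    refine ⟨normLp ∞ (h : X →ₘ[m] ℝ) * C, fun v => ?_⟩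
    change normLp 1 ((h : X →ₘ[m] ℝ) * (T v : X →ₘ[m] ℝ)) ≤ _
    rw [mul_assoc]
    exact (normLp_mul_le h.2 (T v).2).trans
      (mul_le_mul_of_nonneg_left (hC v) (normLp_nonneg _ _))

instance instAddCommGroupDualModule (p : ℝ≥0∞) (m : Measure X) {M : Type*} [AddCommGroup M]
    [Module (Linfty m) M] (nrm : M → (X →ₘ[m] ℝ)) : AddCommGroup (dualModule p m nrm) :=
  Submodule.addCommGroup _

instance instModuleDualModule (p : ℝ≥0∞) (m : Measure X) {M : Type*} [AddCommGroup M]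
    [Module (Linfty m) M] (nrm : M → (X →ₘ[m] ℝ)) : Module (Linfty m) (dualModule p m nrm) :=
  Submodule.module _

instance instSMulDualModule (p : ℝ≥0∞) (m : Measure X) {M : Type*} [AddCommGroup M]
    [Module (Linfty m) M] (nrm : M → (X →ₘ[m] ℝ)) : SMul (Linfty m) (dualModule p m nrm) :=
  (instModuleDualModule p m nrm).toSMul

/-- The set whose supremum in the lattice `L⁰(m)` is the pointwise norm of `T` in the dual. -/
def dualValues (p : ℝ≥0∞) (m : Measure X) {M : Type*} [AddCommGroup M] [Module (Linfty m) M]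
    (nrm : M → (X →ₘ[m] ℝ)) (T : dualModule p m nrm) : Set (X →ₘ[m] ℝ) :=
  {h | ∃ v : M, nrm v ≤ 1 ∧ h = ((T : M →ₗ[Linfty m] LpModule 1 m) v : X →ₘ[m] ℝ)}

/-- The dual pointwise norm `|T| = ⋁ {T(v) | |v| ≤ 1}` (supremum in the lattice `L⁰(m)`). -/
def dualNorm (p : ℝ≥0∞) (m : Measure X) {M : Type*} [AddCommGroup M] [Module (Linfty m) M]
    (nrm : M → (X →ₘ[m] ℝ)) (T : dualModule p m nrm) : X →ₘ[m] ℝ :=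
  Classical.epsilon fun g => IsLUB (dualValues p m nrm T) g

end BanachModules

/-! ### Curves, modulus, weak upper gradients -/

section Curves

variable {X : Type*} [MetricSpace X]

variable (X) in
/-- A curve `[a, b] → X`, `a < b`: only the values of `toFun` on `[a, b]` matter. -/
structure Curve where
  a : ℝ
  b : ℝ
  lt : a < b
  toFun : ℝ → X
  continuousOn : ContinuousOn toFun (Icc a b)

/-- The length of a curve. -/
def Curve.length (γ : Curve X) : ℝ≥0∞ := eVariationOn γ.toFun (Icc γ.a γ.b)

/-- A curve is rectifiable if it has finite length. -/
def Curve.Rectifiable (γ : Curve X) : Prop := γ.length < ∞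

/-- The constant-speed reparametrisation of a rectifiable curve, defined on `[0, 1]`: `t` is sent
to the value of `γ` at a time `s` for which `γ` restricted to `[a, s]` has length `t * length γ`. -/
def Curve.constSpeed (γ : Curve X) (t : ℝ) : X :=
  naturalParameterization γ.toFun (Icc γ.a γ.b) γ.a (γ.length.toReal * t)

open Classical in
/-- The path integral `∫_γ ρ ds`, equal to `∞` if `γ` is not rectifiable. -/
def Curve.pathIntegral (γ : Curve X) (ρ : X → ℝ≥0∞) : ℝ≥0∞ :=
  if γ.Rectifiable then γ.length * ∫⁻ t in Icc (0 : ℝ) 1, ρ (γ.constSpeed t) else ∞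

lemma Curve.pathIntegral_mono (γ : Curve X) {ρ σ : X → ℝ≥0∞} (h : ∀ x, ρ x ≤ σ x) :
    γ.pathIntegral ρ ≤ γ.pathIntegral σ := by
  unfold Curve.pathIntegral
  split_ifs
  · exact mul_le_mul_right (lintegral_mono fun t => h _) _
  · exact le_rfl

variable [MeasurableSpace X]

/-- The `p`-modulus of a family of curves (for `1 ≤ p < ∞`). -/
def modulus (p : ℝ≥0∞) (m : Measure X) (Γ : Set (Curve X)) : ℝ≥0∞ :=
  ⨅ (ρ : X → ℝ≥0∞) (_ : Measurable ρ) (_ : ∀ γ ∈ Γ, 1 ≤ γ.pathIntegral ρ),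
    ∫⁻ x, ρ x ^ p.toReal ∂m

/-- The rectifiable curves along which the upper gradient inequality for `(f, ρ)` fails. Such
curves are automatically nonconstant. -/
def badCurves (f : X → ℝ) (ρ : X → ℝ≥0∞) : Set (Curve X) :=
  {γ | γ.Rectifiable ∧ ¬ ENNReal.ofReal |f (γ.toFun γ.b) - f (γ.toFun γ.a)| ≤ γ.pathIntegral ρ}

/-- The `p`-integrable Borel function `ρ` is a weak `p`-upper gradient of `f`. -/
def IsWeakUpperGradient (p : ℝ≥0∞) (m : Measure X) (f : X → ℝ) (ρ : X → ℝ≥0∞) : Prop :=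
  Measurable ρ ∧ ∫⁻ x, ρ x ^ p.toReal ∂m < ∞ ∧ modulus p m (badCurves f ρ) = 0

lemma modulus_mono {p : ℝ≥0∞} {m : Measure X} {Γ Δ : Set (Curve X)} (h : Γ ⊆ Δ) :
    modulus p m Γ ≤ modulus p m Δ :=
  iInf_mono fun _ => iInf_mono fun _ => iInf_mono' fun H => ⟨fun γ hγ => H γ (h hγ), le_rfl⟩

lemma modulus_union_le {p : ℝ≥0∞} {m : Measure X} (Γ Δ : Set (Curve X)) :
    modulus p m (Γ ∪ Δ) ≤ modulus p m Γ + modulus p m Δ := by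
  refine ENNReal.le_of_forall_pos_le_add fun ε hε hfin => ?_
  have hε2 : (0 : ℝ≥0∞) < (ε : ℝ≥0∞) / 2 := ENNReal.half_pos (by exact_mod_cast hε.ne')
  have key : ∀ Λ : Set (Curve X), modulus p m Λ < ∞ → ∃ ρ : X → ℝ≥0∞, Measurable ρ ∧
      (∀ γ ∈ Λ, 1 ≤ γ.pathIntegral ρ) ∧
      ∫⁻ x, ρ x ^ p.toReal ∂m < modulus p m Λ + (ε : ℝ≥0∞) / 2 := by
    intro Λ hΛ
    have h : modulus p m Λ < modulus p m Λ + (ε : ℝ≥0∞) / 2 :=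
      ENNReal.lt_add_right hΛ.ne hε2.ne'
    conv_lhs at h => unfold modulus
    simp only [iInf_lt_iff] at h
    obtain ⟨ρ, h1, h2, h3⟩ := h
    exact ⟨ρ, h1, h2, h3⟩
  obtain ⟨ρ, hρ, hρΓ, hρi⟩ := key Γ (lt_of_le_of_lt le_self_add hfin)
  obtain ⟨σ, hσ, hσΔ, hσi⟩ := key Δ (lt_of_le_of_lt le_add_self hfin)
  have hle : modulus p m (Γ ∪ Δ) ≤ ∫⁻ x, (max (ρ x) (σ x)) ^ p.toReal ∂m := by
    refine iInf_le_of_le (fun x => max (ρ x) (σ x)) (iInf_le_of_le (hρ.max hσ)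
      (iInf_le_of_le ?_ le_rfl))
    rintro γ (hγ | hγ)
    · exact (hρΓ γ hγ).trans (γ.pathIntegral_mono fun x => le_max_left _ _)
    · exact (hσΔ γ hγ).trans (γ.pathIntegral_mono fun x => le_max_right _ _)
  calc modulus p m (Γ ∪ Δ) ≤ ∫⁻ x, (max (ρ x) (σ x)) ^ p.toReal ∂m := hle
    _ ≤ ∫⁻ x, (ρ x ^ p.toReal + σ x ^ p.toReal) ∂m := by
        refine lintegral_mono fun x => ?_
        rcases max_cases (ρ x) (σ x) with ⟨h, _⟩ | ⟨h, _⟩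
        · simp only [h]; exact le_self_add
        · simp only [h]; exact le_add_self
    _ = ∫⁻ x, ρ x ^ p.toReal ∂m + ∫⁻ x, σ x ^ p.toReal ∂m :=
        lintegral_add_left (hρ.pow_const _) _
    _ ≤ (modulus p m Γ + (ε : ℝ≥0∞) / 2) + (modulus p m Δ + (ε : ℝ≥0∞) / 2) :=
        add_le_add hρi.le hσi.le
    _ = modulus p m Γ + modulus p m Δ + ε := by
        rw [add_add_add_comm, ENNReal.add_halves]

lemma IsWeakUpperGradient.add {p : ℝ≥0∞} (hp : 1 ≤ p) (hp' : p ≠ ∞) {m : Measure X}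
    {f g : X → ℝ} {ρ σ : X → ℝ≥0∞}
    (hf : IsWeakUpperGradient p m f ρ) (hg : IsWeakUpperGradient p m g σ) :
    IsWeakUpperGradient p m (fun x => f x + g x) (fun x => ρ x + σ x) := by
  refine ⟨hf.1.add hg.1, ?_, ?_⟩
  · have h1 : 1 ≤ p.toReal := by
      rw [← ENNReal.toReal_one]; exact ENNReal.toReal_mono hp' hp
    exact ENNReal.lintegral_rpow_add_lt_top_of_lintegral_rpow_lt_top hf.1.aemeasurable hf.2.1 hg.2.1 h1
  · refine le_antisymm ?_ bot_le
    refine (modulus_mono ?_).trans ((modulus_union_le (badCurves f ρ) (badCurves g σ)).trans ?_)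
    · rintro γ ⟨hr, hγ⟩
      by_contra hcon
      simp only [mem_union, not_or, badCurves, mem_ofPred_eq, not_and, not_not] at hcon
      refine hγ ?_
      have h1 := hcon.1 hr
      have h2 := hcon.2 hr
      calc ENNReal.ofReal |f (γ.toFun γ.b) + g (γ.toFun γ.b) - (f (γ.toFun γ.a) + g (γ.toFun γ.a))|
          ≤ ENNReal.ofReal (|f (γ.toFun γ.b) - f (γ.toFun γ.a)|
              + |g (γ.toFun γ.b) - g (γ.toFun γ.a)|) := by
            refine ENNReal.ofReal_le_ofReal ?_
            rw [add_sub_add_comm]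
            exact abs_add_le _ _
        _ = ENNReal.ofReal |f (γ.toFun γ.b) - f (γ.toFun γ.a)|
              + ENNReal.ofReal |g (γ.toFun γ.b) - g (γ.toFun γ.a)| :=
            ENNReal.ofReal_add (abs_nonneg _) (abs_nonneg _)
        _ ≤ γ.pathIntegral ρ + γ.pathIntegral σ := add_le_add h1 h2
        _ ≤ γ.pathIntegral (fun x => ρ x + σ x) := by
            simp only [Curve.pathIntegral, if_pos hr]
            rw [← mul_add]
            exact mul_le_mul_right (le_lintegral_add _ _) _
    · rw [hf.2.2, hg.2.2, add_zero]

lemma IsWeakUpperGradient.const_smul {p : ℝ≥0∞} {m : Measure X}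
    {f : X → ℝ} {ρ : X → ℝ≥0∞} (hf : IsWeakUpperGradient p m f ρ) (c : ℝ) :
    IsWeakUpperGradient p m (fun x => c * f x) (fun x => ENNReal.ofReal |c| * ρ x) := by
  refine ⟨hf.1.const_mul _, ?_, ?_⟩
  · simp_rw [ENNReal.mul_rpow_of_nonneg _ _ ENNReal.toReal_nonneg]
    rw [lintegral_const_mul _ (hf.1.pow_const _)]
    exact ENNReal.mul_lt_top
      (ENNReal.rpow_lt_top_of_nonneg ENNReal.toReal_nonneg ENNReal.ofReal_ne_top) hf.2.1
  · refine le_antisymm ?_ bot_le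
    rw [← hf.2.2]
    refine modulus_mono ?_
    rintro γ ⟨hr, hγ⟩
    refine ⟨hr, fun h => hγ ?_⟩
    calc ENNReal.ofReal |c * f (γ.toFun γ.b) - c * f (γ.toFun γ.a)|
        = ENNReal.ofReal |c| * ENNReal.ofReal |f (γ.toFun γ.b) - f (γ.toFun γ.a)| := by
          rw [← mul_sub, abs_mul, ENNReal.ofReal_mul (abs_nonneg _)]
      _ ≤ ENNReal.ofReal |c| * γ.pathIntegral ρ := mul_le_mul_right h _
      _ ≤ γ.pathIntegral (fun x => ENNReal.ofReal |c| * ρ x) := by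
          simp only [Curve.pathIntegral, if_pos hr]
          rw [mul_left_comm]
          exact mul_le_mul_right (lintegral_const_mul_le _ _) _

lemma isWeakUpperGradient_zero {p : ℝ≥0∞} (hp : 1 ≤ p) (hp' : p ≠ ∞) (m : Measure X) :
    IsWeakUpperGradient p m (fun _ => 0) (fun _ => 0) := by
  have h1 : 0 < p.toReal := ENNReal.toReal_pos (zero_lt_one.trans_le hp).ne' hp'
  refine ⟨measurable_const, by simp [h1], ?_⟩
  have : badCurves (fun _ : X => (0 : ℝ)) (fun _ => 0) = ∅ := by
    ext γ; simp [badCurves]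
  rw [this]
  refine le_antisymm ?_ bot_le
  refine iInf_le_of_le (fun _ => 0) (iInf_le_of_le measurable_const (iInf_le_of_le (by simp) ?_))
  simp [h1]

end Curves

/-! ### Dirichlet and Sobolev spaces -/

section Sobolev

variable {X : Type*} [MetricSpace X] [MeasurableSpace X]

/-- The Dirichlet space `D^{1,p}_m(X) ⊆ L⁰(m)`: the classes of those (`m`-measurable) functions
that have a weak `p`-upper gradient. -/
def dirichletSpace (p : ℝ≥0∞) [hp : Fact (1 ≤ p)] [hp' : Fact (p ≠ ∞)] (m : Measure X) :
    Submodule ℝ (X →ₘ[m] ℝ) where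
  carrier := {f | ∃ f' : X → ℝ, f' =ᵐ[m] f ∧ ∃ ρ, IsWeakUpperGradient p m f' ρ}
  add_mem' := by
    rintro f g ⟨f', hf, ρ, hρ⟩ ⟨g', hg, σ, hσ⟩
    refine ⟨fun x => f' x + g' x, ?_, _, hρ.add hp.out hp'.out hσ⟩
    filter_upwards [hf, hg, AEEqFun.coeFn_add f g] with x h1 h2 h3
    simp [h1, h2, h3]
  zero_mem' :=
    ⟨fun _ => 0, AEEqFun.coeFn_zero.symm, _, isWeakUpperGradient_zero hp.out hp'.out m⟩
  smul_mem' := by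
    rintro c f ⟨f', hf, ρ, hρ⟩
    refine ⟨fun x => c * f' x, ?_, _, hρ.const_smul c⟩
    filter_upwards [hf, AEEqFun.coeFn_smul c f] with x h1 h3
    simp [h1, h3]

/-- The classes, in `L^p(m)`, of the weak `p`-upper gradients of the representatives of `f`. -/
def upperGradientClasses (p : ℝ≥0∞) (m : Measure X) (f : X →ₘ[m] ℝ) : Set (Lp ℝ p m) :=
  {G | ∃ f' : X → ℝ, f' =ᵐ[m] f ∧ ∃ ρ, IsWeakUpperGradient p m f' ρ ∧
    0 ≤ G ∧ ρ =ᵐ[m] fun x => ENNReal.ofReal (G x)}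

/-- The minimal weak `p`-upper gradient `|Df| ∈ L^p(m)` of `f ∈ D^{1,p}_m(X)`: the a.e. smallest
weak `p`-upper gradient. -/
def minGrad (p : ℝ≥0∞) (m : Measure X) (f : X →ₘ[m] ℝ) : Lp ℝ p m :=
  Classical.epsilon fun G => IsLeast (upperGradientClasses p m f) G

/-- The Sobolev space `W^{1,p}(X) = D^{1,p}_m(X) ∩ L^p(m)`. -/
def sobolevSpace (p : ℝ≥0∞) [Fact (1 ≤ p)] [Fact (p ≠ ∞)] (m : Measure X) :
    Submodule ℝ (X →ₘ[m] ℝ) :=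
  dirichletSpace p m ⊓ Lp.LpSubmodule ℝ ℝ p m

end Sobolev

/-! ### The cotangent module

It is the completion of `L^∞(m) ⊗ D^{1,p}_m(X)` for the largest seminorm compatible with
`|∑ᵢ gᵢ ⊗ fᵢ| ≤ ∑ᵢ |gᵢ| |Dfᵢ|`. -/

section Cotangent

variable {X : Type*} [MetricSpace X] [MeasurableSpace X]
variable (p : ℝ≥0∞) [Fact (1 ≤ p)] [Fact (p ≠ ∞)] (m : Measure X)

/-- Formal `1`-forms: finite sums `∑ᵢ gᵢ dfᵢ` with `gᵢ ∈ L^∞(m)` and `fᵢ ∈ D^{1,p}_m(X)`. -/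
def FormalForm : Type _ := (Linfty m) ⊗[ℝ] (dirichletSpace p m)

instance : AddCommGroup (FormalForm p m) :=
  inferInstanceAs (AddCommGroup ((Linfty m) ⊗[ℝ] (dirichletSpace p m)))

instance : Module (Linfty m) (FormalForm p m) :=
  inferInstanceAs (Module (Linfty m) ((Linfty m) ⊗[ℝ] (dirichletSpace p m)))

instance : Module ℝ (FormalForm p m) :=
  inferInstanceAs (Module ℝ ((Linfty m) ⊗[ℝ] (dirichletSpace p m)))

instance : IsScalarTower ℝ (Linfty m) (FormalForm p m) :=
  inferInstanceAs (IsScalarTower ℝ (Linfty m) ((Linfty m) ⊗[ℝ] (dirichletSpace p m)))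

/-- The form `g df`. -/
def FormalForm.of (g : Linfty m) (f : dirichletSpace p m) : FormalForm p m := g ⊗ₜ[ℝ] f

/-- The form `∑ᵢ gᵢ dfᵢ` given by a list of pairs `(gᵢ, fᵢ)`. -/
def listForm (l : List (Linfty m × dirichletSpace p m)) : FormalForm p m :=
  (l.map fun x => FormalForm.of p m x.1 x.2).sum

/-- The function `∑ᵢ |gᵢ| |Dfᵢ|`. -/
def listBound (l : List (Linfty m × dirichletSpace p m)) : X →ₘ[m] ℝ :=
  (l.map fun x => |(x.1 : X →ₘ[m] ℝ)| * (minGrad p m x.2 : X →ₘ[m] ℝ)).sum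

lemma listBound_mem (l : List (Linfty m × dirichletSpace p m)) : listBound p m l ∈ Lp ℝ p m := by
  induction l with
  | nil => exact (Lp ℝ p m).zero_mem
  | cons x l ih =>
    simp only [listBound, List.map_cons, List.sum_cons] at *
    exact (Lp ℝ p m).add_mem (mul_mem_Lp (abs_mem_Lp x.1.2) (minGrad p m x.2).2) ih

lemma exists_listForm (t : FormalForm p m) : ∃ l, listForm p m l = t := by
  refine TensorProduct.induction_on (motive := fun t => ∃ l, listForm p m l = t) t ?_ ?_ ?_
  · exact ⟨[], rfl⟩
  · exact fun g f => ⟨[(g, f)], add_zero (FormalForm.of p m g f)⟩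
  · rintro s t ⟨k, hk⟩ ⟨l, hl⟩
    refine ⟨k ++ l, ?_⟩
    rw [← hk, ← hl]
    simp only [listForm, List.map_append, List.sum_append]
    rfl

/-- The seminorm of a formal `1`-form: the infimum of `‖∑ᵢ |gᵢ| |Dfᵢ|‖_{L^p(m)}` over all ways of
writing it as `∑ᵢ gᵢ dfᵢ`. -/
def formNorm (t : FormalForm p m) : ℝ :=
  ⨅ l : {l : List (Linfty m × dirichletSpace p m) // listForm p m l = t},
    normLp p (listBound p m l.1)

lemma formNorm_le (l : List (Linfty m × dirichletSpace p m)) :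
    formNorm p m (listForm p m l) ≤ normLp p (listBound p m l) :=
  ciInf_le (f := fun k : {k // listForm p m k = listForm p m l} => normLp p (listBound p m k.1))
    ⟨0, by rintro _ ⟨k, rfl⟩; exact normLp_nonneg _ _⟩ ⟨l, rfl⟩

lemma exists_lt_of_formNorm_lt {t : FormalForm p m} {r : ℝ} (h : formNorm p m t < r) :
    ∃ l, listForm p m l = t ∧ normLp p (listBound p m l) < r := by
  have : Nonempty {l // listForm p m l = t} := by
    obtain ⟨l, hl⟩ := exists_listForm p m t
    exact ⟨⟨l, hl⟩⟩
  obtain ⟨l, hl⟩ := exists_lt_of_ciInf_lt h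
  exact ⟨l.1, l.2, hl⟩

lemma formNorm_add_le (s t : FormalForm p m) :
    formNorm p m (s + t) ≤ formNorm p m s + formNorm p m t := by
  refine le_of_forall_pos_le_add fun ε hε => ?_
  obtain ⟨k, hk, hk'⟩ := exists_lt_of_formNorm_lt p m (lt_add_of_pos_right (formNorm p m s)
    (half_pos hε))
  obtain ⟨l, hl, hl'⟩ := exists_lt_of_formNorm_lt p m (lt_add_of_pos_right (formNorm p m t)
    (half_pos hε))
  have h1 : listForm p m (k ++ l) = s + t := by
    rw [← hk, ← hl]; simp [listForm]
  have h2 : listBound p m (k ++ l) = listBound p m k + listBound p m l := by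
    simp [listBound]
  have h3 := formNorm_le p m (k ++ l)
  rw [h1, h2] at h3
  have h4 := normLp_add_le (Fact.out : 1 ≤ p) (listBound_mem p m k) (listBound_mem p m l)
  linarith

lemma formNorm_smul_le (h : Linfty m) (t : FormalForm p m) :
    formNorm p m (h • t) ≤ normLp ∞ |(h : X →ₘ[m] ℝ)| * formNorm p m t := by
  refine le_of_forall_pos_le_add fun ε hε => ?_
  set C := normLp ∞ |(h : X →ₘ[m] ℝ)| with hC
  have hC0 : 0 ≤ C := normLp_nonneg _ _
  obtain ⟨l, hl, hl'⟩ := exists_lt_of_formNorm_lt p m (lt_add_of_pos_right (formNorm p m t)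
    (div_pos hε (show 0 < C + 1 by linarith)))
  have h1 : listForm p m (l.map fun x => (h * x.1, x.2)) = h • t := by
    rw [← hl]
    simp only [listForm, List.smul_sum, List.map_map]
    rfl
  have h2 : listBound p m (l.map fun x => (h * x.1, x.2)) = |(h : X →ₘ[m] ℝ)| * listBound p m l := by
    simp only [listBound, List.map_map, ← List.sum_map_mul_left]
    congr 1
    refine List.map_congr_left fun x _ => ?_
    have habs : |(h : X →ₘ[m] ℝ) * (x.1 : X →ₘ[m] ℝ)|
        = |(h : X →ₘ[m] ℝ)| * |(x.1 : X →ₘ[m] ℝ)| := by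
      refine AEEqFun.ext ?_
      filter_upwards [AEEqFun.coeFn_abs ((h : X →ₘ[m] ℝ) * (x.1 : X →ₘ[m] ℝ)),
        AEEqFun.coeFn_mul (h : X →ₘ[m] ℝ) (x.1 : X →ₘ[m] ℝ),
        AEEqFun.coeFn_mul |(h : X →ₘ[m] ℝ)| |(x.1 : X →ₘ[m] ℝ)|,
        AEEqFun.coeFn_abs (h : X →ₘ[m] ℝ), AEEqFun.coeFn_abs (x.1 : X →ₘ[m] ℝ)]
        with y e1 e2 e3 e4 e5
      rw [e1, e2, e3, Pi.mul_apply, Pi.mul_apply, e4, e5, abs_mul]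
    simp only [Function.comp_apply, Subalgebra.coe_mul, habs, mul_assoc]
  have h3 := formNorm_le p m (l.map fun x => (h * x.1, x.2))
  rw [h1, h2] at h3
  have h4 := normLp_mul_le (abs_mem_Lp h.2) (listBound_mem p m l)
  have h5 : C * normLp p (listBound p m l) ≤ C * (formNorm p m t + ε / (C + 1)) :=
    mul_le_mul_of_nonneg_left hl'.le hC0
  have h6 : C * (ε / (C + 1)) ≤ ε := by
    rw [mul_div_assoc', div_le_iff₀ (by linarith)]
    nlinarith
  rw [← hC] at h4
  linarith [mul_add C (formNorm p m t) (ε / (C + 1))]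

lemma formNorm_zero : formNorm p m 0 = 0 := by
  refine le_antisymm ?_ (Real.iInf_nonneg fun l => normLp_nonneg _ _)
  have h := formNorm_le p m []
  have h0 : normLp p (listBound p m []) = 0 := by
    simp only [listBound, List.map_nil, List.sum_nil, normLp]
    rw [eLpNorm_congr_ae AEEqFun.coeFn_zero]
    simp
  rw [h0] at h
  exact h

lemma formNorm_neg_le (t : FormalForm p m) : formNorm p m (-t) ≤ formNorm p m t := by
  refine le_of_forall_pos_le_add fun ε hε => ?_
  obtain ⟨l, hl, hl'⟩ := exists_lt_of_formNorm_lt p m (lt_add_of_pos_right (formNorm p m t) hε)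
  have h1 : listForm p m (l.map fun x => (-x.1, x.2)) = -t := by
    rw [← hl]
    clear hl hl'
    induction l with
    | nil => exact neg_zero.symm
    | cons x l ih =>
      simp only [listForm, List.map_cons, List.sum_cons, List.map_map, neg_add] at *
      rw [ih]
      congr 1
  have h2 : listBound p m (l.map fun x => (-x.1, x.2)) = listBound p m l := by
    simp only [listBound, List.map_map]
    congr 1
    refine List.map_congr_left fun x _ => ?_
    simp
  have h3 := formNorm_le p m (l.map fun x => (-x.1, x.2))
  rw [h1, h2] at h3
  linarith

instance : SeminormedAddCommGroup (FormalForm p m) :=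
  AddGroupSeminorm.toSeminormedAddCommGroup
    { toFun := formNorm p m
      map_zero' := formNorm_zero p m
      add_le' := formNorm_add_le p m
      neg' := fun t => le_antisymm (formNorm_neg_le p m t) (by
        simpa using formNorm_neg_le p m (-t)) }

instance : UniformContinuousConstSMul (Linfty m) (FormalForm p m) where
  uniformContinuous_const_smul h := by
    refine (AddMonoidHomClass.uniformContinuous_of_bound
      (DistribSMul.toAddMonoidHom (FormalForm p m) h) (normLp ∞ |(h : X →ₘ[m] ℝ)|) fun t => ?_)
    exact formNorm_smul_le p m h t

instance : UniformContinuousConstSMul ℝ (FormalForm p m) where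
  uniformContinuous_const_smul r := by
    have h := uniformContinuous_const_smul (X := FormalForm p m) (algebraMap ℝ (Linfty m) r)
    simpa only [algebraMap_smul] using h

/-- The `p`-cotangent module `L^p(T*X)`. -/
abbrev CotangentModule : Type _ := UniformSpace.Completion (FormalForm p m)

/-- The differential `d : D^{1,p}_m(X) → L^p(T*X)`. -/
def differential : dirichletSpace p m →ₗ[ℝ] CotangentModule p m where
  toFun f := ((FormalForm.of p m 1 f : FormalForm p m) : CotangentModule p m)
  map_add' f g := by
    rw [← UniformSpace.Completion.coe_add]
    exact congrArg _ (TensorProduct.tmul_add _ _ _)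
  map_smul' c f := by
    rw [RingHom.id_apply, ← UniformSpace.Completion.coe_smul]
    exact congrArg _ (TensorProduct.tmul_smul _ _ _)

/-- The pointwise norm `|ω| ∈ L^p(m)` on the cotangent module: the nonnegative function whose
`L^p(m)`-norm over each Borel set `E` is the norm of `1_E ω`. -/
def cotangentNorm (ω : CotangentModule p m) : X →ₘ[m] ℝ :=
  Classical.epsilon fun g => g ∈ Lp ℝ p m ∧ 0 ≤ g ∧
    ∀ (E : Set X) (hE : MeasurableSet E),
      normLp p ((charFun m E hE : X →ₘ[m] ℝ) * g) = ‖charFun m E hE • ω‖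

/-- The tangent module `L^q(TX)`, the dual of `L^p(T*X)` (where `1/p + 1/q = 1`). -/
abbrev TangentModule : Submodule (Linfty m) (CotangentModule p m →ₗ[Linfty m] LpModule 1 m) :=
  dualModule p m (cotangentNorm p m)

/-- The pointwise norm on the tangent module. -/
abbrev tangentNorm (v : TangentModule p m) : X →ₘ[m] ℝ := dualNorm p m (cotangentNorm p m) v

end Cotangent

/-! ### Sobolev derivations -/

section Derivations

variable {X : Type*} [MetricSpace X] [MeasurableSpace X]
variable (p q : ℝ≥0∞) [Fact (1 ≤ p)] [Fact (p ≠ ∞)] (m : Measure X)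

/-- The functions `g ∈ L^q(m)`, `g ≥ 0`, with `|δ(f)| ≤ g |Df|` a.e. for all `f ∈ W^{1,p}(X)`. -/
def derivationBounds (δ : sobolevSpace p m →ₗ[ℝ] LpModule 1 m) : Set (X →ₘ[m] ℝ) :=
  {g | g ∈ Lp ℝ q m ∧ 0 ≤ g ∧
    ∀ f : sobolevSpace p m, |(δ f : X →ₘ[m] ℝ)| ≤ g * (minGrad p m f : X →ₘ[m] ℝ)}

/-- The Sobolev tangent module `L^q_Sob(TX)` of all Sobolev `q`-derivations, with the operations
`(δ + δ')(f) = δ(f) + δ'(f)` and `(hδ)(f) = h δ(f)`. -/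
def SobolevDerivation : Submodule (Linfty m) (sobolevSpace p m →ₗ[ℝ] LpModule 1 m) where
  carrier := {δ | (derivationBounds p q m δ).Nonempty}
  add_mem' := by
    rintro δ ε ⟨g, hg, hg0, hgδ⟩ ⟨h, hh, hh0, hhε⟩
    refine ⟨g + h, (Lp ℝ q m).add_mem hg hh, ?_, fun f => ?_⟩
    · rw [← AEEqFun.coeFn_le] at *
      filter_upwards [hg0, hh0, AEEqFun.coeFn_add g h, AEEqFun.coeFn_zero (β := ℝ) (μ := m)]
        with x e1 e2 e3 e4
      rw [e3, e4]
      rw [e4] at e1 e2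
      exact add_nonneg e1 e2
    · have h1 := hgδ f
      have h2 := hhε f
      change |(δ f : X →ₘ[m] ℝ) + (ε f : X →ₘ[m] ℝ)| ≤ _
      rw [← AEEqFun.coeFn_le] at *
      filter_upwards [h1, h2, AEEqFun.coeFn_add g h,
        AEEqFun.coeFn_abs ((δ f : X →ₘ[m] ℝ) + (ε f : X →ₘ[m] ℝ)),
        AEEqFun.coeFn_abs (δ f : X →ₘ[m] ℝ), AEEqFun.coeFn_abs (ε f : X →ₘ[m] ℝ),
        AEEqFun.coeFn_add (δ f : X →ₘ[m] ℝ) (ε f : X →ₘ[m] ℝ),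
        AEEqFun.coeFn_mul g (minGrad p m f : X →ₘ[m] ℝ),
        AEEqFun.coeFn_mul h (minGrad p m f : X →ₘ[m] ℝ),
        AEEqFun.coeFn_mul (g + h) (minGrad p m f : X →ₘ[m] ℝ)]
        with x e1 e2 e3 e4 e5 e6 e7 e8 e9 e10
      rw [e4, e7, e10, Pi.add_apply, Pi.mul_apply, e3, Pi.add_apply, add_mul]
      rw [e5, e8, Pi.mul_apply] at e1
      rw [e6, e9, Pi.mul_apply] at e2
      exact (abs_add_le _ _).trans (add_le_add e1 e2)
  zero_mem' := by
    refine ⟨0, (Lp ℝ q m).zero_mem, le_rfl, fun f => ?_⟩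
    change |(0 : X →ₘ[m] ℝ)| ≤ _
    rw [zero_mul, abs, neg_zero, sup_idem]
  smul_mem' := by
    rintro h δ ⟨g, hg, hg0, hgδ⟩
    refine ⟨|(h : X →ₘ[m] ℝ)| * g, mul_mem_Lp (abs_mem_Lp h.2) hg, ?_, fun f => ?_⟩
    · rw [← AEEqFun.coeFn_le] at *
      filter_upwards [hg0, AEEqFun.coeFn_mul |(h : X →ₘ[m] ℝ)| g,
        AEEqFun.coeFn_abs (h : X →ₘ[m] ℝ), AEEqFun.coeFn_zero (β := ℝ) (μ := m)] with x e1 e2 e3 e4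
      rw [e2, e4, Pi.mul_apply, e3]
      rw [e4] at e1
      exact mul_nonneg (abs_nonneg _) e1
    · have h1 := hgδ f
      change |(h : X →ₘ[m] ℝ) * (δ f : X →ₘ[m] ℝ)| ≤ _
      rw [← AEEqFun.coeFn_le] at *
      filter_upwards [h1, AEEqFun.coeFn_abs ((h : X →ₘ[m] ℝ) * (δ f : X →ₘ[m] ℝ)),
        AEEqFun.coeFn_mul (h : X →ₘ[m] ℝ) (δ f : X →ₘ[m] ℝ),
        AEEqFun.coeFn_abs (δ f : X →ₘ[m] ℝ), AEEqFun.coeFn_abs (h : X →ₘ[m] ℝ),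
        AEEqFun.coeFn_mul g (minGrad p m f : X →ₘ[m] ℝ),
        AEEqFun.coeFn_mul |(h : X →ₘ[m] ℝ)| g,
        AEEqFun.coeFn_mul (|(h : X →ₘ[m] ℝ)| * g) (minGrad p m f : X →ₘ[m] ℝ)]
        with x e1 e2 e3 e4 e5 e6 e7 e8
      rw [e2, e3, Pi.mul_apply, e8, Pi.mul_apply, e7, Pi.mul_apply, e5, abs_mul, mul_assoc]
      rw [e4, e6, Pi.mul_apply] at e1
      exact mul_le_mul_of_nonneg_left e1 (abs_nonneg _)

instance instAddCommGroupSobolevDerivation : AddCommGroup (SobolevDerivation p q m) :=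
  Submodule.addCommGroup _

instance instModuleSobolevDerivation : Module (Linfty m) (SobolevDerivation p q m) :=
  Submodule.module _

instance instSMulSobolevDerivation : SMul (Linfty m) (SobolevDerivation p q m) :=
  (instModuleSobolevDerivation p q m).toSMul

/-- The pointwise norm `|δ|` of a Sobolev `q`-derivation: the infimum, in the lattice `L⁰(m)`, of
all admissible functions `g`. -/
def derivationNorm (δ : SobolevDerivation p q m) : X →ₘ[m] ℝ :=
  Classical.epsilon fun g =>
    IsGLB (derivationBounds p q m (δ : sobolevSpace p m →ₗ[ℝ] LpModule 1 m)) g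

/-- The differential of a Sobolev function. -/
def sobolevDifferential (f : sobolevSpace p m) : CotangentModule p m :=
  differential p m ⟨f.1, f.2.1⟩

end Derivations

end

end SobolevTangent

open SobolevTangent

namespace SobolevTangent

noncomputable section

/-! ### Constant-speed reparametrisations and their restrictions to subintervals -/

section ConstantSpeed

variable {X : Type*} [MetricSpace X]

/-! A derivation `δ` sees only `W^{1,p}`, whereas the cotangent module is generated by the
differentials of the larger space `D^{1,p}`. What bridges the gap is locality: `|Df| = 0` a.e. on
`{f = 0}` (`minGrad_eq_zero_of_eq_zero`), hence `δ f = δ f'` a.e. on `{f = f'}`. A Dirichlet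
function `f` agrees at a.e. point, for all large `n`, with `f` cut off between `-v n` and `v n`,
where `v n = max (n - d(·, x₀)) 0`. This cut-off is in `W^{1,p}` because balls have finite measure
(`exists_sobolev_truncation`). So `δ` extends to `D^{1,p}`, its values being read off pointwise from
the truncations, with the same bound `|δ| |Df|` (`exists_dirichlet_extension`).

The extension `D` induces `∑ gᵢ dfᵢ ↦ ∑ gᵢ D(fᵢ)` on formal forms, bounded by `|δ| ∑ |gᵢ| |Dfᵢ|` for
every representation of the form. The pointwise norm of a form is the infimum of these sums, so the
map is bounded by `|δ|` times the pointwise norm and extends to the completion (`exists_lift`). This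
gives `I(δ)` with `|I(δ)(ω)| ≤ |δ| |ω|`, whence `|I(δ)| ≤ |δ|`. Conversely `|v(ω)| ≤ |v| |ω|` for
every tangent field `v` (`abs_le_mul_of_isLUB`), so `v ∘ d` is a derivation with bound `|v|`; this
yields surjectivity and `|δ| ≤ |I(δ)|`. Uniqueness is density of formal forms together with locality
(`tangent_ext`). Completeness and glueing are proved for derivations and carried to the tangent
module through `I`.

Three ingredients concern the definitions themselves.

Existence of `|Df|`: a family of curves has modulus zero exactly if some `σ` of finite `p`-energy
has infinite integral along each of its members (`modulus_eq_zero_iff`). On the remaining curves `f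
∘ γ` is absolutely continuous with derivative bounded by every weak upper gradient in play. Weak
upper gradients are therefore stable under minima and countable infima, and a directed infimum in
`L⁰(m)` is a sequential one. The same one-variable picture gives locality.

The identity `|df| = |Df|`: one must show `|Df| ≤ ∑ |gᵢ| |Dfᵢ|` whenever `1 ⊗ f = ∑ gᵢ ⊗ fᵢ`. For
constant coefficients this is the triangle inequality. In general the equational criterion for
vanishing tensors puts the coefficient vector at a.e. point into a linear space of constant
relations, and a countable dense subset of that space reduces the claim to constants
(`abs_mul_minGrad_le_of_sum_eq_zero`).

The norm on the dual: the converse of Hölder's inequality bounds all `T(v)`, `|v| ≤ 1`, uniformly in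
`L^q`, so that their directed supremum is finite a.e. and in `L^q` (`exists_isLUB_dualValues`). -/

lemma Curve.continuousOn_variation (γ : Curve X) (h : γ.Rectifiable) :
    ContinuousOn (variationOnFromTo γ.toFun (Icc γ.a γ.b) γ.a) (Icc γ.a γ.b) := by
  have hbv : BoundedVariationOn γ.toFun (Icc γ.a γ.b) := h.ne
  have hl := hbv.locallyBoundedVariationOn
  have ha : γ.a ∈ Icc γ.a γ.b := left_mem_Icc.2 γ.lt.le
  intro x hx
  have h1 := hbv.tendsto_eVariationOn_Icc_zero_left (x := x)
    ((γ.continuousOn x hx).mono inter_subset_left)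
  have h2 := hbv.tendsto_eVariationOn_Icc_zero_right x
    ((γ.continuousOn x hx).mono inter_subset_left)
  -- The increment between `y` and `x` is at most the sum of the variations over `[y, x]` and `[x,
  -- y]`, one of which is over at most a point; adding the two one-sided limits treats both orders
  -- at once.
  rw [ContinuousWithinAt, tendsto_iff_dist_tendsto_zero]
  have h3 := h1.add h2
  rw [add_zero] at h3
  have h4 := (ENNReal.tendsto_toReal ENNReal.zero_ne_top).comp h3
  refine squeeze_zero' (Eventually.of_forall fun _ => dist_nonneg) ?_ h4
  filter_upwards [self_mem_nhdsWithin] with y hy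
  have hfin : eVariationOn γ.toFun (Icc γ.a γ.b ∩ Icc y x)
      + eVariationOn γ.toFun (Icc γ.a γ.b ∩ Icc x y) ≠ ∞ :=
    ENNReal.add_ne_top.2 ⟨hl y x hy hx, hl x y hx hy⟩
  rw [Real.dist_eq, variationOnFromTo.sub_right hl ha hy hx]
  rcases le_total x y with hxy | hxy
  · rw [variationOnFromTo.eq_of_le _ _ hxy, abs_of_nonneg ENNReal.toReal_nonneg]
    exact ENNReal.toReal_mono hfin le_add_self
  · rw [variationOnFromTo.eq_of_ge _ _ hxy, abs_neg, abs_of_nonneg ENNReal.toReal_nonneg]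
    exact ENNReal.toReal_mono hfin le_self_add

lemma Curve.variation_b (γ : Curve X) :
    variationOnFromTo γ.toFun (Icc γ.a γ.b) γ.a γ.b = γ.length.toReal := by
  rw [variationOnFromTo.eq_of_le _ _ γ.lt.le, inter_self]; rfl

lemma Curve.image_variation (γ : Curve X) (h : γ.Rectifiable) :
    variationOnFromTo γ.toFun (Icc γ.a γ.b) γ.a '' Icc γ.a γ.b = Icc 0 γ.length.toReal := by
  have hbv : BoundedVariationOn γ.toFun (Icc γ.a γ.b) := h.ne
  have ha : γ.a ∈ Icc γ.a γ.b := left_mem_Icc.2 γ.lt.le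
  have hb : γ.b ∈ Icc γ.a γ.b := right_mem_Icc.2 γ.lt.le
  have hm := variationOnFromTo.monotoneOn hbv.locallyBoundedVariationOn ha
  rw [← γ.variation_b, ← variationOnFromTo.self γ.toFun (Icc γ.a γ.b) γ.a]
  refine Subset.antisymm ?_ (intermediate_value_Icc γ.lt.le (γ.continuousOn_variation h))
  rintro _ ⟨x, hx, rfl⟩
  exact ⟨hm ha hx hx.1, hm hx hb hx.2⟩

/-- The natural parameterization has unit speed on the image of the variation function, which by
continuity is all of `[0, length]`; precomposing with multiplication by the length multiplies the
speed. A curve of length zero needs no separate treatment. -/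
lemma Curve.hasConstantSpeedOnWith (γ : Curve X) (h : γ.Rectifiable) :
    HasConstantSpeedOnWith γ.constSpeed (Icc 0 1) γ.length.toNNReal := by
  have hbv : BoundedVariationOn γ.toFun (Icc γ.a γ.b) := h.ne
  have ha : γ.a ∈ Icc γ.a γ.b := left_mem_Icc.2 γ.lt.le
  have hu := has_unit_speed_naturalParameterization γ.toFun hbv.locallyBoundedVariationOn ha
  rw [γ.image_variation h] at hu
  have hL : 0 ≤ γ.length.toReal := ENNReal.toReal_nonneg
  have hmem : ∀ t ∈ Icc (0 : ℝ) 1, γ.length.toReal * t ∈ Icc 0 γ.length.toReal := fun t ht =>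
    ⟨mul_nonneg hL ht.1, mul_le_of_le_one_right hL ht.2⟩
  have himg : (fun t => γ.length.toReal * t) '' Icc (0 : ℝ) 1 = Icc 0 γ.length.toReal := by
    refine Subset.antisymm ?_ ?_
    · rintro _ ⟨t, ht, rfl⟩; exact hmem t ht
    · have := intermediate_value_Icc (f := fun t => γ.length.toReal * t) (zero_le_one (α := ℝ))
        (by fun_prop)
      simpa using this
  intro x hx y hy
  have h1 := eVariationOn.comp_inter_Icc_eq_of_monotoneOn
    (naturalParameterization γ.toFun (Icc γ.a γ.b) γ.a) (t := Icc (0 : ℝ) 1)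
    (fun t => γ.length.toReal * t) (fun s _ t _ hst => mul_le_mul_of_nonneg_left hst hL) hx hy
  rw [himg] at h1
  refine h1.trans ((hu (hmem x hx) (hmem y hy)).trans ?_)
  congr 1
  simp only [NNReal.coe_one, ENNReal.coe_toNNReal_eq_toReal]
  ring

lemma Curve.constSpeed_zero (γ : Curve X) (h : γ.Rectifiable) :
    γ.constSpeed 0 = γ.toFun γ.a := by
  have hbv : BoundedVariationOn γ.toFun (Icc γ.a γ.b) := h.ne
  have ha : γ.a ∈ Icc γ.a γ.b := left_mem_Icc.2 γ.lt.le
  have := edist_naturalParameterization_eq_zero hbv.locallyBoundedVariationOn ha ha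
  rw [variationOnFromTo.self] at this
  rw [Curve.constSpeed, mul_zero]
  exact edist_eq_zero.1 this

lemma Curve.constSpeed_one (γ : Curve X) (h : γ.Rectifiable) :
    γ.constSpeed 1 = γ.toFun γ.b := by
  have hbv : BoundedVariationOn γ.toFun (Icc γ.a γ.b) := h.ne
  have ha : γ.a ∈ Icc γ.a γ.b := left_mem_Icc.2 γ.lt.le
  have hb : γ.b ∈ Icc γ.a γ.b := right_mem_Icc.2 γ.lt.le
  have := edist_naturalParameterization_eq_zero hbv.locallyBoundedVariationOn ha hb
  rw [variation_b] at this
  rw [Curve.constSpeed, mul_one]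
  exact edist_eq_zero.1 this

lemma lipschitzOnWith_of_hasConstantSpeedOnWith {c : ℝ → X} {s : Set ℝ} {l : ℝ≥0}
    (h : HasConstantSpeedOnWith c s l) : LipschitzOnWith l c s := by
  have key : ∀ x ∈ s, ∀ y ∈ s, x ≤ y → edist (c x) (c y) ≤ l * edist x y := by
    intro x hx y hy hxy
    have h1 := eVariationOn.edist_le c (s := s ∩ Icc x y) ⟨hx, left_mem_Icc.2 hxy⟩
      ⟨hy, right_mem_Icc.2 hxy⟩
    rw [h hx hy, ENNReal.ofReal_mul (NNReal.coe_nonneg _), ENNReal.ofReal_coe_nnreal] at h1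
    rwa [edist_comm x y, edist_dist y x, Real.dist_eq, abs_of_nonneg (sub_nonneg.2 hxy)]
  intro x hx y hy
  rcases le_total x y with hxy | hxy
  · exact key x hx y hy hxy
  · rw [edist_comm, edist_comm x]; exact key y hy x hx hxy

lemma Curve.lipschitzOnWith_constSpeed (γ : Curve X) (h : γ.Rectifiable) :
    LipschitzOnWith γ.length.toNNReal γ.constSpeed (Icc 0 1) :=
  lipschitzOnWith_of_hasConstantSpeedOnWith (γ.hasConstantSpeedOnWith h)

lemma Curve.continuousOn_constSpeed (γ : Curve X) (h : γ.Rectifiable) :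
    ContinuousOn γ.constSpeed (Icc 0 1) :=
  (γ.lipschitzOnWith_constSpeed h).continuousOn

/-- The restriction of the constant-speed reparametrisation of `γ` to `[s, t] ⊆ [0, 1]`. -/
def Curve.sub (γ : Curve X) (h : γ.Rectifiable) {s t : ℝ} (hs : 0 ≤ s) (hst : s < t)
    (ht : t ≤ 1) : Curve X where
  a := s
  b := t
  lt := hst
  toFun := γ.constSpeed
  continuousOn := (γ.continuousOn_constSpeed h).mono (Icc_subset_Icc hs ht)

lemma Curve.length_sub (γ : Curve X) (h : γ.Rectifiable) {s t : ℝ} (hs : 0 ≤ s) (hst : s < t)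
    (ht : t ≤ 1) : (γ.sub h hs hst ht).length = γ.length * ENNReal.ofReal (t - s) := by
  have h1 := γ.hasConstantSpeedOnWith h (x := s) ⟨hs, hst.le.trans ht⟩ (y := t)
    ⟨hs.trans hst.le, ht⟩
  rw [inter_eq_self_of_subset_right (Icc_subset_Icc hs ht), ENNReal.ofReal_mul (NNReal.coe_nonneg _),
    ENNReal.ofReal_coe_nnreal, ENNReal.coe_toNNReal h.ne] at h1
  exact h1

lemma Curve.rectifiable_sub (γ : Curve X) (h : γ.Rectifiable) {s t : ℝ} (hs : 0 ≤ s)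
    (hst : s < t) (ht : t ≤ 1) : (γ.sub h hs hst ht).Rectifiable := by
  rw [Curve.Rectifiable, length_sub]
  exact ENNReal.mul_lt_top h ENNReal.ofReal_lt_top

/-- At time `s + (t - s) * r` the restricted curve has run through the share `r` of its length,
because its speed is constant. The natural parameterization returns a point at distance zero from
the one with that arc length. -/
lemma Curve.constSpeed_sub (γ : Curve X) (h : γ.Rectifiable) {s t : ℝ} (hs : 0 ≤ s)
    (hst : s < t) (ht : t ≤ 1) {r : ℝ} (hr : r ∈ Icc (0 : ℝ) 1) :
    (γ.sub h hs hst ht).constSpeed r = γ.constSpeed (s + (t - s) * r) := by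
  have hr' := γ.rectifiable_sub h hs hst ht
  have hbv : BoundedVariationOn γ.constSpeed (Icc s t) := hr'.ne
  have hx : s + (t - s) * r ∈ Icc s t :=
    ⟨by nlinarith [hr.1], by nlinarith [hr.2]⟩
  have h1 := edist_naturalParameterization_eq_zero hbv.locallyBoundedVariationOn
    (left_mem_Icc.2 hst.le) hx
  have h2 : variationOnFromTo γ.constSpeed (Icc s t) s (s + (t - s) * r)
      = (γ.sub h hs hst ht).length.toReal * r := by
    rw [length_sub, variationOnFromTo.eq_of_le _ _ hx.1,
      inter_eq_self_of_subset_right (Icc_subset_Icc_right hx.2)]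
    have h3 := γ.hasConstantSpeedOnWith h (x := s) ⟨hs, hst.le.trans ht⟩ (y := s + (t - s) * r)
      ⟨hs.trans hx.1, hx.2.trans ht⟩
    rw [inter_eq_self_of_subset_right (Icc_subset_Icc hs (hx.2.trans ht))] at h3
    rw [h3, add_sub_cancel_left, ENNReal.toReal_mul,
      ENNReal.toReal_ofReal (sub_nonneg.2 hst.le), ENNReal.toReal_ofReal]
    · simp only [ENNReal.coe_toNNReal_eq_toReal]; ring
    · exact mul_nonneg (NNReal.coe_nonneg _) (mul_nonneg (sub_nonneg.2 hst.le) hr.1)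
  rw [h2] at h1
  exact edist_eq_zero.1 h1

lemma Curve.pathIntegral_eq (γ : Curve X) (h : γ.Rectifiable) (ρ : X → ℝ≥0∞) :
    γ.pathIntegral ρ = γ.length * ∫⁻ t in Icc (0 : ℝ) 1, ρ (γ.constSpeed t) := if_pos h

/-- The affine change of variables `[0, 1] → [s, t]` cancels the factor `t - s` in the length. This
lets an inequality assumed for whole curves be used between any two times of one curve. -/
lemma Curve.pathIntegral_sub (γ : Curve X) (h : γ.Rectifiable) {s t : ℝ} (hs : 0 ≤ s)
    (hst : s < t) (ht : t ≤ 1) (ρ : X → ℝ≥0∞) :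
    (γ.sub h hs hst ht).pathIntegral ρ
      = γ.length * ∫⁻ r in Icc s t, ρ (γ.constSpeed r) := by
  rw [Curve.pathIntegral_eq _ (γ.rectifiable_sub h hs hst ht), length_sub, mul_assoc]
  congr 1
  have himg : (fun r => s + (t - s) * r) '' Icc (0 : ℝ) 1 = Icc s t := by
    refine Subset.antisymm ?_ ?_
    · rintro _ ⟨r, hr, rfl⟩
      exact ⟨by nlinarith [hr.1], by nlinarith [hr.2]⟩
    · have := intermediate_value_Icc (f := fun r => s + (t - s) * r) (zero_le_one (α := ℝ))
        (by fun_prop)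
      simpa using this
  have hinj : InjOn (fun r => s + (t - s) * r) (Icc (0 : ℝ) 1) := fun x _ y _ hxy => by
    have : t - s ≠ 0 := (sub_pos.2 hst).ne'
    simpa [this] using hxy
  rw [← himg, lintegral_image_eq_lintegral_abs_deriv_mul measurableSet_Icc
    (f' := fun _ => t - s) (fun x _ => ?_) hinj, abs_of_pos (sub_pos.2 hst),
    lintegral_const_mul' _ _ ENNReal.ofReal_ne_top]
  · congr 1
    exact setLIntegral_congr_fun measurableSet_Icc fun r hr => by
      simp only [γ.constSpeed_sub h hs hst ht hr]
  · simpa using (((hasDerivAt_id x).const_mul (t - s)).const_add s).hasDerivWithinAt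

lemma Curve.pathIntegral_const_mul (γ : Curve X) {c : ℝ≥0∞} (hc : c ≠ 0) (hc' : c ≠ ∞)
    (ρ : X → ℝ≥0∞) :
    γ.pathIntegral (fun x => c * ρ x) = c * γ.pathIntegral ρ := by
  by_cases h : γ.Rectifiable
  · simp only [Curve.pathIntegral_eq _ h]
    rw [lintegral_const_mul' _ _ hc', mul_left_comm]
  · simp [Curve.pathIntegral, h, ENNReal.mul_top hc]

variable [MeasurableSpace X] [BorelSpace X]

lemma Curve.aemeasurable_comp (γ : Curve X) (h : γ.Rectifiable) {ρ : X → ℝ≥0∞}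
    (hρ : Measurable ρ) {s : Set ℝ} (hs : s ⊆ Icc 0 1) (hs' : MeasurableSet s) :
    AEMeasurable (fun t => ρ (γ.constSpeed t)) (volume.restrict s) :=
  hρ.comp_aemeasurable (((γ.continuousOn_constSpeed h).mono hs).aemeasurable hs')

lemma Curve.pathIntegral_add (γ : Curve X) {ρ σ : X → ℝ≥0∞} (hρ : Measurable ρ) :
    γ.pathIntegral (fun x => ρ x + σ x) = γ.pathIntegral ρ + γ.pathIntegral σ := by
  by_cases h : γ.Rectifiable
  · simp only [Curve.pathIntegral_eq _ h]
    rw [lintegral_add_left' (γ.aemeasurable_comp h hρ Subset.rfl measurableSet_Icc), mul_add]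
  · simp [Curve.pathIntegral, h]

end ConstantSpeed

/-! ### Modulus and exceptional families of curves -/

section Modulus

/-- Each term is at most the `p`-th root of the sum of all `p`-th powers. Combining countably many
functions by a supremum instead of a sum thus avoids Minkowski's inequality. -/
lemma lintegral_iSup_rpow_le {X : Type*} [MeasurableSpace X] {p : ℝ} (hp : 0 < p) {m : Measure X} {a : ℕ → X → ℝ≥0∞}
    (ha : ∀ n, Measurable (a n)) :
    ∫⁻ x, (⨆ n, a n x) ^ p ∂m ≤ ∑' n, ∫⁻ x, a n x ^ p ∂m := by
  rw [← lintegral_tsum fun n => ((ha n).pow_const p).aemeasurable]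
  refine lintegral_mono fun x => ?_
  have h : (⨆ n, a n x) ≤ (∑' n, a n x ^ p) ^ p⁻¹ := iSup_le fun n => by
    rw [ENNReal.le_rpow_inv_iff hp]
    exact ENNReal.le_tsum n
  exact (ENNReal.le_rpow_inv_iff hp).1 h

variable {X : Type*} [MetricSpace X] [MeasurableSpace X]

lemma toReal_pos_of_one_le {p : ℝ≥0∞} (hp : 1 ≤ p) (hp' : p ≠ ∞) : 0 < p.toReal :=
  ENNReal.toReal_pos (zero_lt_one.trans_le hp).ne' hp'

/-- Fuglede's criterion. If the modulus vanishes, there are admissible `ρ n` with energy so small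
that `2 ^ n * ρ n` has energy at most `2⁻¹ ^ (n + 1)`; their supremum has finite energy and integral
at least `2 ^ n` for every `n`. Conversely every positive multiple of `σ` is admissible, and its
energy tends to zero with the factor. -/
lemma modulus_eq_zero_iff {p : ℝ≥0∞} (hp : 1 ≤ p) (hp' : p ≠ ∞) {m : Measure X}
    {Γ : Set (Curve X)} :
    modulus p m Γ = 0 ↔ ∃ σ : X → ℝ≥0∞, Measurable σ ∧ ∫⁻ x, σ x ^ p.toReal ∂m < ∞ ∧
      ∀ γ ∈ Γ, γ.pathIntegral σ = ∞ := by
  have hpp := toReal_pos_of_one_le hp hp'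
  constructor
  · intro h
    have hex : ∀ n : ℕ, ∃ ρ : X → ℝ≥0∞, Measurable ρ ∧ (∀ γ ∈ Γ, 1 ≤ γ.pathIntegral ρ) ∧
        ((2 : ℝ≥0∞) ^ n) ^ p.toReal * ∫⁻ x, ρ x ^ p.toReal ∂m ≤ 2⁻¹ ^ (n + 1) := by
      intro n
      have h2 : ((2 : ℝ≥0∞) ^ n) ^ p.toReal ≠ ∞ :=
        ENNReal.rpow_ne_top_of_nonneg hpp.le (by simp)
      have h3 : modulus p m Γ < 2⁻¹ ^ (n + 1) / ((2 : ℝ≥0∞) ^ n) ^ p.toReal := by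
        rw [h]
        exact ENNReal.div_pos (by simp) h2
      unfold modulus at h3
      simp only [iInf_lt_iff] at h3
      obtain ⟨ρ, h4, h5, h6⟩ := h3
      refine ⟨ρ, h4, h5, ?_⟩
      rw [mul_comm]
      exact ENNReal.mul_le_of_le_div h6.le
    choose ρ h1 h2 h3 using hex
    refine ⟨fun x => ⨆ n, 2 ^ n * ρ n x, Measurable.iSup fun n => (h1 n).const_mul _, ?_, ?_⟩
    · refine (lintegral_iSup_rpow_le hpp fun n => (h1 n).const_mul _).trans_lt ?_
      refine (ENNReal.tsum_le_tsum fun n => ?_).trans_lt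
        (ENNReal.tsum_geometric_add_one 2⁻¹ ▸ ?_ : ∑' n : ℕ, (2⁻¹ : ℝ≥0∞) ^ (n + 1) < ∞)
      · simp_rw [ENNReal.mul_rpow_of_nonneg _ _ hpp.le]
        rw [lintegral_const_mul _ ((h1 n).pow_const _)]
        exact h3 n
      · rw [ENNReal.one_sub_inv_two, inv_inv]
        exact ENNReal.mul_lt_top (by simp) (by simp)
    · intro γ hγ
      refine ENNReal.eq_top_of_forall_nnreal_le fun r => ?_
      obtain ⟨n, hn⟩ := pow_unbounded_of_one_lt r (one_lt_two : (1 : ℝ≥0) < 2)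
      calc (r : ℝ≥0∞) ≤ 2 ^ n := by exact_mod_cast hn.le
        _ = 2 ^ n * 1 := (mul_one _).symm
        _ ≤ 2 ^ n * γ.pathIntegral (ρ n) := mul_le_mul_right (h2 n γ hγ) _
        _ = γ.pathIntegral fun x => 2 ^ n * ρ n x :=
          (γ.pathIntegral_const_mul (by simp) (by simp) _).symm
        _ ≤ _ := γ.pathIntegral_mono fun x => le_iSup (fun n => 2 ^ n * ρ n x) n
  · rintro ⟨σ, h1, h2, h3⟩
    have hle : ∀ c : ℝ≥0, 0 < c → modulus p m Γ ≤ (c : ℝ≥0∞) ^ p.toReal *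
        ∫⁻ x, σ x ^ p.toReal ∂m := by
      intro c hc
      refine iInf_le_of_le (fun x => c * σ x) (iInf_le_of_le (h1.const_mul _)
        (iInf_le_of_le (fun γ hγ => ?_) ?_))
      · rw [γ.pathIntegral_const_mul (by simpa using hc.ne') (by simp), h3 γ hγ,
          ENNReal.mul_top (by simpa using hc.ne')]
        exact le_top
      · simp_rw [ENNReal.mul_rpow_of_nonneg _ _ hpp.le]
        rw [lintegral_const_mul _ (h1.pow_const _)]
    have htend : Tendsto (fun c : ℝ≥0 => (c : ℝ≥0∞) ^ p.toReal * ∫⁻ x, σ x ^ p.toReal ∂m)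
        (𝓝[>] 0) (𝓝 0) := by
      have h4 : Tendsto (fun c : ℝ≥0 => (c : ℝ≥0∞) ^ p.toReal) (𝓝[>] 0) (𝓝 0) := by
        have : Tendsto (fun c : ℝ≥0 => (c : ℝ≥0∞) ^ p.toReal) (𝓝 0) (𝓝 ((0 : ℝ≥0∞) ^ p.toReal)) :=
          ((ENNReal.continuous_rpow_const).comp ENNReal.continuous_coe).tendsto' _ _ (by simp)
        rw [ENNReal.zero_rpow_of_pos hpp] at this
        exact this.mono_left nhdsWithin_le_nhds
      simpa using ENNReal.Tendsto.mul_const h4 (Or.inr h2.ne)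
    refine le_antisymm (ge_of_tendsto htend ?_) bot_le
    filter_upwards [self_mem_nhdsWithin] with c hc using hle c hc

/-- Countably many exceptional families are contained in a single one. -/
lemma exists_dominating {p : ℝ≥0∞} (hp : 1 ≤ p) (hp' : p ≠ ∞) {m : Measure X}
    {σ : ℕ → X → ℝ≥0∞} (hσ : ∀ n, Measurable (σ n))
    (hσ' : ∀ n, ∫⁻ x, σ n x ^ p.toReal ∂m < ∞) :
    ∃ τ : X → ℝ≥0∞, Measurable τ ∧ ∫⁻ x, τ x ^ p.toReal ∂m < ∞ ∧
      ∀ γ : Curve X, γ.pathIntegral τ < ∞ → ∀ n, γ.pathIntegral (σ n) < ∞ := by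
  have hpp := toReal_pos_of_one_le hp hp'
  set I := fun n => ∫⁻ x, σ n x ^ p.toReal ∂m
  -- Chosen so that `c n * σ n`, with `c n` the `p`-th root of `b n`, has energy at most `2⁻¹ ^ (n +
  -- 1)`; the summand `1` avoids division by zero.
  set b : ℕ → ℝ≥0∞ := fun n => 2⁻¹ ^ (n + 1) / (1 + I n) with hb
  have hI : ∀ n, 1 + I n ≠ ∞ := fun n => ENNReal.add_ne_top.2 ⟨ENNReal.one_ne_top, (hσ' n).ne⟩
  have hI0 : ∀ n, 1 + I n ≠ 0 := fun n => by simp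
  have hb0 : ∀ n, b n ≠ 0 := fun n => (ENNReal.div_pos (by simp) (hI n)).ne'
  have hbt : ∀ n, b n ≠ ∞ := fun n => ENNReal.div_ne_top (by simp) (hI0 n)
  set c : ℕ → ℝ≥0∞ := fun n => b n ^ (1 / p.toReal)
  have hc0 : ∀ n, c n ≠ 0 := fun n => (ENNReal.rpow_pos (hb0 n).bot_lt (hbt n)).ne'
  have hct : ∀ n, c n ≠ ∞ := fun n => ENNReal.rpow_ne_top_of_nonneg (by positivity) (hbt n)
  have hcb : ∀ n, c n ^ p.toReal = b n := fun n => by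
    simp only [c]
    rw [← ENNReal.rpow_mul, one_div_mul_cancel hpp.ne', ENNReal.rpow_one]
  refine ⟨fun x => ⨆ n, c n * σ n x, Measurable.iSup fun n => (hσ n).const_mul _, ?_, ?_⟩
  · refine (lintegral_iSup_rpow_le hpp fun n => (hσ n).const_mul _).trans_lt ?_
    refine (ENNReal.tsum_le_tsum fun n => ?_).trans_lt
      (ENNReal.tsum_geometric_add_one 2⁻¹ ▸ ?_ : ∑' n : ℕ, (2⁻¹ : ℝ≥0∞) ^ (n + 1) < ∞)
    · simp_rw [ENNReal.mul_rpow_of_nonneg _ _ hpp.le]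
      rw [lintegral_const_mul _ ((hσ n).pow_const _), hcb]
      calc b n * I n ≤ b n * (1 + I n) := mul_le_mul_right le_add_self _
        _ = 2⁻¹ ^ (n + 1) := ENNReal.div_mul_cancel (hI0 n) (hI n)
    · rw [ENNReal.one_sub_inv_two, inv_inv]
      exact ENNReal.mul_lt_top (by simp) (by simp)
  · intro γ hγ n
    have h1 : c n * γ.pathIntegral (σ n) < ∞ := by
      rw [← γ.pathIntegral_const_mul (hc0 n) (hct n)]
      exact (γ.pathIntegral_mono fun x => le_iSup (fun n => c n * σ n x) n).trans_lt hγ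
    exact lt_top_iff_ne_top.2 fun h => by
      rw [h, ENNReal.mul_top (hc0 n)] at h1; exact lt_irrefl _ h1

/-- A Borel function with finite `p`-energy is a weak `p`-upper gradient of `f` exactly if the
upper gradient inequality holds along all curves on which some `p`-integrable function has a
finite integral. -/
lemma isWeakUpperGradient_iff {p : ℝ≥0∞} (hp : 1 ≤ p) (hp' : p ≠ ∞) {m : Measure X}
    {f : X → ℝ} {ρ : X → ℝ≥0∞} :
    IsWeakUpperGradient p m f ρ ↔ Measurable ρ ∧ ∫⁻ x, ρ x ^ p.toReal ∂m < ∞ ∧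
      ∃ σ : X → ℝ≥0∞, Measurable σ ∧ ∫⁻ x, σ x ^ p.toReal ∂m < ∞ ∧
        ∀ γ : Curve X, γ.Rectifiable → γ.pathIntegral σ < ∞ →
          ENNReal.ofReal |f (γ.toFun γ.b) - f (γ.toFun γ.a)| ≤ γ.pathIntegral ρ := by
  unfold IsWeakUpperGradient
  rw [modulus_eq_zero_iff hp hp']
  refine and_congr_right fun _ => and_congr_right fun _ => exists_congr fun σ =>
    and_congr_right fun _ => and_congr_right fun _ => ⟨fun h γ hr hγ => ?_, ?_⟩
  · by_contra hcon
    exact hγ.ne (h γ ⟨hr, hcon⟩)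
  · rintro h γ ⟨hr, hγ⟩
    by_contra hcon
    exact hγ (h γ hr (lt_top_iff_ne_top.2 hcon))

/-- If `σ` has finite integral along a curve, it has finite integral along each of its subcurves. So
no subcurve of a good curve is exceptional, and the inequality holds between all pairs of times. -/
lemma IsWeakUpperGradient.exists_exceptional {p : ℝ≥0∞} (hp : 1 ≤ p) (hp' : p ≠ ∞)
    {m : Measure X} {f : X → ℝ} {ρ : X → ℝ≥0∞} (h : IsWeakUpperGradient p m f ρ) :
    ∃ σ : X → ℝ≥0∞, Measurable σ ∧ ∫⁻ x, σ x ^ p.toReal ∂m < ∞ ∧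
      ∀ γ : Curve X, γ.Rectifiable → γ.pathIntegral σ < ∞ → ∀ s t, 0 ≤ s → s ≤ t → t ≤ 1 →
        ENNReal.ofReal |f (γ.constSpeed t) - f (γ.constSpeed s)|
          ≤ γ.length * ∫⁻ r in Icc s t, ρ (γ.constSpeed r) := by
  obtain ⟨-, -, σ, h1, h2, h3⟩ := (isWeakUpperGradient_iff hp hp').1 h
  refine ⟨σ, h1, h2, fun γ hγ hfin s t hs hst ht => ?_⟩
  rcases hst.eq_or_lt with rfl | hst
  · simp
  rw [← γ.pathIntegral_sub hγ hs hst ht]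
  refine h3 (γ.sub hγ hs hst ht) (γ.rectifiable_sub hγ hs hst ht) (lt_of_le_of_lt ?_ hfin)
  rw [γ.pathIntegral_sub hγ hs hst ht, γ.pathIntegral_eq hγ]
  exact mul_le_mul_right (lintegral_mono_set (Icc_subset_Icc hs ht)) _

/-- Curves of length zero have equal end points, the reparametrisation being Lipschitz with constant
zero, so only curves of positive length need to be tested. -/
lemma isWeakUpperGradient_of_constSpeed {p : ℝ≥0∞} (hp : 1 ≤ p) (hp' : p ≠ ∞)
    {m : Measure X} {f : X → ℝ} {ρ σ : X → ℝ≥0∞} (hρ : Measurable ρ)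
    (hρ' : ∫⁻ x, ρ x ^ p.toReal ∂m < ∞) (hσ : Measurable σ)
    (hσ' : ∫⁻ x, σ x ^ p.toReal ∂m < ∞)
    (h : ∀ γ : Curve X, γ.Rectifiable → 0 < γ.length → γ.pathIntegral σ < ∞ →
      ENNReal.ofReal |f (γ.constSpeed 1) - f (γ.constSpeed 0)|
        ≤ γ.length * ∫⁻ r in Icc (0 : ℝ) 1, ρ (γ.constSpeed r)) :
    IsWeakUpperGradient p m f ρ := by
  refine (isWeakUpperGradient_iff hp hp').2 ⟨hρ, hρ', σ, hσ, hσ', fun γ hγ hfin => ?_⟩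
  rw [γ.pathIntegral_eq hγ, ← γ.constSpeed_one hγ, ← γ.constSpeed_zero hγ]
  rcases eq_or_ne γ.length 0 with h0 | h0
  · have h1 := γ.lipschitzOnWith_constSpeed hγ (right_mem_Icc.2 zero_le_one)
      (left_mem_Icc.2 zero_le_one)
    rw [h0] at h1
    simp only [ENNReal.toNNReal_zero, ENNReal.coe_zero, zero_mul, nonpos_iff_eq_zero,
      edist_eq_zero] at h1
    simp [h1]
  · exact h γ hγ h0.bot_lt hfin

end Modulus

/-! ### Absolutely continuous functions on the unit interval -/

section Interval

/-- The increments of `F : [0, 1] → ℝ` are controlled by the integrals of the integrable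
function `g`. -/
structure HasIncrementBound (F : ℝ → ℝ) (g : ℝ → ℝ≥0∞) : Prop where
  aemeasurable : AEMeasurable g (volume.restrict (Icc 0 1))
  lintegral_lt_top : ∫⁻ r in Icc (0 : ℝ) 1, g r < ∞
  le : ∀ s t, 0 ≤ s → s ≤ t → t ≤ 1 → ENNReal.ofReal |F t - F s| ≤ ∫⁻ r in Icc s t, g r

variable {F : ℝ → ℝ} {g h : ℝ → ℝ≥0∞}

lemma HasIncrementBound.integrableOn (H : HasIncrementBound F g) :
    IntegrableOn (fun r => (g r).toReal) (Icc 0 1) :=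
  integrable_toReal_of_lintegral_ne_top H.aemeasurable H.lintegral_lt_top.ne

lemma HasIncrementBound.intervalIntegrable (H : HasIncrementBound F g) :
    IntervalIntegrable (fun r => (g r).toReal) volume 0 1 :=
  (intervalIntegrable_iff_integrableOn_Icc_of_le zero_le_one).2 H.integrableOn

lemma HasIncrementBound.abs_sub_le (H : HasIncrementBound F g) {s t : ℝ} (hs : s ∈ Icc (0 : ℝ) 1)
    (ht : t ∈ Icc (0 : ℝ) 1) :
    |F t - F s| ≤ |(∫ r in (0 : ℝ)..t, (g r).toReal) - ∫ r in (0 : ℝ)..s, (g r).toReal| := by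
  wlog hst : s ≤ t generalizing s t
  · rw [abs_sub_comm, abs_sub_comm (∫ r in (0 : ℝ)..t, (g r).toReal)]
    exact this ht hs (le_of_not_ge hst)
  have hsub : ∀ r ∈ Icc (0 : ℝ) 1, IntervalIntegrable (fun r => (g r).toReal) volume 0 r :=
    fun r hr => H.intervalIntegrable.mono_set (by
      rw [uIcc_of_le hr.1, uIcc_of_le zero_le_one]; exact Icc_subset_Icc_right hr.2)
  rw [intervalIntegral.integral_interval_sub_left (hsub t ht) (hsub s hs)]
  refine le_trans ?_ (le_abs_self _)
  have hle := H.le s t hs.1 hst ht.2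
  have hss : Icc s t ⊆ Icc 0 1 := Icc_subset_Icc hs.1 ht.2
  have hfin : ∫⁻ r in Icc s t, g r ≠ ∞ :=
    ((lintegral_mono_set hss).trans_lt H.lintegral_lt_top).ne
  have ham := H.aemeasurable.mono_measure (Measure.restrict_mono_set volume hss)
  rw [intervalIntegral.integral_of_le hst, ← integral_Icc_eq_integral_Ioc,
    integral_toReal ham (ae_lt_top' ham hfin)]
  rwa [← ENNReal.ofReal_le_iff_le_toReal hfin]

/-- The increments of `F` are dominated by those of the indefinite integral of `g`, which is
absolutely continuous. -/
lemma HasIncrementBound.absolutelyContinuous (H : HasIncrementBound F g) :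
    AbsolutelyContinuousOnInterval F 0 1 := by
  have hG := H.intervalIntegrable.absolutelyContinuousOnInterval_intervalIntegral (c := 0) (by simp)
  unfold AbsolutelyContinuousOnInterval at *
  refine squeeze_zero' (Eventually.of_forall fun _ => Finset.sum_nonneg fun _ _ => dist_nonneg)
    ?_ hG
  filter_upwards [mem_inf_of_right (mem_principal_self _)] with E hE
  refine Finset.sum_le_sum fun i hi => ?_
  have h1 := hE.1 i hi
  rw [uIcc_of_le zero_le_one] at h1
  rw [Real.dist_eq, Real.dist_eq]
  exact H.abs_sub_le h1.2 h1.1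

lemma HasIncrementBound.continuousOn (H : HasIncrementBound F g) : ContinuousOn F (Icc 0 1) := by
  simpa using H.absolutelyContinuous.continuousOn

lemma HasIncrementBound.ae_abs_deriv_le (H : HasIncrementBound F g) :
    ∀ᵐ x, x ∈ Icc (0 : ℝ) 1 → ENNReal.ofReal |deriv F x| ≤ g x := by
  have hfin := ae_lt_top' H.aemeasurable H.lintegral_lt_top.ne
  rw [ae_restrict_iff' measurableSet_Icc] at hfin
  have h0 : ∀ᵐ x : ℝ, x ≠ 0 := by simp [ae_iff, measure_singleton]
  have h1 : ∀ᵐ x : ℝ, x ≠ 1 := by simp [ae_iff, measure_singleton]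
  filter_upwards [H.absolutelyContinuous.ae_differentiableAt,
    H.intervalIntegrable.ae_hasDerivAt_integral, hfin, h0, h1] with x hF hG hfin h0 h1 hx
  rw [uIcc_of_le zero_le_one] at hF hG
  have hF' := hasDerivAt_iff_tendsto_slope.1 (hF hx).hasDerivAt
  have hG' := hasDerivAt_iff_tendsto_slope.1 (hG hx 0 (by simp))
  -- Away from the two end points, the slopes of `F` near `x` are bounded by those of the indefinite
  -- integral, whose derivative at `x` is `g x` by Lebesgue's theorem.
  have hnhds : Icc (0 : ℝ) 1 ∈ 𝓝[≠] x := mem_nhdsWithin_of_mem_nhds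
    (Icc_mem_nhds (lt_of_le_of_ne hx.1 h0.symm) (lt_of_le_of_ne hx.2 h1))
  have hle := le_of_tendsto_of_tendsto hF'.abs hG'.abs (by
    filter_upwards [hnhds] with y hy
    rw [slope_def_field, slope_def_field, abs_div, abs_div]
    exact div_le_div_of_nonneg_right (H.abs_sub_le hx hy) (abs_nonneg _))
  rw [abs_of_nonneg ENNReal.toReal_nonneg] at hle
  exact (ENNReal.ofReal_le_iff_le_toReal (hfin hx).ne).2 hle

lemma HasIncrementBound.le_lintegral_deriv (H : HasIncrementBound F g) :
    ENNReal.ofReal |F 1 - F 0| ≤ ∫⁻ r in Icc (0 : ℝ) 1, ENNReal.ofReal |deriv F r| := by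
  rw [← H.absolutelyContinuous.integral_deriv_eq_sub, ← Real.norm_eq_abs, ofReal_norm,
    intervalIntegral.integral_of_le zero_le_one, ← integral_Icc_eq_integral_Ioc]
  refine (enorm_integral_le_lintegral_enorm _).trans_eq ?_
  simp only [← ofReal_norm, Real.norm_eq_abs]

/-- Both bounds control `|F'|` a.e., hence so does their minimum, and the increment of `F` is the
integral of `F'`. This is why weak upper gradients form a lattice. -/
lemma HasIncrementBound.le_lintegral_min (H : HasIncrementBound F g)
    (H' : HasIncrementBound F h) :
    ENNReal.ofReal |F 1 - F 0| ≤ ∫⁻ r in Icc (0 : ℝ) 1, min (g r) (h r) := by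
  refine H.le_lintegral_deriv.trans (lintegral_mono_ae ?_)
  rw [ae_restrict_iff' measurableSet_Icc]
  filter_upwards [H.ae_abs_deriv_le, H'.ae_abs_deriv_le] with x h1 h2 hx
  exact le_min (h1 hx) (h2 hx)

/-- Only the part of the bound where `F` does not vanish is needed. -/
lemma HasIncrementBound.le_lintegral_indicator (H : HasIncrementBound F g) {A : Set ℝ}
    (hA : ∀ r ∈ Icc (0 : ℝ) 1, F r ≠ 0 → r ∈ A) :
    ENNReal.ofReal |F 1 - F 0| ≤ ∫⁻ r in Icc (0 : ℝ) 1, A.indicator g r := by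
  set Z := Icc (0 : ℝ) 1 ∩ F ⁻¹' {0} with hZ
  have hZc : IsCompact Z := isCompact_Icc.of_isClosed_subset
    (H.continuousOn.preimage_isClosed_of_isClosed isClosed_Icc isClosed_singleton)
    inter_subset_left
  rcases Z.eq_empty_or_nonempty with h0 | h0
  · refine (H.le 0 1 le_rfl zero_le_one le_rfl).trans_eq
      (setLIntegral_congr_fun measurableSet_Icc fun r hr => ?_)
    rw [indicator_of_mem]
    refine hA r hr fun h => ?_
    have : r ∈ Z := ⟨hr, h⟩
    rw [h0] at this; exact this
  -- With `s` and `t` the first and the last zero of `F`, the increment over `[s, t]` vanishes,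
  -- while `F ≠ 0` on `[0, s)` and `(t, 1]`, where the indicator therefore changes nothing.
  · obtain ⟨s, hs⟩ := hZc.exists_isLeast h0
    obtain ⟨t, ht⟩ := hZc.exists_isGreatest h0
    have hst : s ≤ t := hs.2 ht.1
    have hs1 : F s = 0 := hs.1.2
    have ht1 : F t = 0 := ht.1.2
    have e1 : ENNReal.ofReal |F s - F 0| ≤ ∫⁻ r in Ico 0 s, A.indicator g r := by
      refine (H.le 0 s le_rfl hs.1.1.1 hs.1.1.2).trans_eq ?_
      rw [← setLIntegral_congr Ico_ae_eq_Icc]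
      refine setLIntegral_congr_fun measurableSet_Ico fun r hr => ?_
      have hr' : r ∈ Icc (0 : ℝ) 1 := ⟨hr.1, hr.2.le.trans hs.1.1.2⟩
      rw [indicator_of_mem]
      exact hA r hr' fun h => (hs.2 ⟨hr', h⟩).not_gt hr.2
    have e2 : ENNReal.ofReal |F 1 - F t| ≤ ∫⁻ r in Ioc t 1, A.indicator g r := by
      refine (H.le t 1 ht.1.1.1 ht.1.1.2 le_rfl).trans_eq ?_
      rw [← setLIntegral_congr Ioc_ae_eq_Icc]
      refine setLIntegral_congr_fun measurableSet_Ioc fun r hr => ?_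
      have hr' : r ∈ Icc (0 : ℝ) 1 := ⟨ht.1.1.1.trans hr.1.le, hr.2⟩
      rw [indicator_of_mem]
      exact hA r hr' fun h => (ht.2 ⟨hr', h⟩).not_gt hr.1
    have hdisj : Disjoint (Ico 0 s) (Ioc t 1) :=
      Set.disjoint_left.2 fun r h1 h2 => (h1.2.trans_le hst).not_gt h2.1
    calc ENNReal.ofReal |F 1 - F 0|
        ≤ ENNReal.ofReal (|F s - F 0| + |F 1 - F t|) := by
          refine ENNReal.ofReal_le_ofReal ?_
          rw [hs1, ht1, zero_sub, sub_zero, abs_neg, add_comm]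
          exact abs_sub _ _
      _ = ENNReal.ofReal |F s - F 0| + ENNReal.ofReal |F 1 - F t| :=
          ENNReal.ofReal_add (abs_nonneg _) (abs_nonneg _)
      _ ≤ _ := add_le_add e1 e2
      _ = ∫⁻ r in Ico 0 s ∪ Ioc t 1, A.indicator g r :=
          (lintegral_union measurableSet_Ioc hdisj).symm
      _ ≤ _ := lintegral_mono_set (union_subset
          (Ico_subset_Icc_self.trans (Icc_subset_Icc_right hs.1.1.2))
          (Ioc_subset_Icc_self.trans (Icc_subset_Icc_left ht.1.1.1)))

lemma HasIncrementBound.eq_zero_of_ae (H : HasIncrementBound F g)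
    (h0 : ∀ᵐ r ∂volume.restrict (Icc (0 : ℝ) 1), F r = 0) : ∀ r ∈ Icc (0 : ℝ) 1, F r = 0 := by
  have h1 : F =ᵐ[volume.restrict (Ioo 0 1)] fun _ => 0 :=
    ae_mono (Measure.restrict_mono_set volume Ioo_subset_Icc_self) h0
  have h2 : EqOn F (fun _ => 0) (Ioo 0 1) :=
    Measure.eqOn_open_of_ae_eq h1 isOpen_Ioo (H.continuousOn.mono Ioo_subset_Icc_self)
      continuousOn_const
  intro r hr
  refine h2.of_subset_closure H.continuousOn continuousOn_const Ioo_subset_Icc_self ?_ hr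
  rw [closure_Ioo zero_ne_one]

end Interval

/-! ### Calculus and locality of weak upper gradients -/

section WeakUpperGradients

lemma lintegral_rpow_add_lt_top {X : Type*} [MeasurableSpace X] {p : ℝ≥0∞} {m : Measure X}
    {ρ ρ' : X → ℝ≥0∞} (hp : 1 ≤ p) (hp' : p ≠ ∞) (hρ : Measurable ρ)
    (h1 : ∫⁻ x, ρ x ^ p.toReal ∂m < ∞) (h2 : ∫⁻ x, ρ' x ^ p.toReal ∂m < ∞) :
    ∫⁻ x, (ρ x + ρ' x) ^ p.toReal ∂m < ∞ :=
  ENNReal.lintegral_rpow_add_lt_top_of_lintegral_rpow_lt_top hρ.aemeasurable h1 h2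
    (by rw [← ENNReal.toReal_one]; exact ENNReal.toReal_mono hp' hp)

/-- Makes `∞` on a null set usable as an exceptional function: curves with finite integral then
spend no time in the null set. -/
lemma lintegral_indicator_top_rpow {X : Type*} [MeasurableSpace X] {p : ℝ≥0∞} {m : Measure X}
    (hp : 1 ≤ p) (hp' : p ≠ ∞) {N : Set X} (hN0 : m N = 0) :
    ∫⁻ x, (N.indicator (fun _ => (∞ : ℝ≥0∞)) x) ^ p.toReal ∂m < ∞ := by
  have : (fun x => (N.indicator (fun _ => (∞ : ℝ≥0∞)) x) ^ p.toReal) =ᵐ[m] fun _ => 0 := by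
    filter_upwards [measure_eq_zero_iff_ae_notMem.1 hN0] with x hx
    rw [indicator_of_notMem hx, ENNReal.zero_rpow_of_pos (toReal_pos_of_one_le hp hp')]
  rw [lintegral_congr_ae this]
  simp

variable {X : Type*} [MetricSpace X] [MeasurableSpace X] {p : ℝ≥0∞} {m : Measure X}
  {f f' : X → ℝ} {ρ ρ' : X → ℝ≥0∞}

/-- A `1`-Lipschitz function that vanishes off a set `A` of finite measure has the weak upper
gradient `1_A`. -/
lemma isWeakUpperGradient_of_lipschitzWith (hp : 1 ≤ p) (hp' : p ≠ ∞) (hf : LipschitzWith 1 f)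
    {A : Set X} (hA : MeasurableSet A) (hmA : m A < ∞) (hfA : ∀ x, f x ≠ 0 → x ∈ A) :
    IsWeakUpperGradient p m f (A.indicator fun _ => 1) := by
  have hpp := toReal_pos_of_one_le hp hp'
  have hfin : ∫⁻ x, (A.indicator (fun _ => (1 : ℝ≥0∞)) x) ^ p.toReal ∂m < ∞ := by
    have : (fun x => (A.indicator (fun _ => (1 : ℝ≥0∞)) x) ^ p.toReal)
        = A.indicator fun _ => 1 := by
      ext x
      by_cases hx : x ∈ A <;> simp [hx, hpp]
    rw [this, lintegral_indicator_const hA, one_mul]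
    exact hmA
  refine isWeakUpperGradient_of_constSpeed hp hp' (measurable_const.indicator hA) hfin
    measurable_zero (by simp [hpp]) fun γ hγ _ _ => ?_
  have hb : HasIncrementBound (fun r => f (γ.constSpeed r)) fun _ => γ.length := by
    refine ⟨aemeasurable_const, ?_, fun s t hs hst ht => ?_⟩
    · have : γ.length < ∞ := hγ
      simpa using this
    · have h1 := hf.comp_lipschitzOnWith (γ.lipschitzOnWith_constSpeed hγ)
      have h2 := h1 (x := t) ⟨hs.trans hst, ht⟩ (y := s) ⟨hs, hst.trans ht⟩
      simp only [Function.comp_apply, one_mul, ENNReal.coe_toNNReal hγ.ne, edist_dist,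
        Real.dist_eq, abs_of_nonneg (sub_nonneg.2 hst)] at h2
      simpa using h2
  refine (hb.le_lintegral_indicator (A := γ.constSpeed ⁻¹' A) fun r _ hr => hfA _ hr).trans_eq ?_
  rw [← lintegral_const_mul' _ _ hγ.ne]
  congr 1
  ext r
  by_cases hr : γ.constSpeed r ∈ A <;> simp [hr]

variable [BorelSpace X]

/-- Adding `ρ` to the exceptional function forces `ρ` to be integrable along the remaining curves;
the results on the interval then apply to `f` along each of them. -/
lemma IsWeakUpperGradient.exists_hasIncrementBound (hp : 1 ≤ p) (hp' : p ≠ ∞)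
    (h : IsWeakUpperGradient p m f ρ) :
    ∃ σ : X → ℝ≥0∞, Measurable σ ∧ ∫⁻ x, σ x ^ p.toReal ∂m < ∞ ∧
      ∀ γ : Curve X, γ.Rectifiable → γ.pathIntegral σ < ∞ →
        HasIncrementBound (fun r => f (γ.constSpeed r)) fun r => γ.length * ρ (γ.constSpeed r) := by
  obtain ⟨σ, h1, h2, h3⟩ := h.exists_exceptional hp hp'
  refine ⟨fun x => σ x + ρ x, h1.add h.1, lintegral_rpow_add_lt_top hp hp' h1 h2 h.2.1,
    fun γ hγ hfin => ?_⟩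
  rw [γ.pathIntegral_add h1, ENNReal.add_lt_top] at hfin
  refine ⟨(γ.aemeasurable_comp hγ h.1 Subset.rfl measurableSet_Icc).const_mul _, ?_,
    fun s t hs hst ht => ?_⟩
  · rw [lintegral_const_mul' _ _ hγ.ne, ← γ.pathIntegral_eq hγ]
    exact hfin.2
  · rw [lintegral_const_mul' _ _ hγ.ne]
    exact h3 γ hγ hfin.1 s t hs hst ht

lemma IsWeakUpperGradient.min (hp : 1 ≤ p) (hp' : p ≠ ∞)
    (h : IsWeakUpperGradient p m f ρ) (h' : IsWeakUpperGradient p m f ρ') :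
    IsWeakUpperGradient p m f fun x => min (ρ x) (ρ' x) := by
  obtain ⟨σ, h1, h2, h3⟩ := h.exists_hasIncrementBound hp hp'
  obtain ⟨σ', h1', h2', h3'⟩ := h'.exists_hasIncrementBound hp hp'
  refine isWeakUpperGradient_of_constSpeed hp hp' (h.1.min h'.1)
    ((lintegral_mono fun x => ENNReal.rpow_le_rpow (min_le_left _ _)
      ENNReal.toReal_nonneg).trans_lt h.2.1) (h1.add h1')
    (lintegral_rpow_add_lt_top hp hp' h1 h2 h2') fun γ hγ _ hfin => ?_
  change γ.pathIntegral (fun x => σ x + σ' x) < ∞ at hfin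
  rw [γ.pathIntegral_add h1, ENNReal.add_lt_top] at hfin
  refine ((h3 γ hγ hfin.1).le_lintegral_min (h3' γ hγ hfin.2)).trans_eq ?_
  rw [← lintegral_const_mul' _ _ hγ.ne]
  simp only [mul_min]

/-- The weak upper gradients of a function are closed under countable infima. -/
lemma IsWeakUpperGradient.iInf (hp : 1 ≤ p) (hp' : p ≠ ∞) {ρ : ℕ → X → ℝ≥0∞}
    (h : ∀ n, IsWeakUpperGradient p m f (ρ n)) :
    IsWeakUpperGradient p m f fun x => ⨅ n, ρ n x := by
  -- The running minima decrease to the infimum, so monotone convergence gives the inequality along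
  -- each curve that is good for all of them.
  set τ : ℕ → X → ℝ≥0∞ := fun n x => (Finset.range (n + 1)).inf fun k => ρ k x with hτ
  have hτw : ∀ n, IsWeakUpperGradient p m f (τ n) := by
    intro n
    induction n with
    | zero => simpa [hτ] using h 0
    | succ n ih =>
      have := (h (n + 1)).min hp hp' ih
      simp only [hτ, Finset.range_add_one (n := n + 1), Finset.inf_insert]
      exact this
  have hanti : ∀ x, Antitone fun n => τ n x := fun x i j hij =>
    Finset.inf_mono (Finset.range_mono (by omega))
  have heq : ∀ x, ⨅ n, ρ n x = ⨅ n, τ n x := fun x => le_antisymm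
    (le_iInf fun n => Finset.le_inf fun k _ => iInf_le _ k)
    (le_iInf fun n => (iInf_le _ n).trans (Finset.inf_le (by simp)))
  choose σ h1 h2 h3 using fun n => (hτw n).exists_hasIncrementBound hp hp'
  obtain ⟨σ', h1', h2', h3'⟩ := exists_dominating hp hp' h1 h2
  refine isWeakUpperGradient_of_constSpeed hp hp' (Measurable.iInf fun n => (h n).1)
    ((lintegral_mono fun x => ENNReal.rpow_le_rpow (iInf_le _ 0)
      ENNReal.toReal_nonneg).trans_lt (h 0).2.1) h1' h2' fun γ hγ hL hfin => ?_
  have hb := fun n => h3 n γ hγ (h3' γ hfin n)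
  simp only [heq]
  rw [← lintegral_const_mul' _ _ hγ.ne]
  simp only [ENNReal.mul_iInf_of_ne hL.ne' hγ.ne]
  rw [lintegral_iInf' (fun n => (hb n).aemeasurable)
    (Eventually.of_forall fun r i j hij => mul_le_mul_right (hanti _ hij) _)
    (hb 0).lintegral_lt_top.ne]
  exact le_iInf fun n => (hb n).le 0 1 le_rfl zero_le_one le_rfl

/-- Almost every curve avoids a given null set at almost every time. -/
lemma ae_notMem_of_pathIntegral_lt_top {N : Set X} (hN : MeasurableSet N) {γ : Curve X}
    (hγ : γ.Rectifiable) (h0 : 0 < γ.length)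
    (h : γ.pathIntegral (N.indicator fun _ => ∞) < ∞) :
    ∀ᵐ r ∂volume.restrict (Icc (0 : ℝ) 1), γ.constSpeed r ∉ N := by
  have hm : Measurable (N.indicator fun _ => (∞ : ℝ≥0∞)) := measurable_const.indicator hN
  rw [γ.pathIntegral_eq hγ] at h
  have h1 : ∫⁻ r in Icc (0 : ℝ) 1, N.indicator (fun _ => ∞) (γ.constSpeed r) ≠ ∞ := fun h' => by
    rw [h', ENNReal.mul_top h0.ne'] at h; exact lt_irrefl _ h
  filter_upwards [ae_lt_top' (γ.aemeasurable_comp hγ hm Subset.rfl measurableSet_Icc) h1]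
    with r hr hrN
  rw [indicator_of_mem hrN] at hr
  exact lt_irrefl _ hr

/-- Two functions that agree a.e. and have weak upper gradients agree at the end points of almost
every curve. -/
lemma IsWeakUpperGradient.congr (hp : 1 ≤ p) (hp' : p ≠ ∞)
    (h : IsWeakUpperGradient p m f ρ) (h' : IsWeakUpperGradient p m f' ρ') (hff : f =ᵐ[m] f') :
    IsWeakUpperGradient p m f' ρ := by
  -- Along almost every curve `f - f'` is continuous, since it has a weak upper gradient, and zero
  -- at almost every time, since the curve avoids the null set `N` at almost every time. Hence it
  -- vanishes at all times, the end points included.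
  have hd := h.add hp hp' (h'.const_smul (-1))
  obtain ⟨N, hsub, hN, hN0⟩ := exists_measurable_superset_of_null (ae_iff.1 hff)
  obtain ⟨σ, h1, h2, h3⟩ := h.exists_exceptional hp hp'
  obtain ⟨σ', h1', h2', h3'⟩ := hd.exists_hasIncrementBound hp hp'
  have hm : Measurable (N.indicator fun _ => (∞ : ℝ≥0∞)) := measurable_const.indicator hN
  refine isWeakUpperGradient_of_constSpeed hp hp' h.1 h.2.1 ((h1.add h1').add hm)
    (lintegral_rpow_add_lt_top hp hp' (h1.add h1') (lintegral_rpow_add_lt_top hp hp' h1 h2 h2')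
      (lintegral_indicator_top_rpow hp hp' hN0)) fun γ hγ h0 hfin => ?_
  change γ.pathIntegral (fun x => (σ x + σ' x) + N.indicator (fun _ => ∞) x) < ∞ at hfin
  rw [γ.pathIntegral_add (ρ := fun x => σ x + σ' x) (h1.add h1'), γ.pathIntegral_add h1,
    ENNReal.add_lt_top,
    ENNReal.add_lt_top] at hfin
  have hz := (h3' γ hγ hfin.1.2).eq_zero_of_ae (by
    filter_upwards [ae_notMem_of_pathIntegral_lt_top hN hγ h0 hfin.2] with r hr
    have : f (γ.constSpeed r) = f' (γ.constSpeed r) := by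
      by_contra hne
      exact hr (hsub hne)
    simp [this])
  have e : ∀ r ∈ Icc (0 : ℝ) 1, f' (γ.constSpeed r) = f (γ.constSpeed r) := fun r hr => by
    have := hz r hr
    linarith
  rw [e 1 (by simp), e 0 (by simp)]
  exact h3 γ hγ hfin.1.1 0 1 le_rfl zero_le_one le_rfl

/-- Locality: a weak upper gradient of `f` may be replaced by zero where `f = 0`. -/
lemma IsWeakUpperGradient.indicator (hp : 1 ≤ p) (hp' : p ≠ ∞)
    (h : IsWeakUpperGradient p m f ρ) {A : Set X} (hA : MeasurableSet A)
    (hfA : ∀ x, f x ≠ 0 → x ∈ A) :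
    IsWeakUpperGradient p m f (A.indicator ρ) := by
  obtain ⟨σ, h1, h2, h3⟩ := h.exists_hasIncrementBound hp hp'
  refine isWeakUpperGradient_of_constSpeed hp hp' (h.1.indicator hA)
    ((lintegral_mono fun x => ENNReal.rpow_le_rpow (indicator_le_self _ _ _)
      ENNReal.toReal_nonneg).trans_lt h.2.1) h1 h2 fun γ hγ _ hfin => ?_
  refine ((h3 γ hγ hfin).le_lintegral_indicator (A := γ.constSpeed ⁻¹' A)
    fun r _ hr => hfA _ hr).trans_eq ?_
  rw [← lintegral_const_mul' _ _ hγ.ne]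
  congr 1
  ext r
  by_cases hr : γ.constSpeed r ∈ A <;> simp [hr]

lemma abs_clamp_sub_clamp_le (a b u v : ℝ) :
    |max (min a u) (-u) - max (min b v) (-v)| ≤ |a - b| + |u - v| := by
  have h1 := abs_max_sub_max_le_max (min a u) (-u) (min b v) (-v)
  have h2 := abs_min_sub_min_le_max a u b v
  rw [neg_sub_neg, abs_sub_comm v u] at h1
  have h3 := abs_nonneg (a - b)
  have h4 := abs_nonneg (u - v)
  refine h1.trans (max_le (h2.trans (max_le ?_ ?_)) ?_) <;> linarith

/-- Clamping is `1`-Lipschitz in the sum of the distances of its two arguments. With a compactly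
cut-off cone as `f'` it truncates the values and the support of `f` at once. -/
lemma IsWeakUpperGradient.clamp (hp : 1 ≤ p) (hp' : p ≠ ∞)
    (h : IsWeakUpperGradient p m f ρ) (h' : IsWeakUpperGradient p m f' ρ') :
    IsWeakUpperGradient p m (fun x => Max.max (Min.min (f x) (f' x)) (-(f' x)))
      fun x => ρ x + ρ' x := by
  obtain ⟨-, -, σ, h1, h2, h3⟩ := (isWeakUpperGradient_iff hp hp').1 h
  obtain ⟨-, -, σ', h1', h2', h3'⟩ := (isWeakUpperGradient_iff hp hp').1 h'
  refine (isWeakUpperGradient_iff hp hp').2 ⟨h.1.add h'.1,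
    lintegral_rpow_add_lt_top hp hp' h.1 h.2.1 h'.2.1, fun x => σ x + σ' x, h1.add h1',
    lintegral_rpow_add_lt_top hp hp' h1 h2 h2', fun γ hγ hfin => ?_⟩
  rw [γ.pathIntegral_add h1, ENNReal.add_lt_top] at hfin
  rw [γ.pathIntegral_add h.1]
  calc _ ≤ ENNReal.ofReal (|f (γ.toFun γ.b) - f (γ.toFun γ.a)|
        + |f' (γ.toFun γ.b) - f' (γ.toFun γ.a)|) :=
        ENNReal.ofReal_le_ofReal (abs_clamp_sub_clamp_le _ _ _ _)
    _ = ENNReal.ofReal |f (γ.toFun γ.b) - f (γ.toFun γ.a)|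
        + ENNReal.ofReal |f' (γ.toFun γ.b) - f' (γ.toFun γ.a)| :=
        ENNReal.ofReal_add (abs_nonneg _) (abs_nonneg _)
    _ ≤ _ := add_le_add (h3 γ hγ hfin.1) (h3' γ hγ hfin.2)

end WeakUpperGradients

/-! ### The ordered ring of measurable functions and directed infima in it -/

section MeasurableFunctions

variable {X : Type*} [MeasurableSpace X] {m : Measure X}

instance instIsOrderedAddMonoidAEEqFun : IsOrderedAddMonoid (X →ₘ[m] ℝ) where
  add_le_add_left a b hab c := by
    rw [← AEEqFun.coeFn_le] at *
    filter_upwards [hab, AEEqFun.coeFn_add a c, AEEqFun.coeFn_add b c] with x h1 h2 h3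
    rw [h2, h3]
    exact add_le_add_left h1 _

lemma aeeqFun_nonneg_iff {f : X →ₘ[m] ℝ} : 0 ≤ f ↔ ∀ᵐ x ∂m, 0 ≤ f x := by
  rw [← AEEqFun.coeFn_le]
  refine ⟨fun h => ?_, fun h => ?_⟩ <;>
    filter_upwards [h, AEEqFun.coeFn_zero (β := ℝ) (μ := m)] with x h1 h2
  · rwa [h2] at h1
  · rwa [h2]

lemma aeeqFun_le_iff {f g : X →ₘ[m] ℝ} : f ≤ g ↔ ∀ᵐ x ∂m, f x ≤ g x :=
  AEEqFun.coeFn_le.symm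

instance instIsOrderedRingAEEqFun : IsOrderedRing (X →ₘ[m] ℝ) :=
  haveI : ZeroLEOneClass (X →ₘ[m] ℝ) := ⟨by
    rw [aeeqFun_nonneg_iff]
    filter_upwards [AEEqFun.coeFn_one (β := ℝ) (μ := m)] with x h
    rw [h]; exact zero_le_one⟩
  IsOrderedRing.of_mul_nonneg fun a b ha hb => by
    rw [aeeqFun_nonneg_iff] at *
    filter_upwards [ha, hb, AEEqFun.coeFn_mul a b] with x h1 h2 h3
    rw [h3]
    exact mul_nonneg h1 h2

lemma aeeqFun_abs_mul (f g : X →ₘ[m] ℝ) : |f * g| = |f| * |g| := by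
  refine AEEqFun.ext ?_
  filter_upwards [AEEqFun.coeFn_abs (f * g), AEEqFun.coeFn_mul f g, AEEqFun.coeFn_mul |f| |g|,
    AEEqFun.coeFn_abs f, AEEqFun.coeFn_abs g] with x h1 h2 h3 h4 h5
  rw [h1, h2, h3, Pi.mul_apply, Pi.mul_apply, h4, h5, abs_mul]

lemma coeFn_charFun (E : Set X) (hE : MeasurableSet E) :
    (charFun m E hE : X →ₘ[m] ℝ) =ᵐ[m] E.indicator fun _ => 1 :=
  AEEqFun.coeFn_mk _ _

lemma coeFn_charFun_mul (E : Set X) (hE : MeasurableSet E) (f : X →ₘ[m] ℝ) :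
    ((charFun m E hE : X →ₘ[m] ℝ) * f : X →ₘ[m] ℝ) =ᵐ[m] E.indicator f := by
  filter_upwards [AEEqFun.coeFn_mul (charFun m E hE : X →ₘ[m] ℝ) f, coeFn_charFun (m := m) E hE]
    with x h1 h2
  rw [h1, Pi.mul_apply, h2]
  by_cases hx : x ∈ E <;> simp [hx]

lemma charFun_mul_charFun (E F : Set X) (hE : MeasurableSet E) (hF : MeasurableSet F) :
    charFun m E hE * charFun m F hF = charFun m (E ∩ F) (hE.inter hF) := by
  refine Subtype.ext (AEEqFun.ext ?_)
  filter_upwards [coeFn_charFun_mul E hE (charFun m F hF : X →ₘ[m] ℝ), coeFn_charFun (m := m) F hF,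
    coeFn_charFun (m := m) (E ∩ F) (hE.inter hF)] with x h1 h2 h3
  refine h1.trans ?_
  rw [h3]
  by_cases hx : x ∈ E <;> by_cases hx' : x ∈ F <;> simp [hx, hx', h2]

lemma charFun_add_charFun_compl (E : Set X) (hE : MeasurableSet E) :
    charFun m E hE + charFun m Eᶜ hE.compl = 1 := by
  refine Subtype.ext (AEEqFun.ext ?_)
  filter_upwards [AEEqFun.coeFn_add (charFun m E hE : X →ₘ[m] ℝ) (charFun m Eᶜ hE.compl),
    coeFn_charFun (m := m) E hE, coeFn_charFun (m := m) Eᶜ hE.compl,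
    AEEqFun.coeFn_one (β := ℝ) (μ := m)] with x h1 h2 h3 h4
  refine h1.trans ?_
  refine Eq.trans ?_ h4.symm
  rw [Pi.add_apply, h2, h3]
  by_cases hx : x ∈ E <;> simp [hx]

lemma abs_charFun (E : Set X) (hE : MeasurableSet E) :
    |(charFun m E hE : X →ₘ[m] ℝ)| = charFun m E hE := by
  refine abs_of_nonneg (aeeqFun_nonneg_iff.2 ?_)
  filter_upwards [coeFn_charFun (m := m) E hE] with x h
  rw [h]
  exact indicator_nonneg (fun _ _ => zero_le_one) _

lemma mem_Lp_of_abs_le {p : ℝ≥0∞} {f g : X →ₘ[m] ℝ} (hg : g ∈ Lp ℝ p m) (h : |f| ≤ |g|) :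
    f ∈ Lp ℝ p m := by
  rw [Lp.mem_Lp_iff_memLp] at *
  refine hg.mono f.aestronglyMeasurable ?_
  rw [aeeqFun_le_iff] at h
  filter_upwards [h, AEEqFun.coeFn_abs f, AEEqFun.coeFn_abs g] with x h1 h2 h3
  rwa [h2, h3] at h1

lemma normLp_mono {p : ℝ≥0∞} {f g : X →ₘ[m] ℝ} (hg : g ∈ Lp ℝ p m) (h : |f| ≤ |g|) :
    normLp p f ≤ normLp p g := by
  refine ENNReal.toReal_mono ((Lp.mem_Lp_iff_memLp.1 hg).2.ne) (eLpNorm_mono_ae ?_)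
  rw [aeeqFun_le_iff] at h
  filter_upwards [h, AEEqFun.coeFn_abs f, AEEqFun.coeFn_abs g] with x h1 h2 h3
  rwa [h2, h3] at h1

lemma normLp_abs (p : ℝ≥0∞) (f : X →ₘ[m] ℝ) : normLp p |f| = normLp p f := by
  unfold normLp
  rw [eLpNorm_congr_ae (AEEqFun.coeFn_abs f)]
  exact congrArg _ (eLpNorm_norm (f : X → ℝ))

lemma normLp_coe {p : ℝ≥0∞} (f : Lp ℝ p m) : normLp p (f : X →ₘ[m] ℝ) = ‖f‖ := rfl

lemma normLp_eq_zero {p : ℝ≥0∞} (hp : p ≠ 0) {f : X →ₘ[m] ℝ} (hf : f ∈ Lp ℝ p m)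
    (h : normLp p f = 0) : f = 0 := by
  rw [normLp, ENNReal.toReal_eq_zero_iff, or_iff_left (Lp.mem_Lp_iff_memLp.1 hf).2.ne,
    eLpNorm_eq_zero_iff f.aestronglyMeasurable hp] at h
  exact AEEqFun.ext (h.trans AEEqFun.coeFn_zero.symm)

lemma normLp_zero (p : ℝ≥0∞) : normLp p (0 : X →ₘ[m] ℝ) = 0 := by
  unfold normLp
  rw [eLpNorm_congr_ae AEEqFun.coeFn_zero]
  simp

lemma mul_mem_L1 {p q : ℝ≥0∞} (hpq : p.HolderConjugate q) {f g : X →ₘ[m] ℝ}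
    (hf : f ∈ Lp ℝ q m) (hg : g ∈ Lp ℝ p m) : f * g ∈ Lp ℝ 1 m := by
  have := hpq.symm
  rw [Lp.mem_Lp_iff_memLp] at *
  exact (hg.mul (r := 1) hf).ae_eq (AEEqFun.coeFn_mul f g).symm

lemma normLp_mul_le_mul {p q : ℝ≥0∞} (hpq : p.HolderConjugate q) {f g : X →ₘ[m] ℝ}
    (hf : f ∈ Lp ℝ q m) (hg : g ∈ Lp ℝ p m) :
    normLp 1 (f * g) ≤ normLp q f * normLp p g := by
  have := hpq.symm
  rw [Lp.mem_Lp_iff_memLp] at *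
  unfold normLp
  rw [← ENNReal.toReal_mul]
  refine ENNReal.toReal_mono (ENNReal.mul_ne_top hf.2.ne hg.2.ne) ?_
  refine (eLpNorm_congr_ae (AEEqFun.coeFn_mul f g)).trans_le ?_
  have h := eLpNorm_smul_le_mul_eLpNorm (p := q) (q := p) (r := 1) hg.1 hf.1
  simpa only [smul_eq_mul] using h

/-- Directed sets in which antitone sequences are bounded below a.e. have an infimum in `L⁰(m)`,
which is the limit of an antitone sequence in the set. -/
lemma exists_isGLB_of_directedOn_of_ae_bddBelow [SigmaFinite m] {S : Set (X →ₘ[m] ℝ)}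
    (hne : S.Nonempty) (hdir : DirectedOn (· ≥ ·) S)
    (hbdd : ∀ u : ℕ → X →ₘ[m] ℝ, (∀ n, u n ∈ S) → Antitone u →
      ∀ᵐ x ∂m, BddBelow (range fun n => u n x)) :
    ∃ (g : X →ₘ[m] ℝ) (u : ℕ → X →ₘ[m] ℝ), IsGLB S g ∧ (∀ n, u n ∈ S) ∧ Antitone u ∧
      ∀ᵐ x ∂m, Tendsto (fun n => u n x) atTop (𝓝 (g x)) := by
  set μ := m.toFinite with hμ
  have hae : ∀ {P : X → Prop}, (∀ᵐ x ∂m, P x) ↔ ∀ᵐ x ∂μ, P x := by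
    intro P; rw [hμ, ae_toFinite]
  -- `Φ` is a bounded functional, strictly monotone up to null sets, because `μ` is finite with the
  -- same null sets as `m`. By directedness a minimising sequence can be made antitone; its limit
  -- `g` attains the infimum `I` of `Φ` on `S`.
  set Φ : (X →ₘ[m] ℝ) → ℝ := fun f => ∫ x, Real.arctan (f x) ∂μ with hΦ
  have hbound : ∀ t, ‖Real.arctan t‖ ≤ Real.pi / 2 := fun t => by
    rw [Real.norm_eq_abs]
    exact abs_le.2 ⟨(Real.neg_pi_div_two_lt_arctan t).le, (Real.arctan_lt_pi_div_two t).le⟩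
  have hmeas : ∀ f : X →ₘ[m] ℝ, AEStronglyMeasurable (fun x => Real.arctan (f x)) μ := fun f =>
    (Real.measurable_arctan.comp f.measurable).aestronglyMeasurable
  have hint : ∀ f : X →ₘ[m] ℝ, Integrable (fun x => Real.arctan (f x)) μ := fun f =>
    (integrable_const (Real.pi / 2)).mono' (hmeas f) (Eventually.of_forall fun x => hbound _)
  have hmono : ∀ f g : X →ₘ[m] ℝ, f ≤ g → Φ f ≤ Φ g := fun f g hfg => by
    refine integral_mono_ae (hint f) (hint g) ?_
    filter_upwards [hae.1 (aeeqFun_le_iff.1 hfg)] with x hx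
    exact Real.arctan_strictMono.monotone hx
  have hlim : ∀ (v : ℕ → X →ₘ[m] ℝ) (w : X →ₘ[m] ℝ),
      (∀ᵐ x ∂m, Tendsto (fun n => v n x) atTop (𝓝 (w x))) →
      Tendsto (fun n => Φ (v n)) atTop (𝓝 (Φ w)) := fun v w h => by
    refine tendsto_integral_of_dominated_convergence (fun _ => Real.pi / 2)
      (fun n => hmeas _) (integrable_const _) (fun n => Eventually.of_forall fun x => hbound _) ?_
    filter_upwards [hae.1 h] with x hx
    exact (Real.continuous_arctan.tendsto _).comp hx
  have hbddΦ : BddBelow (Φ '' S) := ⟨-(Real.pi / 2 * μ.real univ), by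
    rintro _ ⟨f, -, rfl⟩
    exact (abs_le.1 (norm_integral_le_of_norm_le_const
      (Eventually.of_forall fun x => hbound _))).1⟩
  set I := sInf (Φ '' S)
  have hI : ∀ f ∈ S, I ≤ Φ f := fun f hf => csInf_le hbddΦ ⟨f, hf, rfl⟩
  obtain ⟨r, -, hr, hrS⟩ := exists_seq_tendsto_sInf (hne.image Φ) hbddΦ
  choose f hfS hfr using hrS
  choose! d hdS hd1 hd2 using hdir
  let u : ℕ → X →ₘ[m] ℝ := fun n => Nat.rec (f 0) (fun k v => d v (f (k + 1))) n
  have huS : ∀ n, u n ∈ S := by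
    intro n
    induction n with
    | zero => exact hfS 0
    | succ n ih => exact hdS _ ih _ (hfS _)
  have hua : Antitone u := antitone_nat_of_succ_le fun n => hd1 _ (huS n) _ (hfS _)
  have huf : ∀ n, u n ≤ f n := by
    rintro (_ | n)
    · exact le_rfl
    · exact hd2 _ (huS n) _ (hfS _)
  have huI : Tendsto (fun n => Φ (u n)) atTop (𝓝 I) :=
    tendsto_of_tendsto_of_tendsto_of_le_of_le tendsto_const_nhds hr (fun n => hI _ (huS n))
      fun n => by rw [← hfr]; exact hmono _ _ (huf n)
  let g : X →ₘ[m] ℝ := AEEqFun.mk (fun x => ⨅ n, u n x)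
    (Measurable.iInf fun n => (u n).measurable).aestronglyMeasurable
  have hua' : ∀ᵐ x ∂m, Antitone fun n => u n x := by
    have : ∀ᵐ x ∂m, ∀ n, u (n + 1) x ≤ u n x :=
      ae_all_iff.2 fun n => aeeqFun_le_iff.1 (hua n.le_succ)
    filter_upwards [this] with x hx using antitone_nat_of_succ_le hx
  have hug : ∀ᵐ x ∂m, Tendsto (fun n => u n x) atTop (𝓝 (g x)) := by
    filter_upwards [hua', hbdd u huS hua, AEEqFun.coeFn_mk (fun x => ⨅ n, u n x)
      (Measurable.iInf fun n => (u n).measurable).aestronglyMeasurable] with x h1 h2 h3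
    rw [h3]
    exact tendsto_atTop_ciInf h1 h2
  have hgI : Φ g = I := tendsto_nhds_unique (hlim u g hug) huI
  refine ⟨g, u, ⟨fun h hh => ?_, fun c hc => ?_⟩, huS, hua, hug⟩
  -- The function `u n ⊓ h` need not be in `S`, but it lies above a member of `S`, so `Φ (u n ⊓ h) ≥
  -- I`. In the limit `Φ (g ⊓ h) = Φ g`, which forces `g ≤ h`.
  · have h1 : I ≤ Φ (g ⊓ h) := by
      refine ge_of_tendsto (hlim (fun n => u n ⊓ h) (g ⊓ h) ?_) (Eventually.of_forall fun n =>
        (hI _ (hdS _ (huS n) _ hh)).trans (hmono _ _ (le_inf (hd1 _ (huS n) _ hh)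
          (hd2 _ (huS n) _ hh))))
      have e : ∀ᵐ x ∂m, ∀ n, (u n ⊓ h : X →ₘ[m] ℝ) x = u n x ⊓ h x :=
        ae_all_iff.2 fun n => AEEqFun.coeFn_inf _ _
      filter_upwards [hug, e, AEEqFun.coeFn_inf g h] with x h1 h2 h3
      rw [h3]
      simp only [h2]
      exact h1.inf_nhds tendsto_const_nhds
    have h2 : (fun x => Real.arctan (g x) - Real.arctan ((g ⊓ h : X →ₘ[m] ℝ) x)) =ᵐ[μ] 0 := by
      refine (integral_eq_zero_iff_of_nonneg_ae ?_ ((hint _).sub (hint _))).1 ?_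
      · filter_upwards [hae.1 (aeeqFun_le_iff.1 (inf_le_left : g ⊓ h ≤ g))] with x hx
        exact sub_nonneg.2 (Real.arctan_strictMono.monotone hx)
      · rw [integral_sub' (hint _) (hint _)]
        change Φ g - Φ (g ⊓ h) = 0
        have := hmono (g ⊓ h) g inf_le_left
        linarith
    rw [aeeqFun_le_iff]
    filter_upwards [hae.2 h2, AEEqFun.coeFn_inf g h] with x h3 h4
    have h5 := Real.arctan_injective (sub_eq_zero.1 h3)
    rw [h5, h4]
    exact inf_le_right
  · rw [aeeqFun_le_iff]
    have : ∀ᵐ x ∂m, ∀ n, c x ≤ u n x := ae_all_iff.2 fun n => aeeqFun_le_iff.1 (hc (huS n))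
    filter_upwards [this, hug] with x h1 h2
    exact ge_of_tendsto h2 (Eventually.of_forall h1)

/-- Directed sets that are bounded below have an infimum in `L⁰(m)`, which is the limit of an
antitone sequence in the set. -/
lemma exists_isGLB_of_directedOn [SigmaFinite m] {S : Set (X →ₘ[m] ℝ)} (hne : S.Nonempty)
    (hdir : DirectedOn (· ≥ ·) S) (hbdd : BddBelow S) :
    ∃ (g : X →ₘ[m] ℝ) (u : ℕ → X →ₘ[m] ℝ), IsGLB S g ∧ (∀ n, u n ∈ S) ∧ Antitone u ∧
      ∀ᵐ x ∂m, Tendsto (fun n => u n x) atTop (𝓝 (g x)) := by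
  obtain ⟨b, hb⟩ := hbdd
  refine exists_isGLB_of_directedOn_of_ae_bddBelow hne hdir fun u hu _ => ?_
  filter_upwards [ae_all_iff.2 fun n => aeeqFun_le_iff.1 (hb (hu n))] with x hx
  exact ⟨b x, by rintro _ ⟨n, rfl⟩; exact hx n⟩

end MeasurableFunctions

/-! ### Truncation of Dirichlet functions; the minimal weak upper gradient -/

section MinimalGradient

variable {X : Type*} [MetricSpace X] [MeasurableSpace X]

lemma sigmaFinite_of_finite_on_bounded [BorelSpace X] {m : Measure X}
    (hm : ∀ B : Set X, Bornology.IsBounded B → MeasurableSet B → m B < ∞) : SigmaFinite m := by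
  rcases isEmpty_or_nonempty X with h | ⟨⟨x₀⟩⟩
  · rw [m.eq_zero_of_isEmpty]
    infer_instance
  · refine ⟨⟨⟨fun n => Metric.closedBall x₀ n, fun _ => trivial, fun n =>
      hm _ Metric.isBounded_closedBall measurableSet_closedBall, ?_⟩⟩⟩
    exact Metric.iUnion_closedBall_nat x₀

variable {p : ℝ≥0∞} {m : Measure X} {f' : X → ℝ} {ρ : X → ℝ≥0∞}

lemma IsWeakUpperGradient.exists_class (hp : 1 ≤ p) (hp' : p ≠ ∞)
    (h : IsWeakUpperGradient p m f' ρ) :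
    ∃ G : Lp ℝ p m, 0 ≤ G ∧ ρ =ᵐ[m] fun x => ENNReal.ofReal (G x) := by
  have hpp := toReal_pos_of_one_le hp hp'
  have hfin : ∀ᵐ x ∂m, ρ x < ∞ := by
    filter_upwards [ae_lt_top (h.1.pow_const _) h.2.1.ne] with x hx
    exact (ENNReal.rpow_lt_top_iff_of_pos hpp).1 hx
  have hmem : MemLp (fun x => (ρ x).toReal) p m := by
    refine ⟨h.1.ennreal_toReal.aestronglyMeasurable, ?_⟩
    rw [eLpNorm_lt_top_iff_lintegral_rpow_enorm_lt_top (zero_lt_one.trans_le hp).ne' hp']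
    refine (lintegral_mono fun x => ENNReal.rpow_le_rpow ?_ hpp.le).trans_lt h.2.1
    rw [Real.enorm_eq_ofReal ENNReal.toReal_nonneg]
    exact ENNReal.ofReal_toReal_le
  refine ⟨hmem.toLp, ?_, ?_⟩
  · rw [← Lp.coeFn_nonneg]
    filter_upwards [hmem.coeFn_toLp] with x hx
    rw [hx]; exact ENNReal.toReal_nonneg
  · filter_upwards [hmem.coeFn_toLp, hfin] with x hx hx'
    rw [hx, ENNReal.ofReal_toReal hx'.ne]

variable [BorelSpace X]

/-- Dirichlet functions are eventually equal to Sobolev functions obtained by truncation. -/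
lemma exists_sobolev_truncation [Fact (1 ≤ p)] [Fact (p ≠ ∞)]
    (hm : ∀ B : Set X, Bornology.IsBounded B → MeasurableSet B → m B < ∞)
    (f : dirichletSpace p m) : ∃ u : ℕ → sobolevSpace p m,
      ∀ᵐ x ∂m, ∀ᶠ n in atTop, (u n : X →ₘ[m] ℝ) x = (f : X →ₘ[m] ℝ) x := by
  rcases isEmpty_or_nonempty X with h | ⟨⟨x₀⟩⟩
  · exact ⟨0, by simp [m.eq_zero_of_isEmpty]⟩
  have hp : 1 ≤ p := Fact.out
  have hp' : p ≠ ∞ := Fact.out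
  obtain ⟨f₁, hf, ρ, hρ⟩ := f.2
  -- A cone of height `n` supported in the ball of radius `n`. Clamping `f₁` between `-v n` and `v
  -- n` makes it bounded with support of finite measure, and changes nothing at `x` once `n ≥ |f₁ x|
  -- + dist x x₀`.
  let v : ℕ → X → ℝ := fun n x => max (n - dist x x₀) 0
  have hv0 : ∀ n x, 0 ≤ v n x := fun n x => le_max_right _ _
  have hvA : ∀ n x, v n x ≠ 0 → x ∈ Metric.closedBall x₀ (n : ℝ) := fun n x hx => by
    by_contra h
    rw [Metric.mem_closedBall, not_le] at h
    exact hx (max_eq_right (by linarith))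
  have hvlip : ∀ n, LipschitzWith 1 (v n) := fun n => by
    refine LipschitzWith.of_dist_le_mul fun x y => ?_
    rw [NNReal.coe_one, one_mul, Real.dist_eq]
    refine (abs_max_sub_max_le_max _ _ _ _).trans (max_le ?_ (by simp))
    rw [sub_sub_sub_cancel_left, abs_sub_comm]
    exact abs_dist_sub_le x y x₀
  have hfin : ∀ n : ℕ, m (Metric.closedBall x₀ (n : ℝ)) < ∞ := fun n =>
    hm _ Metric.isBounded_closedBall measurableSet_closedBall
  have hvw := fun n : ℕ => isWeakUpperGradient_of_lipschitzWith (m := m) hp hp' (hvlip n)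
    (measurableSet_closedBall (x := x₀) (ε := (n : ℝ))) (hfin n) (hvA n)
  let w : ℕ → X → ℝ := fun n x => max (min (f₁ x) (v n x)) (-(v n x))
  have hfm : AEStronglyMeasurable f₁ m :=
    (f : X →ₘ[m] ℝ).aestronglyMeasurable.congr hf.symm
  have hvm : ∀ n, AEStronglyMeasurable (v n) m := fun n =>
    (hvlip n).continuous.measurable.aestronglyMeasurable
  have hwm : ∀ n, AEStronglyMeasurable (w n) m := fun n => (hfm.inf (hvm n)).sup (hvm n).neg
  have hwv : ∀ n x, |w n x| ≤ v n x := fun n x =>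
    abs_le.2 ⟨le_max_right _ _, max_le (min_le_right _ _) (by linarith [hv0 n x])⟩
  have hwL : ∀ n, MemLp (w n) p m := fun n => by
    have h1 : MemLp ((Metric.closedBall x₀ (n : ℝ)).indicator fun _ => (n : ℝ)) p m :=
      memLp_indicator_const p measurableSet_closedBall _ (Or.inr (hfin n).ne)
    refine h1.mono (hwm n) (Eventually.of_forall fun x => ?_)
    rw [Real.norm_eq_abs, Real.norm_eq_abs]
    refine (hwv n x).trans ?_
    by_cases hx : x ∈ Metric.closedBall x₀ (n : ℝ)
    · rw [indicator_of_mem hx, Nat.abs_cast]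
      exact max_le (by linarith [dist_nonneg (x := x) (y := x₀)]) (Nat.cast_nonneg n)
    · rw [indicator_of_notMem hx, abs_zero]
      by_contra h
      exact hx (hvA n x (by linarith [hv0 n x] : 0 < v n x).ne')
  refine ⟨fun n => ⟨AEEqFun.mk (w n) (hwm n), ?_, ?_⟩, ?_⟩
  · exact ⟨w n, (AEEqFun.coeFn_mk _ _).symm, _, hρ.clamp hp hp' (hvw n)⟩
  · change _ ∈ Lp ℝ p m
    exact Lp.mem_Lp_iff_memLp.2 ((hwL n).ae_eq (AEEqFun.coeFn_mk _ _).symm)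
  · have e : ∀ᵐ x ∂m, ∀ n, (AEEqFun.mk (w n) (hwm n) : X →ₘ[m] ℝ) x = w n x :=
      ae_all_iff.2 fun n => AEEqFun.coeFn_mk _ _
    filter_upwards [hf, e] with x h1 h2
    obtain ⟨N, hN⟩ := exists_nat_ge (|f₁ x| + dist x x₀)
    filter_upwards [eventually_ge_atTop N] with n hn
    rw [h2, ← h1]
    have h3 : |f₁ x| ≤ v n x := le_max_of_le_left (by
      have : (N : ℝ) ≤ n := by exact_mod_cast hn
      linarith)
    have h4 := abs_le.1 h3
    simp only [w]
    rw [min_eq_left h4.2, max_eq_left h4.1]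

variable [SigmaFinite m]

/-- The minimal weak upper gradient exists. -/
lemma exists_isLeast_upperGradientClasses [Fact (1 ≤ p)] [Fact (p ≠ ∞)]
    (f : dirichletSpace p m) : ∃ G, IsLeast (upperGradientClasses p m f) G := by
  have hp : 1 ≤ p := Fact.out
  have hp' : p ≠ ∞ := Fact.out
  obtain ⟨f₀, hf₀, ρ₀, hρ₀⟩ := f.2
  set S : Set (X →ₘ[m] ℝ) := (fun G : Lp ℝ p m => (G : X →ₘ[m] ℝ)) ''
    upperGradientClasses p m f with hS
  -- A weak upper gradient of one representative also serves every other representative that has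
  -- one. Thus `f₀` can be fixed, and minima and infima are taken for a single function.
  have hchar : ∀ G : Lp ℝ p m, G ∈ upperGradientClasses p m f ↔
      0 ≤ G ∧ ∃ ρ, IsWeakUpperGradient p m f₀ ρ ∧ ρ =ᵐ[m] fun x => ENNReal.ofReal (G x) := by
    refine fun G => ⟨?_, ?_⟩
    · rintro ⟨f₁, hf₁, ρ, hρ, h0, hG⟩
      exact ⟨h0, ρ, hρ.congr hp hp' hρ₀ (hf₁.trans hf₀.symm), hG⟩
    · rintro ⟨h0, ρ, hρ, hG⟩
      exact ⟨f₀, hf₀, ρ, hρ, h0, hG⟩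
  have hne : S.Nonempty := by
    obtain ⟨G, h0, hG⟩ := hρ₀.exists_class hp hp'
    exact ⟨G, G, ⟨f₀, hf₀, ρ₀, hρ₀, h0, hG⟩, rfl⟩
  have hdir : DirectedOn (· ≥ ·) S := by
    rintro _ ⟨G, hG, rfl⟩ _ ⟨G', hG', rfl⟩
    obtain ⟨h0, ρ, hρ, hGρ⟩ := (hchar G).1 hG
    obtain ⟨h0', ρ', hρ', hGρ'⟩ := (hchar G').1 hG'
    refine ⟨_, ⟨G ⊓ G', (hchar _).2 ⟨le_inf h0 h0', _, hρ.min hp hp' hρ', ?_⟩, rfl⟩,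
      inf_le_left (a := G), inf_le_right (a := G)⟩
    filter_upwards [hGρ, hGρ', Lp.coeFn_inf G G'] with x h1 h2 h3
    rw [h1, h2, h3]
    exact (ENNReal.ofReal_min _ _).symm
  have hbdd : BddBelow S := ⟨0, by
    rintro _ ⟨G, hG, rfl⟩
    exact ((hchar G).1 hG).1⟩
  obtain ⟨g, u, hg, huS, hua, hug⟩ := exists_isGLB_of_directedOn hne hdir hbdd
  choose G hG hGu using huS
  choose h0 ρ hρ hGρ using fun n => (hchar (G n)).1 (hG n)
  obtain ⟨G', hG'0, hG'⟩ := (IsWeakUpperGradient.iInf hp hp' hρ).exists_class hp hp'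
  -- The infimum in `L⁰(m)` is the limit of a decreasing sequence of classes, so it is the class of
  -- the pointwise infimum of the corresponding `ρ n`, which is again a weak upper gradient.
  have hgG : g = (G' : X →ₘ[m] ℝ) := by
    refine AEEqFun.ext ?_
    have e1 : ∀ᵐ x ∂m, ∀ n, ρ n x = ENNReal.ofReal (u n x) := ae_all_iff.2 fun n => by
      rw [← hGu]; exact hGρ n
    have e2 : ∀ᵐ x ∂m, ∀ n, u (n + 1) x ≤ u n x :=
      ae_all_iff.2 fun n => aeeqFun_le_iff.1 (hua n.le_succ)
    have e3 : 0 ≤ g := hg.2 (by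
      rintro _ ⟨G, hG, rfl⟩
      exact ((hchar G).1 hG).1)
    filter_upwards [hug, hG', e1, e2, aeeqFun_nonneg_iff.1 e3,
      (Lp.coeFn_nonneg G').2 hG'0] with x h1 h2 h3 h4 h5 h6
    simp only [h3] at h2
    have h7 : Antitone fun n => ENNReal.ofReal (u n x) := fun i j hij =>
      ENNReal.ofReal_le_ofReal (antitone_nat_of_succ_le (f := fun n => u n x) h4 hij)
    have h8 := tendsto_nhds_unique (tendsto_atTop_iInf h7) (ENNReal.tendsto_ofReal h1)
    rw [h2] at h8
    exact ((ENNReal.ofReal_eq_ofReal_iff h6 h5).1 h8).symm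
  refine ⟨G', (hchar G').2 ⟨hG'0, _, IsWeakUpperGradient.iInf hp hp' hρ, hG'⟩, fun H hH => ?_⟩
  have := hg.1 ⟨H, hH, rfl⟩
  rwa [hgG] at this

variable [Fact (1 ≤ p)] [Fact (p ≠ ∞)]

lemma isLeast_minGrad (f : dirichletSpace p m) :
    IsLeast (upperGradientClasses p m f) (minGrad p m f) :=
  Classical.epsilon_spec (exists_isLeast_upperGradientClasses f)

lemma minGrad_nonneg (f : dirichletSpace p m) : 0 ≤ (minGrad p m f : X →ₘ[m] ℝ) := by
  obtain ⟨_, _, _, _, h, _⟩ := (isLeast_minGrad f).1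
  exact h

lemma minGrad_le_of_isWeakUpperGradient (f : dirichletSpace p m) (hf : f' =ᵐ[m] (f : X →ₘ[m] ℝ))
    (h : IsWeakUpperGradient p m f' ρ) {g : X →ₘ[m] ℝ}
    (hg : ∀ᵐ x ∂m, ρ x ≤ ENNReal.ofReal (g x)) (hg0 : 0 ≤ g) :
    (minGrad p m f : X →ₘ[m] ℝ) ≤ g := by
  obtain ⟨G, hG0, hG⟩ := h.exists_class Fact.out Fact.out
  have h1 : (minGrad p m f : X →ₘ[m] ℝ) ≤ G := (isLeast_minGrad f).2 ⟨f', hf, ρ, h, hG0, hG⟩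
  refine h1.trans (aeeqFun_le_iff.2 ?_)
  filter_upwards [hG, hg, aeeqFun_nonneg_iff.1 hg0] with x h2 h3 h4
  rw [h2] at h3
  exact (ENNReal.ofReal_le_ofReal_iff h4).1 h3

lemma minGrad_add_le (f g : dirichletSpace p m) :
    (minGrad p m ((f + g : dirichletSpace p m) : X →ₘ[m] ℝ) : X →ₘ[m] ℝ)
      ≤ (minGrad p m f : X →ₘ[m] ℝ) + minGrad p m g := by
  obtain ⟨f₁, hf, ρ, hρ, h0, hG⟩ := (isLeast_minGrad f).1
  obtain ⟨g₁, hg, σ, hσ, h0', hG'⟩ := (isLeast_minGrad g).1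
  refine minGrad_le_of_isWeakUpperGradient (f + g) (f' := fun x => f₁ x + g₁ x) ?_
    (hρ.add Fact.out Fact.out hσ) ?_ (add_nonneg (minGrad_nonneg f) (minGrad_nonneg g))
  · filter_upwards [hf, hg, AEEqFun.coeFn_add (f : X →ₘ[m] ℝ) g] with x h1 h2 h3
    rw [h1, h2]; exact h3.symm
  · filter_upwards [hG, hG', AEEqFun.coeFn_add (minGrad p m f : X →ₘ[m] ℝ) (minGrad p m g),
      aeeqFun_nonneg_iff.1 (minGrad_nonneg f), aeeqFun_nonneg_iff.1 (minGrad_nonneg g)]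
      with x h1 h2 h3 h4 h5
    rw [h1, h2, h3]
    exact (ENNReal.ofReal_add h4 h5).symm.le

lemma minGrad_smul_le (c : ℝ) (f : dirichletSpace p m) :
    (minGrad p m ((c • f : dirichletSpace p m) : X →ₘ[m] ℝ) : X →ₘ[m] ℝ)
      ≤ |c| • (minGrad p m f : X →ₘ[m] ℝ) := by
  obtain ⟨f₁, hf, ρ, hρ, h0, hG⟩ := (isLeast_minGrad f).1
  have e : ∀ᵐ x ∂m, (|c| • (minGrad p m f : X →ₘ[m] ℝ) : X →ₘ[m] ℝ) x
      = |c| * (minGrad p m f : X →ₘ[m] ℝ) x := AEEqFun.coeFn_smul _ _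
  refine minGrad_le_of_isWeakUpperGradient (c • f) (f' := fun x => c * f₁ x) ?_
    (hρ.const_smul c) ?_ ?_
  · filter_upwards [hf, AEEqFun.coeFn_smul c (f : X →ₘ[m] ℝ)] with x h1 h3
    rw [h1]; exact h3.symm
  · filter_upwards [hG, e] with x h1 h2
    rw [h1, h2, ENNReal.ofReal_mul (abs_nonneg c)]
  · rw [aeeqFun_nonneg_iff]
    filter_upwards [e, aeeqFun_nonneg_iff.1 (minGrad_nonneg f)] with x h1 h2
    rw [h1]; exact mul_nonneg (abs_nonneg _) h2

lemma minGrad_zero : (minGrad p m ((0 : dirichletSpace p m) : X →ₘ[m] ℝ) : X →ₘ[m] ℝ) = 0 := by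
  refine le_antisymm ?_ (minGrad_nonneg 0)
  have := minGrad_smul_le (p := p) (m := m) 0 0
  simpa using this

/-- Locality of the minimal weak upper gradient. -/
lemma minGrad_eq_zero_of_eq_zero (f : dirichletSpace p m) :
    ∀ᵐ x ∂m, (f : X →ₘ[m] ℝ) x = 0 → (minGrad p m f : X →ₘ[m] ℝ) x = 0 := by
  obtain ⟨f₁, hf, ρ, hρ, h0, hG⟩ := (isLeast_minGrad f).1
  obtain ⟨N, hsub, hN, hN0⟩ := exists_measurable_superset_of_null (ae_iff.1 hf)
  -- The null set `N` where representative and class differ is added so that `f₁` vanishes at every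
  -- point outside `A`.
  set A : Set X := (f : X →ₘ[m] ℝ) ⁻¹' {0}ᶜ ∪ N with hA
  have hAm : MeasurableSet A :=
    ((f : X →ₘ[m] ℝ).measurable (measurableSet_singleton 0).compl).union hN
  have h1 := hρ.indicator Fact.out Fact.out hAm fun x hx => by
    by_cases h : f₁ x = (f : X →ₘ[m] ℝ) x
    · exact Or.inl (by rwa [mem_preimage, ← h])
    · exact Or.inr (hsub h)
  obtain ⟨G, hG0, hG1⟩ := h1.exists_class Fact.out Fact.out
  have h2 : (minGrad p m f : X →ₘ[m] ℝ) ≤ G := (isLeast_minGrad f).2 ⟨f₁, hf, _, h1, hG0, hG1⟩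
  filter_upwards [aeeqFun_le_iff.1 h2, hG1, measure_eq_zero_iff_ae_notMem.1 hN0,
    aeeqFun_nonneg_iff.1 (minGrad_nonneg f), (Lp.coeFn_nonneg G).2 hG0] with x e1 e2 e3 e4 e5 hx
  have hxA : x ∉ A := by
    rintro (h | h)
    · exact h hx
    · exact e3 h
  rw [indicator_of_notMem hxA] at e2
  have e6 : (G : X →ₘ[m] ℝ) x ≤ 0 := ENNReal.ofReal_eq_zero.1 e2.symm
  exact le_antisymm (e1.trans e6) e4

end MinimalGradient

/-! ### Glueing of functions along partitions; bounded local inverses -/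

section Glueing

variable {X : Type*} [MeasurableSpace X] {m : Measure X}

lemma normLp_rpow {p : ℝ≥0∞} (hp0 : p ≠ 0) (hp' : p ≠ ∞) {f : X →ₘ[m] ℝ}
    (hf : f ∈ Lp ℝ p m) :
    ∫⁻ x, ‖f x‖ₑ ^ p.toReal ∂m = ENNReal.ofReal (normLp p f ^ p.toReal) := by
  have hpp := ENNReal.toReal_pos hp0 hp'
  rw [← ENNReal.ofReal_rpow_of_nonneg (normLp_nonneg _ _) hpp.le, normLp,
    ENNReal.ofReal_toReal (Lp.mem_Lp_iff_memLp.1 hf).2.ne,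
    eLpNorm_eq_lintegral_rpow_enorm_toReal hp0 hp', one_div, ENNReal.rpow_inv_rpow hpp.ne']

/-- Monotone convergence in `L^p(m)`, `p < ∞`. -/
lemma tendsto_normLp_of_antitone {p : ℝ≥0∞} (hp0 : p ≠ 0) (hp' : p ≠ ∞)
    {u : ℕ → X →ₘ[m] ℝ} {g : X →ₘ[m] ℝ} (hu : u 0 ∈ Lp ℝ p m) (hu0 : ∀ n, 0 ≤ u n)
    (hle : ∀ n, u n ≤ u 0) (hug : ∀ᵐ x ∂m, Tendsto (fun n => u n x) atTop (𝓝 (g x))) :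
    Tendsto (fun n => normLp p (u n)) atTop (𝓝 (normLp p g)) := by
  have hpp := ENNReal.toReal_pos hp0 hp'
  have hL := Lp.mem_Lp_iff_memLp.1 hu
  have hfin : ∫⁻ x, ‖u 0 x‖ₑ ^ p.toReal ∂m ≠ ∞ := by
    rw [normLp_rpow hp0 hp' hu]; exact ENNReal.ofReal_ne_top
  have h0 : ∀ n, ∀ᵐ x ∂m, ‖u n x‖ₑ ≤ ‖u 0 x‖ₑ := fun n => by
    filter_upwards [aeeqFun_nonneg_iff.1 (hu0 n), aeeqFun_le_iff.1 (hle n)] with x h1 h2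
    rw [Real.enorm_eq_ofReal h1, Real.enorm_eq_ofReal (h1.trans h2)]
    exact ENNReal.ofReal_le_ofReal h2
  have key : Tendsto (fun n => ∫⁻ x, ‖u n x‖ₑ ^ p.toReal ∂m) atTop
      (𝓝 (∫⁻ x, ‖g x‖ₑ ^ p.toReal ∂m)) := by
    refine tendsto_lintegral_of_dominated_convergence' (fun x => ‖u 0 x‖ₑ ^ p.toReal)
      (fun n => (u n).measurable.enorm.pow_const _ |>.aemeasurable)
      (fun n => ?_) hfin ?_
    · filter_upwards [h0 n] with x hx
      exact ENNReal.rpow_le_rpow hx hpp.le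
    · filter_upwards [hug] with x hx
      exact (ENNReal.continuous_rpow_const.tendsto _).comp
        ((continuous_enorm.tendsto _).comp hx)
  have hg : ∫⁻ x, ‖g x‖ₑ ^ p.toReal ∂m ≠ ∞ := by
    refine ne_top_of_le_ne_top hfin (le_of_tendsto key (Eventually.of_forall fun n => ?_))
    refine lintegral_mono_ae ?_
    filter_upwards [h0 n] with x hx
    exact ENNReal.rpow_le_rpow hx hpp.le
  unfold normLp
  simp only [eLpNorm_eq_lintegral_rpow_enorm_toReal hp0 hp']
  refine (ENNReal.tendsto_toReal ?_).comp ((ENNReal.continuous_rpow_const.tendsto _).comp key)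
  exact ENNReal.rpow_ne_top_of_nonneg (by positivity) hg

/-- Measurable functions can be glued along countable measurable covers. -/
lemma exists_glue (E : ℕ → Set X) (hE : ∀ n, MeasurableSet (E n)) (a : ℕ → X →ₘ[m] ℝ)
    (hdisj : Pairwise fun i j => Disjoint (E i) (E j)) :
    ∃ g : X →ₘ[m] ℝ, ∀ᵐ x ∂m, ∀ n, x ∈ E n → g x = a n x := by
  obtain ⟨f, hf, hfa⟩ := exists_measurable_piecewise E hE (fun n => (a n : X → ℝ))
    (fun n => (a n).measurable) fun i j hij x hx =>
      (Set.disjoint_left.1 (hdisj hij) hx.1 hx.2).elim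
  refine ⟨AEEqFun.mk f hf.aestronglyMeasurable, ?_⟩
  filter_upwards [AEEqFun.coeFn_mk f (hf.aestronglyMeasurable (μ := m))] with x hx n hn
  rw [hx]
  exact hfa n hn

/-- Turns the `ℓ^q` condition on the pieces into membership in `L^q`: a common essential bound if `q
= ∞`, otherwise additivity of the integral over the partition. -/
lemma mem_Lp_of_glue {q : ℝ≥0∞} (hq : q ≠ 0) {E : ℕ → Set X} (hE : ∀ n, MeasurableSet (E n))
    {a : ℕ → X →ₘ[m] ℝ} (ha : ∀ n, a n ∈ Lp ℝ q m)
    (hdisj : Pairwise fun i j => Disjoint (E i) (E j)) (huniv : ⋃ n, E n = univ)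
    (hmem : Memℓp (fun n => normLp q ((charFun m (E n) (hE n) : X →ₘ[m] ℝ) * a n)) q)
    {g : X →ₘ[m] ℝ} (hg : ∀ᵐ x ∂m, ∀ n, x ∈ E n → g x = a n x) : g ∈ Lp ℝ q m := by
  have hcov : ∀ x, ∃ n, x ∈ E n := fun x => mem_iUnion.1 (huniv ▸ mem_univ x)
  have hmemLp : ∀ n, (charFun m (E n) (hE n) : X →ₘ[m] ℝ) * a n ∈ Lp ℝ q m :=
    fun n => mul_mem_Lp (charFun m (E n) (hE n)).2 (ha n)
  have hch : ∀ᵐ x ∂m, ∀ n, ((charFun m (E n) (hE n) : X →ₘ[m] ℝ) * a n : X →ₘ[m] ℝ) x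
      = (E n).indicator (a n) x := ae_all_iff.2 fun n => coeFn_charFun_mul _ _ _
  rw [Lp.mem_Lp_iff_memLp]
  refine ⟨g.aestronglyMeasurable, ?_⟩
  rcases eq_or_ne q ∞ with rfl | hq'
  · obtain ⟨C, hC⟩ := memℓp_infty_iff.1 hmem
    have hC' : ∀ᵐ x ∂m, ∀ n,
        ‖((charFun m (E n) (hE n) : X →ₘ[m] ℝ) * a n : X →ₘ[m] ℝ) x‖ₑ ≤ ENNReal.ofReal C := by
      refine ae_all_iff.2 fun n => ?_
      have h1 : eLpNorm ((charFun m (E n) (hE n) : X →ₘ[m] ℝ) * a n : X →ₘ[m] ℝ) ∞ m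
          ≤ ENNReal.ofReal C := by
        rw [ENNReal.le_ofReal_iff_toReal_le (Lp.mem_Lp_iff_memLp.1 (hmemLp n)).2.ne]
        · exact (le_abs_self _).trans (hC ⟨n, rfl⟩)
        · exact (norm_nonneg _).trans (hC ⟨n, rfl⟩)
      rw [eLpNorm_exponent_top] at h1
      filter_upwards [enorm_ae_le_eLpNormEssSup
        ((charFun m (E n) (hE n) : X →ₘ[m] ℝ) * a n : X →ₘ[m] ℝ) m] with x hx
      exact hx.trans h1
    rw [eLpNorm_exponent_top]
    refine (eLpNormEssSup_le_of_ae_enorm_bound (C := ENNReal.ofReal C) ?_).trans_lt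
      ENNReal.ofReal_lt_top
    filter_upwards [hg, hC', hch] with x h1 h2 h3
    obtain ⟨n, hn⟩ := hcov x
    have := h2 n
    rwa [h3 n, indicator_of_mem hn, ← h1 n hn] at this
  · have hqq := ENNReal.toReal_pos hq hq'
    rw [eLpNorm_lt_top_iff_lintegral_rpow_enorm_lt_top hq hq', ← setLIntegral_univ, ← huniv,
      lintegral_iUnion hE hdisj]
    have h1 : ∀ n, ∫⁻ x in E n, ‖g x‖ₑ ^ q.toReal ∂m = ENNReal.ofReal
        (normLp q ((charFun m (E n) (hE n) : X →ₘ[m] ℝ) * a n) ^ q.toReal) := by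
      intro n
      rw [← normLp_rpow hq hq' (hmemLp n), ← lintegral_indicator (hE n)]
      refine lintegral_congr_ae ?_
      filter_upwards [hg, hch] with x e1 e2
      rw [e2 n]
      by_cases hx : x ∈ E n
      · rw [indicator_of_mem hx, indicator_of_mem hx, e1 n hx]
      · rw [indicator_of_notMem hx, indicator_of_notMem hx, enorm_zero,
          ENNReal.zero_rpow_of_pos hqq]
    simp only [h1]
    have h2 := (memℓp_gen_iff hqq).1 hmem
    simp only [Real.norm_eq_abs, abs_of_nonneg (normLp_nonneg _ _)] at h2
    rw [← ENNReal.ofReal_tsum_of_nonneg (fun n => Real.rpow_nonneg (normLp_nonneg _ _) _) h2]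
    exact ENNReal.ofReal_lt_top

/-- Conversely, the norms of the pieces of an element of `L^q(m)` are in `ℓ^q`. -/
lemma memℓp_of_mem_Lp {q : ℝ≥0∞} (hq : q ≠ 0) (hq' : q ≠ ∞) {E : ℕ → Set X}
    (hE : ∀ n, MeasurableSet (E n)) (hdisj : Pairwise fun i j => Disjoint (E i) (E j))
    {g : X →ₘ[m] ℝ} (hg : g ∈ Lp ℝ q m) :
    Memℓp (fun n => normLp q ((charFun m (E n) (hE n) : X →ₘ[m] ℝ) * g)) q := by
  have hqq := ENNReal.toReal_pos hq hq'
  rw [memℓp_gen_iff hqq]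
  simp only [Real.norm_eq_abs, abs_of_nonneg (normLp_nonneg _ _)]
  have h1 : ∀ n, ∫⁻ x in E n, ‖g x‖ₑ ^ q.toReal ∂m = ENNReal.ofReal
      (normLp q ((charFun m (E n) (hE n) : X →ₘ[m] ℝ) * g) ^ q.toReal) := by
    intro n
    rw [← normLp_rpow hq hq' (mul_mem_Lp (charFun m (E n) (hE n)).2 hg),
      ← lintegral_indicator (hE n)]
    refine lintegral_congr_ae ?_
    filter_upwards [coeFn_charFun_mul (E n) (hE n) g] with x e2
    rw [e2]
    by_cases hx : x ∈ E n
    · rw [indicator_of_mem hx, indicator_of_mem hx]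
    · rw [indicator_of_notMem hx, indicator_of_notMem hx, enorm_zero,
        ENNReal.zero_rpow_of_pos hqq]
  have h2 : ∑' n, ENNReal.ofReal
      (normLp q ((charFun m (E n) (hE n) : X →ₘ[m] ℝ) * g) ^ q.toReal) ≠ ∞ := by
    simp only [← h1]
    rw [← lintegral_iUnion hE hdisj]
    refine ne_top_of_le_ne_top ?_ (setLIntegral_le_lintegral _ _)
    rw [normLp_rpow hq hq' hg]
    exact ENNReal.ofReal_ne_top
  have h3 := ENNReal.summable_toReal h2
  simpa only [ENNReal.toReal_ofReal (Real.rpow_nonneg (normLp_nonneg _ _) _)] using h3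

lemma le_of_forall_charFun_mul_le {E : ℕ → Set X} (hE : ∀ n, MeasurableSet (E n))
    (huniv : ⋃ n, E n = univ) {f g : X →ₘ[m] ℝ}
    (h : ∀ n, (charFun m (E n) (hE n) : X →ₘ[m] ℝ) * f ≤ (charFun m (E n) (hE n) : X →ₘ[m] ℝ) * g) :
    f ≤ g := by
  have e1 : ∀ᵐ x ∂m, ∀ n, (E n).indicator f x ≤ (E n).indicator g x := by
    refine ae_all_iff.2 fun n => ?_
    filter_upwards [aeeqFun_le_iff.1 (h n), coeFn_charFun_mul (E n) (hE n) f,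
      coeFn_charFun_mul (E n) (hE n) g] with x e1 e2 e3
    rwa [← e2, ← e3]
  rw [aeeqFun_le_iff]
  filter_upwards [e1] with x e1
  obtain ⟨n, hn⟩ := mem_iUnion.1 (huniv ▸ mem_univ x : x ∈ ⋃ n, E n)
  have := e1 n
  rwa [indicator_of_mem hn, indicator_of_mem hn] at this

/-- Measurable functions have bounded inverses on an increasing union of sets covering their
support. -/
lemma exists_bounded_inverse (f : X →ₘ[m] ℝ) :
    ∃ (E : ℕ → Set X) (hE : ∀ n, MeasurableSet (E n)) (k : ℕ → Linfty m),
      (∀ x, f x ≠ 0 → ∃ n, x ∈ E n) ∧ ∀ n, (k n : X →ₘ[m] ℝ) * f = charFun m (E n) (hE n) := by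
  have hmeas := f.measurable
  -- On `E n` the reciprocal of `f` is bounded by `n + 1`.
  let E : ℕ → Set X := fun n => {x | 1 / ((n : ℝ) + 1) ≤ |f x|}
  have hE : ∀ n, MeasurableSet (E n) := fun n =>
    measurableSet_le measurable_const (continuous_abs.measurable.comp hmeas)
  let k₀ : ℕ → X → ℝ := fun n => (E n).indicator fun x => (f x)⁻¹
  have hk₀ : ∀ n, AEStronglyMeasurable (k₀ n) m := fun n =>
    (hmeas.inv.indicator (hE n)).aestronglyMeasurable
  have hkL : ∀ n, AEEqFun.mk (k₀ n) (hk₀ n) ∈ Lp ℝ ∞ m := fun n => by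
    rw [Lp.mem_Lp_iff_memLp]
    refine MemLp.ae_eq (AEEqFun.coeFn_mk _ (hk₀ n)).symm
      (memLp_top_of_bound (hk₀ n) ((n : ℝ) + 1) (Eventually.of_forall fun x => ?_))
    by_cases hx : x ∈ E n
    · have h1 : 1 / ((n : ℝ) + 1) ≤ |f x| := hx
      simp only [k₀, indicator_of_mem hx, Real.norm_eq_abs, abs_inv]
      rw [inv_le_comm₀ (lt_of_lt_of_le (by positivity) h1) (by positivity), ← one_div]
      exact h1
    · simp only [k₀, indicator_of_notMem hx, norm_zero]
      positivity
  refine ⟨E, hE, fun n => ⟨AEEqFun.mk (k₀ n) (hk₀ n), hkL n⟩, fun x hx => ?_, fun n => ?_⟩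
  · obtain ⟨n, hn⟩ := exists_nat_one_div_lt (abs_pos.2 hx)
    exact ⟨n, hn.le⟩
  · refine AEEqFun.ext ?_
    filter_upwards [AEEqFun.coeFn_mul (AEEqFun.mk (k₀ n) (hk₀ n)) f, AEEqFun.coeFn_mk _ (hk₀ n),
      coeFn_charFun (m := m) (E n) (hE n)] with x e1 e2 e3
    refine e1.trans ?_
    rw [e3, Pi.mul_apply, e2]
    by_cases hx : x ∈ E n
    · have h1 : 1 / ((n : ℝ) + 1) ≤ |f x| := hx
      have h2 : f x ≠ 0 := abs_pos.1 (lt_of_lt_of_le (by positivity) h1)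
      simp only [k₀, indicator_of_mem hx]
      exact inv_mul_cancel₀ h2
    · simp only [k₀, indicator_of_notMem hx, zero_mul]

/-- A pointwise seminorm that is submultiplicative for the `L^∞(m)`-action is multiplicative. -/
lemma nrm_smul_eq_of_le {M : Type*} [AddCommGroup M] [Module (Linfty m) M]
    {nrm : M → (X →ₘ[m] ℝ)} (hnonneg : ∀ v, 0 ≤ nrm v)
    (htri : ∀ v w, nrm (v + w) ≤ nrm v + nrm w)
    (hsmul : ∀ (h : Linfty m) (v : M), nrm (h • v) ≤ |(h : X →ₘ[m] ℝ)| * nrm v)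
    (h : Linfty m) (v : M) : nrm (h • v) = |(h : X →ₘ[m] ℝ)| * nrm v := by
  refine le_antisymm (hsmul h v) ?_
  -- From `v = 1_E v + 1_{Eᶜ} v`: the second summand has norm zero a.e. on `E`.
  have hloc : ∀ (E : Set X) (hE : MeasurableSet E), ∀ᵐ x ∂m, x ∈ E →
      nrm v x ≤ nrm (charFun m E hE • v) x := by
    intro E hE
    have h1 := htri (charFun m E hE • v) (charFun m Eᶜ hE.compl • v)
    rw [← add_smul, charFun_add_charFun_compl, one_smul] at h1
    have h2 := hsmul (charFun m Eᶜ hE.compl) v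
    rw [abs_charFun] at h2
    filter_upwards [aeeqFun_le_iff.1 h1, aeeqFun_le_iff.1 h2, coeFn_charFun_mul Eᶜ hE.compl (nrm v),
      AEEqFun.coeFn_add (nrm (charFun m E hE • v)) (nrm (charFun m Eᶜ hE.compl • v))]
      with x e1 e2 e3 e4 hx
    rw [e3, indicator_of_notMem (notMem_compl_iff.2 hx)] at e2
    rw [e4, Pi.add_apply] at e1
    linarith
  obtain ⟨E, hE, k, hcov, hkh⟩ := exists_bounded_inverse (h : X →ₘ[m] ℝ)
  have hall : ∀ᵐ x ∂m, ∀ n, x ∈ E n →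
      |(h : X →ₘ[m] ℝ) x| * nrm v x ≤ nrm (h • v) x := by
    refine ae_all_iff.2 fun n => ?_
    -- With `k n = 1 / h` on `E n`, submultiplicativity for `k n • (h • v) = 1_{E n} v` reads `|1_{E
    -- n} v| ≤ |h|⁻¹ |h v|` there, which is the missing inequality.
    have h1 := hsmul (k n) (h • v)
    rw [← mul_smul, show k n * h = charFun m (E n) (hE n) from Subtype.ext (hkh n)] at h1
    have h2 := AEEqFun.coeFn_mul (k n : X →ₘ[m] ℝ) (h : X →ₘ[m] ℝ)
    rw [hkh n] at h2
    filter_upwards [hloc (E n) (hE n), aeeqFun_le_iff.1 h1,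
      AEEqFun.coeFn_mul |(k n : X →ₘ[m] ℝ)| (nrm (h • v)), AEEqFun.coeFn_abs (k n : X →ₘ[m] ℝ),
      h2, coeFn_charFun (m := m) (E n) (hE n)] with x e1 e2 e3 e4 e5 e6 hx
    rw [e6, indicator_of_mem hx, Pi.mul_apply] at e5
    have h3 : 0 < |(h : X →ₘ[m] ℝ) x| := abs_pos.2 fun h0 => by simp [h0] at e5
    have h4 : |(k n : X →ₘ[m] ℝ) x| = |(h : X →ₘ[m] ℝ) x|⁻¹ :=
      eq_inv_of_mul_eq_one_left (by rw [← abs_mul, ← e5, abs_one])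
    rw [e3, Pi.mul_apply, e4, h4] at e2
    have := (e1 hx).trans e2
    rwa [← div_eq_inv_mul, le_div_iff₀ h3, mul_comm] at this
  rw [aeeqFun_le_iff]
  filter_upwards [hall, AEEqFun.coeFn_mul |(h : X →ₘ[m] ℝ)| (nrm v),
    AEEqFun.coeFn_abs (h : X →ₘ[m] ℝ), aeeqFun_nonneg_iff.1 (hnonneg (h • v))] with x e1 e2 e3 e4
  rw [e2, Pi.mul_apply, e3]
  rcases eq_or_ne ((h : X →ₘ[m] ℝ) x) 0 with h0 | h0
  · rw [h0, abs_zero, zero_mul]; exact e4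
  · obtain ⟨n, hn⟩ := hcov x h0
    exact e1 n hn

/-- Multiplication by an essentially bounded function, as an operator on `L^p(m)`. -/
def mulLp (p : ℝ≥0∞) [Fact (1 ≤ p)] (h : Linfty m) : Lp ℝ p m →L[ℝ] Lp ℝ p m :=
  LinearMap.mkContinuous
    { toFun := fun f => ⟨(h : X →ₘ[m] ℝ) * f, mul_mem_Lp h.2 f.2⟩
      map_add' := fun _ _ => Subtype.ext (mul_add _ _ _)
      map_smul' := fun c _ => Subtype.ext (mul_smul_comm c _ _) }
    (normLp ∞ (h : X →ₘ[m] ℝ)) fun f => normLp_mul_le h.2 f.2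

lemma coe_mulLp (p : ℝ≥0∞) [Fact (1 ≤ p)] (h : Linfty m) (f : Lp ℝ p m) :
    (mulLp p h f : X →ₘ[m] ℝ) = (h : X →ₘ[m] ℝ) * f := rfl

end Glueing

/-! ### The pointwise norm of formal forms -/

section FormalForms

variable {X : Type*} [MetricSpace X] [MeasurableSpace X]
variable {p : ℝ≥0∞} [Fact (1 ≤ p)] [Fact (p ≠ ∞)] {m : Measure X}

lemma listForm_smul (h : Linfty m) (l : List (Linfty m × dirichletSpace p m)) :
    listForm p m (l.map fun x => (h * x.1, x.2)) = h • listForm p m l := by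
  simp only [listForm, List.smul_sum, List.map_map]
  rfl

lemma listForm_append (k l : List (Linfty m × dirichletSpace p m)) :
    listForm p m (k ++ l) = listForm p m k + listForm p m l := by
  simp [listForm]

lemma listBound_smul (h : Linfty m) (l : List (Linfty m × dirichletSpace p m)) :
    listBound p m (l.map fun x => (h * x.1, x.2)) = |(h : X →ₘ[m] ℝ)| * listBound p m l := by
  simp only [listBound, List.map_map, ← List.sum_map_mul_left]
  congr 1
  refine List.map_congr_left fun x _ => ?_
  simp only [Function.comp_apply, Subalgebra.coe_mul, aeeqFun_abs_mul, mul_assoc]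

lemma listBound_append (k l : List (Linfty m × dirichletSpace p m)) :
    listBound p m (k ++ l) = listBound p m k + listBound p m l := by
  simp [listBound]

/-- The functions `∑ᵢ |gᵢ| |Dfᵢ|` over all ways of writing `t` as `∑ᵢ gᵢ dfᵢ`. -/
def formBounds (t : FormalForm p m) : Set (X →ₘ[m] ℝ) :=
  {b | ∃ l, listForm p m l = t ∧ b = listBound p m l}

/-- Representations can be chosen differently on a measurable set and its complement. -/
lemma exists_list_piecewise {E : Set X} (hE : MeasurableSet E) (s t : FormalForm p m)
    (k l : List (Linfty m × dirichletSpace p m)) (hk : listForm p m k = s)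
    (hl : listForm p m l = t) :
    (charFun m E hE : X →ₘ[m] ℝ) * listBound p m k
      + (charFun m Eᶜ hE.compl : X →ₘ[m] ℝ) * listBound p m l
      ∈ formBounds (charFun m E hE • s + charFun m Eᶜ hE.compl • t) := by
  refine ⟨(k.map fun x => (charFun m E hE * x.1, x.2))
    ++ l.map fun x => (charFun m Eᶜ hE.compl * x.1, x.2), ?_, ?_⟩
  · rw [listForm_append, listForm_smul, listForm_smul, hk, hl]
  · rw [listBound_append, listBound_smul, listBound_smul, abs_charFun, abs_charFun]

/-- Use the first representation on the set where its bound is the smaller one and the second on the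
complement; the result represents the same form and its bound is the pointwise minimum. -/
lemma directedOn_formBounds (t : FormalForm p m) : DirectedOn (· ≥ ·) (formBounds t) := by
  rintro _ ⟨k, hk, rfl⟩ _ ⟨l, hl, rfl⟩
  set E : Set X := {x | listBound p m k x ≤ listBound p m l x}
  have hE : MeasurableSet E :=
    measurableSet_le (listBound p m k).measurable (listBound p m l).measurable
  refine ⟨_, by
    have := exists_list_piecewise hE t t k l hk hl
    rwa [← add_smul, charFun_add_charFun_compl, one_smul] at this, ?_, ?_⟩ <;>
  · refine aeeqFun_le_iff.2 ?_
    filter_upwards [AEEqFun.coeFn_add ((charFun m E hE : X →ₘ[m] ℝ) * listBound p m k)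
      ((charFun m Eᶜ hE.compl : X →ₘ[m] ℝ) * listBound p m l),
      coeFn_charFun_mul E hE (listBound p m k),
      coeFn_charFun_mul Eᶜ hE.compl (listBound p m l)] with x h1 h2 h3
    rw [h1, Pi.add_apply, h2, h3]
    by_cases hx : x ∈ E
    · have hx' : listBound p m k x ≤ listBound p m l x := hx
      simp [hx, hx']
    · have hx' : listBound p m l x < listBound p m k x := not_le.1 hx
      simp [hx, hx'.le]

variable [BorelSpace X] [SigmaFinite m]

lemma listBound_nonneg (l : List (Linfty m × dirichletSpace p m)) : 0 ≤ listBound p m l := by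
  refine List.sum_nonneg fun y hy => ?_
  obtain ⟨x, -, rfl⟩ := List.mem_map.1 hy
  exact mul_nonneg (abs_nonneg _) (minGrad_nonneg _)

lemma exists_formBounds_seq (t : FormalForm p m) :
    ∃ (g : X →ₘ[m] ℝ) (u : ℕ → X →ₘ[m] ℝ), IsGLB (formBounds t) g ∧ (∀ n, u n ∈ formBounds t) ∧
      Antitone u ∧ ∀ᵐ x ∂m, Tendsto (fun n => u n x) atTop (𝓝 (g x)) := by
  obtain ⟨l, hl⟩ := exists_listForm p m t
  refine exists_isGLB_of_directedOn ⟨_, l, hl, rfl⟩ (directedOn_formBounds t) ⟨0, ?_⟩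
  rintro _ ⟨k, -, rfl⟩
  exact listBound_nonneg k

/-- The pointwise norm of a formal `1`-form. -/
def formalNorm (t : FormalForm p m) : X →ₘ[m] ℝ := (exists_formBounds_seq t).choose

lemma isGLB_formalNorm (t : FormalForm p m) : IsGLB (formBounds t) (formalNorm t) :=
  (exists_formBounds_seq t).choose_spec.choose_spec.1

lemma exists_seq_formalNorm (t : FormalForm p m) : ∃ u : ℕ → X →ₘ[m] ℝ,
    (∀ n, u n ∈ formBounds t) ∧ Antitone u ∧
      ∀ᵐ x ∂m, Tendsto (fun n => u n x) atTop (𝓝 (formalNorm t x)) :=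
  ⟨_, (exists_formBounds_seq t).choose_spec.choose_spec.2⟩

lemma formalNorm_le_listBound (l : List (Linfty m × dirichletSpace p m)) :
    formalNorm (listForm p m l) ≤ listBound p m l :=
  (isGLB_formalNorm _).1 ⟨l, rfl, rfl⟩

lemma formalNorm_nonneg (t : FormalForm p m) : 0 ≤ formalNorm t := by
  refine (isGLB_formalNorm t).2 ?_
  rintro _ ⟨l, -, rfl⟩
  exact listBound_nonneg l

lemma formalNorm_mem_Lp (t : FormalForm p m) : formalNorm t ∈ Lp ℝ p m := by
  obtain ⟨l, rfl⟩ := exists_listForm p m t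
  refine mem_Lp_of_abs_le (listBound_mem p m l) ?_
  rw [abs_of_nonneg (formalNorm_nonneg _), abs_of_nonneg (listBound_nonneg l)]
  exact formalNorm_le_listBound l

/-- Concatenating representations adds their bounds. The infima are a.e. limits of sequences of
bounds, so the inequality passes to the limit pointwise. -/
lemma formalNorm_add_le (s t : FormalForm p m) :
    formalNorm (s + t) ≤ formalNorm s + formalNorm t := by
  obtain ⟨u, hu, -, hu'⟩ := exists_seq_formalNorm s
  obtain ⟨v, hv, -, hv'⟩ := exists_seq_formalNorm t
  have h1 : ∀ᵐ x ∂m, ∀ n, formalNorm (s + t) x ≤ u n x + v n x := by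
    refine ae_all_iff.2 fun n => ?_
    obtain ⟨k, hk, hk'⟩ := hu n
    obtain ⟨l, hl, hl'⟩ := hv n
    have h2 := formalNorm_le_listBound (k ++ l)
    rw [listForm_append, listBound_append, hk, hl, ← hk', ← hl'] at h2
    filter_upwards [aeeqFun_le_iff.1 h2, AEEqFun.coeFn_add (u n) (v n)] with x e1 e2
    rwa [e2] at e1
  rw [aeeqFun_le_iff]
  filter_upwards [h1, hu', hv', AEEqFun.coeFn_add (formalNorm s) (formalNorm t)] with x e1 e2 e3 e4
  rw [e4]
  exact ge_of_tendsto (e2.add e3) (Eventually.of_forall e1)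

lemma formalNorm_smul_le (h : Linfty m) (t : FormalForm p m) :
    formalNorm (h • t) ≤ |(h : X →ₘ[m] ℝ)| * formalNorm t := by
  obtain ⟨u, hu, -, hu'⟩ := exists_seq_formalNorm t
  have h1 : ∀ᵐ x ∂m, ∀ n, formalNorm (h • t) x ≤ |(h : X →ₘ[m] ℝ)| x * u n x := by
    refine ae_all_iff.2 fun n => ?_
    obtain ⟨k, hk, hk'⟩ := hu n
    have h2 := formalNorm_le_listBound (k.map fun x => (h * x.1, x.2))
    rw [listForm_smul, listBound_smul, hk, ← hk'] at h2
    filter_upwards [aeeqFun_le_iff.1 h2, AEEqFun.coeFn_mul |(h : X →ₘ[m] ℝ)| (u n)] with x e1 e2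
    rwa [e2] at e1
  rw [aeeqFun_le_iff]
  filter_upwards [h1, hu', AEEqFun.coeFn_mul |(h : X →ₘ[m] ℝ)| (formalNorm t)] with x e1 e2 e3
  rw [e3]
  exact ge_of_tendsto (e2.const_mul _) (Eventually.of_forall e1)

lemma formalNorm_smul (h : Linfty m) (t : FormalForm p m) :
    formalNorm (h • t) = |(h : X →ₘ[m] ℝ)| * formalNorm t :=
  nrm_smul_eq_of_le formalNorm_nonneg formalNorm_add_le formalNorm_smul_le h t

/-- The pointwise infimum is the limit of a decreasing sequence of bounds in `L^p`, `p < ∞`, so the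
norm of the infimum is the infimum of the norms. Hence the seminorm used for the completion comes
from a pointwise norm. -/
lemma normLp_formalNorm (t : FormalForm p m) : normLp p (formalNorm t) = formNorm p m t := by
  have hp0 : p ≠ 0 := (zero_lt_one.trans_le Fact.out).ne'
  have hmono : ∀ l, listForm p m l = t → normLp p (formalNorm t) ≤ normLp p (listBound p m l) :=
    fun l hl => normLp_mono (listBound_mem p m l) (by
      rw [abs_of_nonneg (formalNorm_nonneg _), abs_of_nonneg (listBound_nonneg l), ← hl]
      exact formalNorm_le_listBound l)
  obtain ⟨l₀, hl₀⟩ := exists_listForm p m t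
  have : Nonempty {l // listForm p m l = t} := ⟨⟨l₀, hl₀⟩⟩
  refine le_antisymm (le_ciInf fun l => hmono l.1 l.2) ?_
  obtain ⟨u, hu, hua, hu'⟩ := exists_seq_formalNorm t
  choose l hl hlu using hu
  refine ge_of_tendsto (tendsto_normLp_of_antitone hp0 Fact.out (u := u)
    (by rw [hlu]; exact listBound_mem p m _) (fun n => by rw [hlu]; exact listBound_nonneg _)
    (fun n => hua n.zero_le) hu') (Eventually.of_forall fun n => ?_)
  have := formNorm_le p m (l n)
  rwa [hl, ← hlu] at this

lemma eq_neg_inv_smul_of_add_eq_zero {V : Type*} [AddCommGroup V] [Module ℝ V] {c : ℝ}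
    (hc : c ≠ 0) {v w : V} (h : c • v + w = 0) : v = (-c⁻¹) • w := by
  rw [neg_smul, ← smul_neg, ← eq_neg_of_add_eq_zero_left h, smul_smul, inv_mul_cancel₀ hc,
    one_smul]

/-- Pointwise norms of linear combinations of differentials with constant coefficients. -/
lemma abs_mul_minGrad_le {n : ℕ} (F : Fin (n + 1) → dirichletSpace p m) (c : Fin (n + 1) → ℝ)
    (hc : ∑ i, c i • F i = 0) :
    ∀ᵐ x ∂m, |c 0| * (minGrad p m (F 0) : X →ₘ[m] ℝ) x
      ≤ ∑ i : Fin n, |c i.succ| * (minGrad p m (F i.succ) : X →ₘ[m] ℝ) x := by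
  rw [Fin.sum_univ_succ] at hc
  have hsum : ∀ s : Finset (Fin n), ∀ᵐ x ∂m,
      (minGrad p m ((∑ i ∈ s, c i.succ • F i.succ : dirichletSpace p m) : X →ₘ[m] ℝ) :
        X →ₘ[m] ℝ) x ≤ ∑ i ∈ s, |c i.succ| * (minGrad p m (F i.succ) : X →ₘ[m] ℝ) x := by
    intro s
    induction s using Finset.induction_on with
    | empty =>
      filter_upwards [AEEqFun.coeFn_zero (β := ℝ) (μ := m)] with x hx
      rw [Finset.sum_empty, Finset.sum_empty, minGrad_zero, hx]
      exact le_rfl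
    | insert a s ha ih =>
      rw [Finset.sum_insert ha]
      have h1 := minGrad_add_le (c a.succ • F a.succ) (∑ i ∈ s, c i.succ • F i.succ)
      have h2 := minGrad_smul_le (c a.succ) (F a.succ)
      filter_upwards [ih, aeeqFun_le_iff.1 h1, aeeqFun_le_iff.1 h2,
        AEEqFun.coeFn_add (minGrad p m ((c a.succ • F a.succ : dirichletSpace p m) : X →ₘ[m] ℝ) :
          X →ₘ[m] ℝ)
          (minGrad p m ((∑ i ∈ s, c i.succ • F i.succ : dirichletSpace p m) : X →ₘ[m] ℝ)),
        AEEqFun.coeFn_smul |c a.succ| (minGrad p m (F a.succ) : X →ₘ[m] ℝ)] with x e1 e2 e3 e4 e5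
      rw [Finset.sum_insert ha]
      rw [e4, Pi.add_apply] at e2
      rw [e5, Pi.smul_apply, smul_eq_mul] at e3
      linarith
  rcases eq_or_ne (c 0) 0 with h0 | h0
  · have hnn : ∀ᵐ x ∂m, ∀ i : Fin n, 0 ≤ (minGrad p m (F i.succ) : X →ₘ[m] ℝ) x :=
      ae_all_iff.2 fun i => aeeqFun_nonneg_iff.1 (minGrad_nonneg _)
    filter_upwards [hnn] with x hx
    rw [h0, abs_zero, zero_mul]
    exact Finset.sum_nonneg fun i _ => mul_nonneg (abs_nonneg _) (hx i)
  · have hF : F 0 = (-(c 0)⁻¹) • ∑ i : Fin n, c i.succ • F i.succ :=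
      eq_neg_inv_smul_of_add_eq_zero h0 hc
    have h1 := minGrad_smul_le (-(c 0)⁻¹) (∑ i : Fin n, c i.succ • F i.succ)
    rw [← hF] at h1
    filter_upwards [hsum Finset.univ, aeeqFun_le_iff.1 h1, AEEqFun.coeFn_smul |(-(c 0)⁻¹)|
      (minGrad p m ((∑ i : Fin n, c i.succ • F i.succ : dirichletSpace p m) : X →ₘ[m] ℝ) :
        X →ₘ[m] ℝ)] with x e1 e2 e3
    rw [e3, Pi.smul_apply, smul_eq_mul, abs_neg, abs_inv] at e2
    refine le_trans ?_ e1
    rwa [← le_div_iff₀' (abs_pos.2 h0), div_eq_inv_mul]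

/-- Pointwise norms of vanishing linear combinations of differentials. -/
lemma abs_mul_minGrad_le_of_sum_eq_zero {n : ℕ} (G : Fin (n + 1) → Linfty m)
    (F : Fin (n + 1) → dirichletSpace p m) (h : ∑ i, G i ⊗ₜ[ℝ] F i = 0) :
    ∀ᵐ x ∂m, |(G 0 : X →ₘ[m] ℝ) x| * (minGrad p m (F 0) : X →ₘ[m] ℝ) x
      ≤ ∑ i : Fin n, |(G i.succ : X →ₘ[m] ℝ) x| * (minGrad p m (F i.succ) : X →ₘ[m] ℝ) x := by
  -- Equational criterion: `F i = ∑ j, a i j • y j` with `∑ i, a i j • G i = 0` for each `j`. The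
  -- relations `Λ` cut out by the matrix `a` are then linear relations between the `F i` with
  -- constant coefficients, and contain `(G i x)ᵢ` for a.e. `x`.
  obtain ⟨κ, a, y, hy, ha⟩ :=
    TensorProduct.vanishesTrivially_of_sum_tmul_eq_zero_of_rTensor_injective ℝ
      (Module.Flat.rTensor_preserves_injective_linearMap _ Subtype.val_injective) h
  set Λ : Set (Fin (n + 1) → ℝ) := {c | ∀ j, ∑ i, a i j * c i = 0}
  have hΛ : ∀ c ∈ Λ, ∑ i, c i • F i = 0 := fun c hc => by
    simp only [hy, Finset.smul_sum, smul_smul]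
    rw [Finset.sum_comm]
    refine Finset.sum_eq_zero fun j _ => ?_
    rw [← Finset.sum_smul]
    simp only [mul_comm (c _)]
    rw [hc j, zero_smul]
  -- For a fixed relation the inequality holds off a null set depending on it; a countable dense set
  -- leaves a single null set, and at the other points both sides are continuous in the relation.
  obtain ⟨S, hSc, hSd⟩ := TopologicalSpace.exists_countable_dense Λ
  have hS : ∀ᵐ x ∂m, ∀ c ∈ S, |(c : Fin (n + 1) → ℝ) 0| * (minGrad p m (F 0) : X →ₘ[m] ℝ) x
      ≤ ∑ i : Fin n, |(c : Fin (n + 1) → ℝ) i.succ| * (minGrad p m (F i.succ) : X →ₘ[m] ℝ) x :=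
    (ae_ball_iff hSc).2 fun c _ => abs_mul_minGrad_le F c (hΛ c c.2)
  have hG : ∀ᵐ x ∂m, (fun i => (G i : X →ₘ[m] ℝ) x) ∈ Λ := by
    have h1 : ∀ j, ∀ᵐ x ∂m, ∑ i, a i j * (G i : X →ₘ[m] ℝ) x = 0 := fun j => by
      have h2 : ∀ s : Finset (Fin (n + 1)), ∀ᵐ x ∂m,
          ((∑ i ∈ s, a i j • G i : Linfty m) : X →ₘ[m] ℝ) x
            = ∑ i ∈ s, a i j * (G i : X →ₘ[m] ℝ) x := by
        intro s
        induction s using Finset.induction_on with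
        | empty =>
          filter_upwards [AEEqFun.coeFn_zero (β := ℝ) (μ := m)] with x hx
          exact hx
        | insert b s hb ih =>
          rw [Finset.sum_insert hb]
          filter_upwards [ih, AEEqFun.coeFn_smul (a b j) (G b : X →ₘ[m] ℝ), AEEqFun.coeFn_add
            ((a b j • G b : Linfty m) : X →ₘ[m] ℝ) ((∑ i ∈ s, a i j • G i : Linfty m) : X →ₘ[m] ℝ)]
            with x e1 e2 e3
          rw [Finset.sum_insert hb, ← e1]
          refine e3.trans ?_
          rw [Pi.add_apply]
          exact congrArg (· + _) e2
      filter_upwards [h2 Finset.univ, AEEqFun.coeFn_zero (β := ℝ) (μ := m)] with x e1 e2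
      rw [← e1, ha j]
      exact e2
    filter_upwards [ae_all_iff.2 h1] with x hx using hx
  filter_upwards [hS, hG] with x h1 h2
  have hcl : IsClosed {c : Λ | |(c : Fin (n + 1) → ℝ) 0| * (minGrad p m (F 0) : X →ₘ[m] ℝ) x
      ≤ ∑ i : Fin n, |(c : Fin (n + 1) → ℝ) i.succ| * (minGrad p m (F i.succ) : X →ₘ[m] ℝ) x} :=
    isClosed_le
      ((((continuous_apply 0).comp continuous_subtype_val).abs).mul continuous_const)
      (continuous_finsetSum _ fun i _ =>
        (((continuous_apply i.succ).comp continuous_subtype_val).abs).mul continuous_const)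
  exact hcl.closure_subset_iff.2 h1 (hSd ⟨_, h2⟩)

/-- The pointwise norm of `df` is `|Df|`. -/
lemma formalNorm_of_one (f : dirichletSpace p m) :
    formalNorm (FormalForm.of p m 1 f) = (minGrad p m f : X →ₘ[m] ℝ) := by
  refine le_antisymm ?_ ((isGLB_formalNorm _).2 ?_)
  · have h1 := formalNorm_le_listBound [((1 : Linfty m), f)]
    have h2 : listForm p m [((1 : Linfty m), f)] = FormalForm.of p m 1 f := by simp [listForm]
    have h3 : |((1 : Linfty m) : X →ₘ[m] ℝ)| = 1 := abs_of_nonneg zero_le_one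
    have h4 : listBound p m [((1 : Linfty m), f)] = (minGrad p m f : X →ₘ[m] ℝ) := by
      simp only [listBound, List.map_cons, List.map_nil, List.sum_cons, List.sum_nil, add_zero, h3,
        one_mul]
    rwa [h2, h4] at h1
  · rintro _ ⟨l, hl, rfl⟩
    -- Writing `1 ⊗ f = ∑ gᵢ ⊗ fᵢ` as a vanishing sum gives `f` the coefficient `-1`, of modulus
    -- one.
    let G : Fin (l.length + 1) → Linfty m := Fin.cons (-1) fun i => (l.get i).1
    let F : Fin (l.length + 1) → dirichletSpace p m := Fin.cons f fun i => (l.get i).2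
    have hsum : ∑ i, G i ⊗ₜ[ℝ] F i = 0 := by
      rw [Fin.sum_univ_succ]
      have h1 : ∑ i : Fin l.length, G i.succ ⊗ₜ[ℝ] F i.succ = (1 : Linfty m) ⊗ₜ[ℝ] f := by
        refine Eq.trans ?_ hl
        simp only [G, F, Fin.cons_succ, listForm]
        rw [← List.sum_ofFn]
        congr 1
        conv_rhs => rw [← List.ofFn_get l, List.map_ofFn]
        rfl
      rw [h1]
      simp only [G, F, Fin.cons_zero]
      rw [← TensorProduct.add_tmul, neg_add_cancel, TensorProduct.zero_tmul]
    have hb : ∀ᵐ x ∂m, listBound p m l x = ∑ i : Fin l.length,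
        |((l.get i).1 : X →ₘ[m] ℝ) x| * (minGrad p m (l.get i).2 : X →ₘ[m] ℝ) x := by
      clear hl hsum G F
      induction l with
      | nil =>
        filter_upwards [AEEqFun.coeFn_zero (β := ℝ) (μ := m)] with x hx
        simpa [listBound] using hx
      | cons a l ih =>
        have h1 : listBound p m (a :: l) = |(a.1 : X →ₘ[m] ℝ)| * (minGrad p m a.2 : X →ₘ[m] ℝ)
            + listBound p m l := rfl
        rw [h1]
        filter_upwards [ih, AEEqFun.coeFn_add (|(a.1 : X →ₘ[m] ℝ)| * (minGrad p m a.2 : X →ₘ[m] ℝ))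
          (listBound p m l), AEEqFun.coeFn_mul |(a.1 : X →ₘ[m] ℝ)| (minGrad p m a.2 : X →ₘ[m] ℝ),
          AEEqFun.coeFn_abs (a.1 : X →ₘ[m] ℝ)] with x e1 e2 e3 e4
        rw [e2, Pi.add_apply, e3, Pi.mul_apply, e4, e1]
        exact (Fin.sum_univ_succ (fun i : Fin (l.length + 1) => |(((a :: l).get i).1 : X →ₘ[m] ℝ) x|
          * (minGrad p m ((a :: l).get i).2 : X →ₘ[m] ℝ) x)).symm
    rw [aeeqFun_le_iff]
    filter_upwards [abs_mul_minGrad_le_of_sum_eq_zero G F hsum, hb,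
      AEEqFun.coeFn_neg (1 : X →ₘ[m] ℝ), AEEqFun.coeFn_one (β := ℝ) (μ := m)] with x e1 e2 e3 e4
    rw [e2]
    have e5 : (G 0 : X →ₘ[m] ℝ) x = -1 := by
      refine Eq.trans e3 ?_
      rw [Pi.neg_apply, e4]; rfl
    rw [e5, abs_neg, abs_one, one_mul] at e1
    exact e1

end FormalForms

/-! ### Pointwise seminorms, glueing in complete modules, and simple approximation -/

section PointwiseSeminorm

variable {X : Type*} [MeasurableSpace X] {m : Measure X}
variable {M : Type*} [AddCommGroup M] [Module (Linfty m) M]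

/-- `nrm` is a pointwise seminorm with values in `L⁰(m)` on the `L^∞(m)`-module `M`. -/
structure IsPointwiseSeminorm (nrm : M → (X →ₘ[m] ℝ)) : Prop where
  nonneg : ∀ v, 0 ≤ nrm v
  triangle : ∀ v w, nrm (v + w) ≤ nrm v + nrm w
  smul : ∀ (f : Linfty m) (v : M), nrm (f • v) = |(f : X →ₘ[m] ℝ)| * nrm v

namespace IsPointwiseSeminorm

variable {nrm : M → (X →ₘ[m] ℝ)}

lemma map_zero (hN : IsPointwiseSeminorm nrm) : nrm 0 = 0 := by
  have h := hN.smul 0 0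
  rw [zero_smul, ZeroMemClass.coe_zero, abs_zero, zero_mul] at h
  exact h

lemma map_neg (hN : IsPointwiseSeminorm nrm) (v : M) : nrm (-v) = nrm v := by
  have h := hN.smul (-1) v
  rw [neg_smul, one_smul] at h
  rw [h, NegMemClass.coe_neg, abs_neg, OneMemClass.coe_one,
    abs_of_nonneg (zero_le_one (α := X →ₘ[m] ℝ)), one_mul]

lemma map_sub_rev (hN : IsPointwiseSeminorm nrm) (v w : M) : nrm (v - w) = nrm (w - v) := by
  rw [← hN.map_neg, neg_sub]

lemma map_sub_le (hN : IsPointwiseSeminorm nrm) (v w u : M) : nrm (v - u) ≤ nrm (v - w) + nrm (w - u) := by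
  have h := hN.triangle (v - w) (w - u)
  rwa [sub_add_sub_cancel] at h

lemma abs_sub_le (hN : IsPointwiseSeminorm nrm) (v w : M) : |nrm v - nrm w| ≤ nrm (v - w) := by
  refine abs_le'.2 ⟨?_, ?_⟩
  · have h := hN.triangle (v - w) w
    rw [sub_add_cancel] at h
    exact sub_le_iff_le_add.2 h
  · have h := hN.triangle (w - v) v
    rw [sub_add_cancel, hN.map_sub_rev] at h
    rw [neg_sub]
    exact sub_le_iff_le_add.2 h

lemma charFun_smul (hN : IsPointwiseSeminorm nrm) (E : Set X) (hE : MeasurableSet E) (v : M) :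
    nrm (charFun m E hE • v) = (charFun m E hE : X →ₘ[m] ℝ) * nrm v := by
  rw [hN.smul, abs_charFun]

end IsPointwiseSeminorm

lemma charFun_mul_charFun_of_disjoint {E F : Set X} (hE : MeasurableSet E) (hF : MeasurableSet F)
    (h : Disjoint E F) : charFun m E hE * charFun m F hF = 0 := by
  refine Subtype.ext (AEEqFun.ext ?_)
  filter_upwards [AEEqFun.coeFn_mul (charFun m E hE : X →ₘ[m] ℝ) (charFun m F hF),
    coeFn_charFun (m := m) E hE, coeFn_charFun (m := m) F hF,
    AEEqFun.coeFn_zero (β := ℝ) (μ := m)] with x e1 e2 e3 e4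
  refine e1.trans (Eq.trans ?_ e4.symm)
  rw [Pi.mul_apply, e2, e3]
  by_cases hx : x ∈ E
  · simp [Set.disjoint_left.1 h hx]
  · simp [hx]

lemma charFun_mul_self (E : Set X) (hE : MeasurableSet E) :
    charFun m E hE * charFun m E hE = charFun m E hE := by
  refine Subtype.ext (AEEqFun.ext ?_)
  filter_upwards [AEEqFun.coeFn_mul (charFun m E hE : X →ₘ[m] ℝ) (charFun m E hE),
    coeFn_charFun (m := m) E hE] with x e1 e2
  refine e1.trans ?_
  rw [Pi.mul_apply, e2]
  by_cases hx : x ∈ E <;> simp [hx]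

lemma charFun_smul_sum_range {E : ℕ → Set X} (hE : ∀ n, MeasurableSet (E n))
    (hdisj : Pairwise fun i j => Disjoint (E i) (E j)) (v : ℕ → M) (k N : ℕ) :
    charFun m (E k) (hE k) • ∑ n ∈ Finset.range N, charFun m (E n) (hE n) • v n
      = if k < N then charFun m (E k) (hE k) • v k else 0 := by
  rw [Finset.smul_sum]
  have h : ∀ n, charFun m (E k) (hE k) • charFun m (E n) (hE n) • v n
      = if k = n then charFun m (E k) (hE k) • v k else 0 := fun n => by
    rw [← mul_smul]
    split_ifs with h
    · subst h; rw [charFun_mul_self]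
    · rw [charFun_mul_charFun_of_disjoint _ _ (hdisj h), zero_smul]
  simp only [h, Finset.sum_ite_eq, Finset.mem_range]

/-- In a complete module with an `L^p(m)`-valued pointwise norm, `p < ∞`, countable families can be
glued. -/
lemma exists_glue_of_complete {p : ℝ≥0∞} [Fact (1 ≤ p)] (hp' : p ≠ ∞)
    {nrm : M → (X →ₘ[m] ℝ)} (hN : IsPointwiseSeminorm nrm) (hmem : ∀ v, nrm v ∈ Lp ℝ p m)
    (hne : ∀ v, v ≠ 0 → nrm v ≠ 0)
    (hcomplete : ∀ u : ℕ → M,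
      (∀ ε : ℝ, 0 < ε → ∃ N, ∀ i ≥ N, ∀ j ≥ N, normLp p (nrm (u i - u j)) < ε) →
      ∃ v, Tendsto (fun i => normLp p (nrm (u i - v))) atTop (𝓝 0))
    (E : ℕ → Set X) (hE : ∀ n, MeasurableSet (E n)) (v : ℕ → M)
    (hdisj : Pairwise fun i j => Disjoint (E i) (E j)) (huniv : (⋃ n, E n) = univ)
    (hv : Memℓp (fun n => normLp p (nrm (charFun m (E n) (hE n) • v n))) p) :
    ∃ w : M, ∀ n, charFun m (E n) (hE n) • w = charFun m (E n) (hE n) • v n := by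
  have hp0 : p ≠ 0 := (zero_lt_one.trans_le Fact.out).ne'
  obtain ⟨g, hg⟩ := exists_glue (m := m) E hE (fun n => nrm (v n)) hdisj
  have hgL : g ∈ Lp ℝ p m := mem_Lp_of_glue hp0 hE (fun n => hmem (v n)) hdisj huniv
    (by simpa only [hN.charFun_smul] using hv) hg
  have hg0 : ∀ᵐ x ∂m, 0 ≤ g x := by
    filter_upwards [hg, ae_all_iff.2 fun n => aeeqFun_nonneg_iff.1 (hN.nonneg (v n))]
      with x e1 e2
    obtain ⟨n, hn⟩ := mem_iUnion.1 (huniv ▸ mem_univ x : x ∈ ⋃ n, E n)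
    rw [e1 n hn]
    exact e2 n
  let w : ℕ → M := fun N => ∑ n ∈ Finset.range N, charFun m (E n) (hE n) • v n
  -- The partial sums `w N` are Cauchy because `w k - w N` is dominated by `t N`, the part of `g` on
  -- the tail `A N`, whose `L^p`-norm tends to zero by dominated convergence.
  let A : ℕ → Set X := fun N => ⋃ n, ⋃ (_ : N ≤ n), E n
  have hA : ∀ N, MeasurableSet (A N) := fun N =>
    MeasurableSet.iUnion fun n => MeasurableSet.iUnion fun _ => hE n
  let t : ℕ → X →ₘ[m] ℝ := fun N => (charFun m (A N) (hA N) : X →ₘ[m] ℝ) * g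
  have ht : ∀ᵐ x ∂m, ∀ N, t N x = (A N).indicator g x :=
    ae_all_iff.2 fun N => coeFn_charFun_mul _ _ _
  have htL : ∀ N, t N ∈ Lp ℝ p m := fun N => mul_mem_Lp (charFun m (A N) (hA N)).2 hgL
  have hwle : ∀ N k, N ≤ k → nrm (w k - w N) ≤ t N := by
    intro N k hNk
    refine le_of_forall_charFun_mul_le hE huniv fun j => ?_
    rw [← hN.charFun_smul, smul_sub, charFun_smul_sum_range hE hdisj,
      charFun_smul_sum_range hE hdisj]
    have hpos : 0 ≤ (charFun m (E j) (hE j) : X →ₘ[m] ℝ) * t N := by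
      rw [aeeqFun_nonneg_iff]
      filter_upwards [coeFn_charFun_mul (E j) (hE j) (t N), ht, hg0] with x e1 e2 e3
      rw [e1]
      refine indicator_apply_nonneg fun _ => ?_
      rw [e2]
      exact indicator_apply_nonneg fun _ => e3
    by_cases h1 : j < N
    · rw [if_pos h1, if_pos (h1.trans_le hNk), sub_self, hN.map_zero]
      exact hpos
    · rw [if_neg h1, sub_zero]
      split_ifs with h2
      · rw [hN.charFun_smul, aeeqFun_le_iff]
        filter_upwards [coeFn_charFun_mul (E j) (hE j) (t N), ht, hg,
          coeFn_charFun_mul (E j) (hE j) (nrm (v j))] with x e1 e2 e3 e4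
        rw [e1, e4]
        by_cases hx : x ∈ E j
        · rw [indicator_of_mem hx, indicator_of_mem hx, e2,
            indicator_of_mem (mem_iUnion₂.2 ⟨j, not_lt.1 h1, hx⟩), e3 j hx]
        · rw [indicator_of_notMem hx, indicator_of_notMem hx]
      · rw [hN.map_zero]; exact hpos
  have htabs : ∀ N, 0 ≤ t N := fun N => by
    rw [aeeqFun_nonneg_iff]
    filter_upwards [ht, hg0] with x e2 e3
    rw [e2]
    exact indicator_apply_nonneg fun _ => e3
  have htend : Tendsto (fun N => normLp p (t N)) atTop (𝓝 0) := by
    rw [← normLp_zero (m := m) p]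
    refine tendsto_normLp_of_antitone hp0 hp' (htL 0) htabs (fun N => ?_) ?_
    · rw [aeeqFun_le_iff]
      filter_upwards [ht, hg0] with x e2 e3
      rw [e2, e2]
      by_cases hx : x ∈ A N
      · obtain ⟨j, -, hxj⟩ := mem_iUnion₂.1 hx
        rw [indicator_of_mem hx, indicator_of_mem (mem_iUnion₂.2 ⟨j, j.zero_le, hxj⟩)]
      · rw [indicator_of_notMem hx]
        exact indicator_apply_nonneg fun _ => e3
    · filter_upwards [ht, AEEqFun.coeFn_zero (β := ℝ) (μ := m)] with x e2 e3
      rw [e3]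
      obtain ⟨n, hn⟩ := mem_iUnion.1 (huniv ▸ mem_univ x : x ∈ ⋃ n, E n)
      refine tendsto_atTop_of_eventually_const (i₀ := n + 1) fun N hNn => ?_
      rw [e2, indicator_of_notMem]
      · rfl
      · intro hx
        obtain ⟨j, hj, hxj⟩ := mem_iUnion₂.1 hx
        exact Set.disjoint_left.1 (hdisj (show n ≠ j by omega)) hn hxj
  have hle2 : ∀ N k, N ≤ k → normLp p (nrm (w k - w N)) ≤ normLp p (t N) := fun N k h =>
    normLp_mono (htL N) (by
      rw [abs_of_nonneg (hN.nonneg _), abs_of_nonneg (htabs N)]; exact hwle N k h)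
  obtain ⟨W, hW⟩ := hcomplete w fun ε hε => by
    obtain ⟨N, hN'⟩ := (htend.eventually (gt_mem_nhds (half_pos hε))).exists
    refine ⟨N, fun i hi j hj => ?_⟩
    have h1 := hN.map_sub_le (w i) (w N) (w j)
    have h2 : normLp p (nrm (w i - w j))
        ≤ normLp p (nrm (w i - w N) + nrm (w N - w j)) :=
      normLp_mono ((Lp ℝ p m).add_mem (hmem _) (hmem _)) (by
        rw [abs_of_nonneg (hN.nonneg _),
          abs_of_nonneg (add_nonneg (hN.nonneg _) (hN.nonneg _))]
        exact h1)
    have h3 := normLp_add_le Fact.out (hmem (w i - w N)) (hmem (w N - w j))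
    rw [hN.map_sub_rev (w N)] at h3 h2
    have h4 := hle2 N i hi
    have h5 := hle2 N j hj
    linarith
  -- As soon as `N > n`, the piece of `w N` on `E n` is that of `v n`, so the discrepancy is `1_{E
  -- n} (W - w N)` and tends to zero in norm.
  refine ⟨W, fun n => ?_⟩
  by_contra hcon
  refine hne _ (sub_ne_zero.2 hcon) (normLp_eq_zero hp0 (hmem _) (le_antisymm ?_
    (normLp_nonneg _ _)))
  refine ge_of_tendsto hW ?_
  filter_upwards [eventually_gt_atTop n] with N hNn
  have h1 : charFun m (E n) (hE n) • W - charFun m (E n) (hE n) • v n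
      = charFun m (E n) (hE n) • (W - w N) := by
    rw [smul_sub, charFun_smul_sum_range hE hdisj, if_pos hNn]
  rw [h1, hN.charFun_smul]
  refine normLp_mono (hmem _) ?_
  rw [hN.map_sub_rev, aeeqFun_abs_mul, abs_charFun, aeeqFun_le_iff]
  filter_upwards [coeFn_charFun_mul (E n) (hE n) |nrm (w N - W)|,
    aeeqFun_nonneg_iff.1 (abs_nonneg (nrm (w N - W)))] with x e1 e2
  rw [e1]
  exact indicator_le_self' (fun _ _ => e2) x

/-- Test with `E = {f < g}`: there the smaller function has at least the norm of the larger one, and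
this norm is finite, so they agree a.e. on `E`, which must be null. -/
lemma le_of_forall_normLp_charFun_mul_le {p : ℝ≥0∞} (hp0 : p ≠ 0) (hp' : p ≠ ∞)
    {f g : X →ₘ[m] ℝ} (hf : f ∈ Lp ℝ p m) (hg : g ∈ Lp ℝ p m) (hf0 : 0 ≤ f)
    (h : ∀ (E : Set X) (hE : MeasurableSet E), normLp p ((charFun m E hE : X →ₘ[m] ℝ) * g)
      ≤ normLp p ((charFun m E hE : X →ₘ[m] ℝ) * f)) : g ≤ f := by
  have hpp := ENNReal.toReal_pos hp0 hp'
  set E : Set X := {x | f x < g x}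
  have hE : MeasurableSet E := measurableSet_lt f.measurable g.measurable
  set F := (charFun m E hE : X →ₘ[m] ℝ) * f
  set G := (charFun m E hE : X →ₘ[m] ℝ) * g
  have hF : F ∈ Lp ℝ p m := mul_mem_Lp (charFun m E hE).2 hf
  have hG : G ∈ Lp ℝ p m := mul_mem_Lp (charFun m E hE).2 hg
  have h1 : (fun x => ‖F x‖ₑ ^ p.toReal) ≤ᵐ[m] fun x => ‖G x‖ₑ ^ p.toReal := by
    filter_upwards [coeFn_charFun_mul E hE f, coeFn_charFun_mul E hE g,
      aeeqFun_nonneg_iff.1 hf0] with x e1 e2 e3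
    refine ENNReal.rpow_le_rpow ?_ hpp.le
    rw [e1, e2]
    by_cases hx : x ∈ E
    · rw [indicator_of_mem hx, indicator_of_mem hx]
      have : f x < g x := hx
      rw [Real.enorm_eq_ofReal e3, Real.enorm_eq_ofReal (e3.trans this.le)]
      exact ENNReal.ofReal_le_ofReal this.le
    · rw [indicator_of_notMem hx, indicator_of_notMem hx]
  have h2 := ae_eq_of_ae_le_of_lintegral_le h1
    (by rw [normLp_rpow hp0 hp' hF]; exact ENNReal.ofReal_ne_top)
    (G.measurable.enorm.pow_const _).aemeasurable
    (by
      rw [normLp_rpow hp0 hp' hF, normLp_rpow hp0 hp' hG]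
      exact ENNReal.ofReal_le_ofReal
        (Real.rpow_le_rpow (normLp_nonneg _ _) (h E hE) hpp.le))
  rw [aeeqFun_le_iff]
  filter_upwards [h2, coeFn_charFun_mul E hE f, coeFn_charFun_mul E hE g,
    aeeqFun_nonneg_iff.1 hf0] with x e0 e1 e2 e3
  by_contra hx
  have hx' : f x < g x := not_le.1 hx
  have hxE : x ∈ E := hx'
  have e4 := ENNReal.rpow_left_injective hpp.ne' e0
  rw [e1, e2, indicator_of_mem hxE, indicator_of_mem hxE, Real.enorm_eq_ofReal e3,
    Real.enorm_eq_ofReal (e3.trans hx'.le)] at e4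
  exact ((ENNReal.ofReal_lt_ofReal_iff (e3.trans_lt hx')).2 hx').ne e4

/-- Bounded functions are uniformly close to functions with countably many values. -/
lemma exists_floor_approx (h : Linfty m) {ε : ℝ} (hε : 0 < ε) :
    ∃ (r : Linfty m) (E : ℕ → Set X) (hE : ∀ n, MeasurableSet (E n)) (c : ℕ → ℝ),
      Pairwise (fun i j => Disjoint (E i) (E j)) ∧ (⋃ n, E n) = univ ∧
      normLp ∞ (r : X →ₘ[m] ℝ) ≤ ε ∧
      ∀ n, charFun m (E n) (hE n) * (h - r) = c n • charFun m (E n) (hE n) := by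
  have hmeas := (h : X →ₘ[m] ℝ).measurable
  -- Removing this remainder rounds `h` down to a multiple of `ε`; the level sets of the rounded
  -- function are indexed by `ℤ`, enumerated by `ℕ`.
  let r₀ : X → ℝ := fun x => ε * Int.fract ((h : X →ₘ[m] ℝ) x / ε)
  have hr₀ : Measurable r₀ := (measurable_fract.comp (hmeas.div_const ε)).const_mul ε
  have hbd : ∀ x, ‖r₀ x‖ ≤ ε := fun x => by
    rw [Real.norm_eq_abs, abs_of_nonneg (mul_nonneg hε.le (Int.fract_nonneg _))]
    exact mul_le_of_le_one_right hε.le (Int.fract_lt_one _).le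
  have hrL : AEEqFun.mk r₀ hr₀.aestronglyMeasurable ∈ Lp ℝ ∞ m := by
    rw [Lp.mem_Lp_iff_memLp]
    exact MemLp.ae_eq (AEEqFun.coeFn_mk _ _).symm
      (memLp_top_of_bound hr₀.aestronglyMeasurable ε (Eventually.of_forall hbd))
  let e := Denumerable.eqv ℤ
  let E : ℕ → Set X := fun n => {x | ⌊(h : X →ₘ[m] ℝ) x / ε⌋ = e.symm n}
  have hE : ∀ n, MeasurableSet (E n) := fun n =>
    (Int.measurable_floor.comp (hmeas.div_const ε)) (measurableSet_singleton _)
  refine ⟨⟨_, hrL⟩, E, hE, fun n => ε * (e.symm n : ℤ), fun i j hij => ?_, ?_, ?_, fun n => ?_⟩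
  · refine Set.disjoint_left.2 fun x hi hj => hij (e.symm.injective ?_)
    exact (show _ = _ from hi).symm.trans hj
  · exact eq_univ_of_forall fun x => mem_iUnion.2 ⟨e ⌊(h : X →ₘ[m] ℝ) x / ε⌋, by simp [E]⟩
  · refine ENNReal.toReal_le_of_le_ofReal hε.le ?_
    rw [eLpNorm_congr_ae (AEEqFun.coeFn_mk _ _), eLpNorm_exponent_top]
    refine eLpNormEssSup_le_of_ae_bound (Eventually.of_forall hbd)
  · refine Subtype.ext (AEEqFun.ext ?_)
    filter_upwards [coeFn_charFun_mul (E n) (hE n) ((h : X →ₘ[m] ℝ) - AEEqFun.mk r₀ _),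
      AEEqFun.coeFn_sub (h : X →ₘ[m] ℝ) (AEEqFun.mk r₀ hr₀.aestronglyMeasurable),
      AEEqFun.coeFn_mk r₀ (hr₀.aestronglyMeasurable (μ := m)),
      AEEqFun.coeFn_smul (ε * (e.symm n : ℤ)) (charFun m (E n) (hE n) : X →ₘ[m] ℝ),
      coeFn_charFun (m := m) (E n) (hE n)] with x e1 e2 e3 e4 e5
    refine e1.trans (Eq.trans ?_ e4.symm)
    rw [Pi.smul_apply, e5]
    by_cases hx : x ∈ E n
    · have hx' : ⌊(h : X →ₘ[m] ℝ) x / ε⌋ = e.symm n := hx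
      rw [indicator_of_mem hx, indicator_of_mem hx, e2, Pi.sub_apply, e3, ← hx', smul_eq_mul,
        mul_one]
      simp only [r₀, Int.fract]
      field_simp
      ring
    · rw [indicator_of_notMem hx, indicator_of_notMem hx, smul_zero]

end PointwiseSeminorm

/-! ### The cotangent module: pointwise norm, completeness, generation by differentials -/

section CotangentNorm

variable {X : Type*} [MetricSpace X] [MeasurableSpace X]
variable {p : ℝ≥0∞} [Fact (1 ≤ p)] [Fact (p ≠ ∞)] {m : Measure X}

variable (p m) in
/-- The `1`-forms glued from countably many elements of the linear span of the differentials. -/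
def gluedForms : Set (CotangentModule p m) :=
  {w | ∃ (E : ℕ → Set X) (hE : ∀ n, MeasurableSet (E n)) (v : ℕ → CotangentModule p m),
    Pairwise (fun i j => Disjoint (E i) (E j)) ∧ (⋃ n, E n) = univ ∧
    (∀ n, v n ∈ Submodule.span ℝ (range (differential p m))) ∧
    ∀ n, charFun m (E n) (hE n) • w = charFun m (E n) (hE n) • v n}

/-- On the common refinement of the two partitions, indexed by pairs, the sum is glued from the sums
of the pieces. -/
lemma add_mem_gluedForms {w w' : CotangentModule p m} (hw : w ∈ gluedForms p m)
    (hw' : w' ∈ gluedForms p m) : w + w' ∈ gluedForms p m := by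
  obtain ⟨E, hE, v, hd, hu, hs, hg⟩ := hw
  obtain ⟨E', hE', v', hd', hu', hs', hg'⟩ := hw'
  refine ⟨fun k => E k.unpair.1 ∩ E' k.unpair.2, fun k => (hE _).inter (hE' _),
    fun k => v k.unpair.1 + v' k.unpair.2, fun i j hij => ?_, ?_,
    fun k => Submodule.add_mem _ (hs _) (hs' _), fun k => ?_⟩
  · by_cases h1 : i.unpair.1 = j.unpair.1
    · have h2 : i.unpair.2 ≠ j.unpair.2 := fun h2 => hij (by
        rw [← Nat.pair_unpair i, ← Nat.pair_unpair j, h1, h2])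
      exact (hd' h2).mono inter_subset_right inter_subset_right
    · exact (hd h1).mono inter_subset_left inter_subset_left
  · refine eq_univ_of_forall fun x => ?_
    obtain ⟨i, hi⟩ := mem_iUnion.1 (hu ▸ mem_univ x : x ∈ ⋃ n, E n)
    obtain ⟨j, hj⟩ := mem_iUnion.1 (hu' ▸ mem_univ x : x ∈ ⋃ n, E' n)
    exact mem_iUnion.2 ⟨Nat.pair i j, by simpa using ⟨hi, hj⟩⟩
  · rw [← charFun_mul_charFun _ _ (hE _) (hE' _), smul_add, smul_add]
    congr 1
    · rw [mul_comm, mul_smul, mul_smul, hg]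
    · rw [mul_smul, mul_smul, hg']

variable [BorelSpace X] [SigmaFinite m]

lemma isPointwiseSeminorm_formalNorm :
    IsPointwiseSeminorm (formalNorm : FormalForm p m → X →ₘ[m] ℝ) :=
  ⟨formalNorm_nonneg, formalNorm_add_le, formalNorm_smul⟩

/-- The pointwise norm of a formal form, as an element of `L^p(m)`. -/
def formalNormLp (t : FormalForm p m) : Lp ℝ p m := ⟨formalNorm t, formalNorm_mem_Lp t⟩

lemma norm_formalNormLp (t : FormalForm p m) : ‖formalNormLp t‖ = ‖t‖ := normLp_formalNorm t

/-- The reverse triangle inequality holds pointwise, so the pointwise norm is `1`-Lipschitz into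
`L^p` and extends to the completion. -/
lemma lipschitzWith_formalNormLp :
    LipschitzWith 1 (formalNormLp : FormalForm p m → Lp ℝ p m) := by
  refine LipschitzWith.of_dist_le_mul fun s t => ?_
  rw [dist_eq_norm, dist_eq_norm, NNReal.coe_one, one_mul, ← norm_formalNormLp (s - t)]
  refine normLp_mono (formalNorm_mem_Lp (s - t)) ?_
  exact (isPointwiseSeminorm_formalNorm.abs_sub_le s t).trans (le_abs_self _)

/-- The continuous extension of the pointwise norm to the cotangent module. -/
def cotangentNormLp : CotangentModule p m → Lp ℝ p m :=
  UniformSpace.Completion.extension formalNormLp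

lemma continuous_cotangentNormLp :
    Continuous (cotangentNormLp : CotangentModule p m → Lp ℝ p m) :=
  UniformSpace.Completion.continuous_extension

lemma cotangentNormLp_coe (t : FormalForm p m) :
    cotangentNormLp (t : CotangentModule p m) = formalNormLp t :=
  UniformSpace.Completion.extension_coe lipschitzWith_formalNormLp.uniformContinuous t

lemma cotangentNormLp_nonneg (ω : CotangentModule p m) : 0 ≤ cotangentNormLp ω := by
  induction ω using UniformSpace.Completion.induction_on with
  | hp => exact isClosed_le continuous_const continuous_cotangentNormLp
  | ih t => rw [cotangentNormLp_coe]; exact formalNorm_nonneg t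

lemma cotangentNormLp_add_le (ω η : CotangentModule p m) :
    cotangentNormLp (ω + η) ≤ cotangentNormLp ω + cotangentNormLp η := by
  induction ω, η using UniformSpace.Completion.induction_on₂ with
  | hp =>
    exact isClosed_le (continuous_cotangentNormLp.comp continuous_add)
      ((continuous_cotangentNormLp.comp continuous_fst).add
        (continuous_cotangentNormLp.comp continuous_snd))
  | ih s t =>
    rw [← UniformSpace.Completion.coe_add, cotangentNormLp_coe, cotangentNormLp_coe,
      cotangentNormLp_coe]
    exact formalNorm_add_le s t

lemma cotangentNormLp_smul (h : Linfty m) (ω : CotangentModule p m) :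
    cotangentNormLp (h • ω) = mulLp p ⟨|(h : X →ₘ[m] ℝ)|, abs_mem_Lp h.2⟩ (cotangentNormLp ω) := by
  induction ω using UniformSpace.Completion.induction_on with
  | hp =>
    exact isClosed_eq (continuous_cotangentNormLp.comp (continuous_const_smul h))
      ((ContinuousLinearMap.continuous _).comp continuous_cotangentNormLp)
  | ih t =>
    rw [← UniformSpace.Completion.coe_smul, cotangentNormLp_coe, cotangentNormLp_coe]
    exact Subtype.ext (formalNorm_smul h t)

lemma norm_cotangentNormLp (ω : CotangentModule p m) : ‖cotangentNormLp ω‖ = ‖ω‖ := by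
  induction ω using UniformSpace.Completion.induction_on with
  | hp => exact isClosed_eq continuous_cotangentNormLp.norm continuous_norm
  | ih t =>
    rw [cotangentNormLp_coe, UniformSpace.Completion.norm_coe]
    exact norm_formalNormLp t

/-- A nonnegative function in `L^p` is determined by its norms over all measurable sets, and the
continuous extension has the norms prescribed in the definition. All properties of the pointwise
norm are then obtained by density from formal forms. -/
lemma cotangentNorm_eq (ω : CotangentModule p m) : cotangentNorm p m ω = cotangentNormLp ω := by
  have hp0 : p ≠ 0 := (zero_lt_one.trans_le Fact.out).ne'
  have hex : (cotangentNormLp ω : X →ₘ[m] ℝ) ∈ Lp ℝ p m ∧ 0 ≤ (cotangentNormLp ω : X →ₘ[m] ℝ) ∧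
      ∀ (E : Set X) (hE : MeasurableSet E),
        normLp p ((charFun m E hE : X →ₘ[m] ℝ) * (cotangentNormLp ω : X →ₘ[m] ℝ))
          = ‖charFun m E hE • ω‖ := by
    refine ⟨(cotangentNormLp ω).2, cotangentNormLp_nonneg ω, fun E hE => ?_⟩
    rw [← norm_cotangentNormLp, cotangentNormLp_smul, ← normLp_coe, coe_mulLp]
    simp only [abs_charFun]
  have hspec := Classical.epsilon_spec (p := fun g => g ∈ Lp ℝ p m ∧ 0 ≤ g ∧
    ∀ (E : Set X) (hE : MeasurableSet E),
      normLp p ((charFun m E hE : X →ₘ[m] ℝ) * g) = ‖charFun m E hE • ω‖) ⟨_, hex⟩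
  change cotangentNorm p m ω ∈ Lp ℝ p m ∧ 0 ≤ cotangentNorm p m ω ∧
    ∀ (E : Set X) (hE : MeasurableSet E),
      normLp p ((charFun m E hE : X →ₘ[m] ℝ) * cotangentNorm p m ω) = ‖charFun m E hE • ω‖ at hspec
  refine le_antisymm ?_ ?_
  · exact le_of_forall_normLp_charFun_mul_le hp0 Fact.out hex.1 hspec.1 hex.2.1 fun E hE => by
      rw [hspec.2.2, hex.2.2]
  · exact le_of_forall_normLp_charFun_mul_le hp0 Fact.out hspec.1 hex.1 hspec.2.1 fun E hE => by
      rw [hspec.2.2, hex.2.2]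

lemma normLp_cotangentNorm (ω : CotangentModule p m) :
    normLp p (cotangentNorm p m ω) = ‖ω‖ := by
  rw [cotangentNorm_eq, normLp_coe, norm_cotangentNormLp]

lemma cotangentNorm_coe (t : FormalForm p m) :
    cotangentNorm p m (t : CotangentModule p m) = formalNorm t := by
  rw [cotangentNorm_eq, cotangentNormLp_coe]; rfl

lemma cotangentNorm_differential (f : dirichletSpace p m) :
    cotangentNorm p m (differential p m f) = (minGrad p m f : X →ₘ[m] ℝ) :=
  (cotangentNorm_coe _).trans (formalNorm_of_one f)

lemma cotangentNorm_mem_Lp (ω : CotangentModule p m) : cotangentNorm p m ω ∈ Lp ℝ p m := by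
  rw [cotangentNorm_eq]; exact (cotangentNormLp ω).2

lemma isPointwiseSeminorm_cotangentNorm :
    IsPointwiseSeminorm (cotangentNorm p m : CotangentModule p m → X →ₘ[m] ℝ) where
  nonneg ω := by rw [cotangentNorm_eq]; exact cotangentNormLp_nonneg ω
  triangle ω η := by
    simp only [cotangentNorm_eq]; exact cotangentNormLp_add_le ω η
  smul h ω := by
    simp only [cotangentNorm_eq, cotangentNormLp_smul, coe_mulLp]

/-- The `L^p`-norm of the pointwise norm is the norm of the completion, so completeness is built in;
glueing follows from it because `p < ∞`. -/
lemma isLpBanachModule_cotangentModule :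
    IsLpBanachModule p m (CotangentModule p m) (cotangentNorm p m) := by
  have hne : ∀ ω : CotangentModule p m, ω ≠ 0 → cotangentNorm p m ω ≠ 0 := fun ω hω h => by
    refine hω (norm_eq_zero.1 ?_)
    rw [← normLp_cotangentNorm, h, normLp_zero]
  have hcomplete : ∀ u : ℕ → CotangentModule p m,
      (∀ ε : ℝ, 0 < ε → ∃ N, ∀ i ≥ N, ∀ j ≥ N, normLp p (cotangentNorm p m (u i - u j)) < ε) →
      ∃ v, Tendsto (fun i => normLp p (cotangentNorm p m (u i - v))) atTop (𝓝 0) := by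
    intro u hu
    simp only [normLp_cotangentNorm] at hu ⊢
    obtain ⟨v, hv⟩ := cauchySeq_tendsto_of_complete (u := u) (Metric.cauchySeq_iff.2 fun ε hε => by
      obtain ⟨N, hN⟩ := hu ε hε
      exact ⟨N, fun i hi j hj => by rw [dist_eq_norm]; exact hN i hi j hj⟩)
    exact ⟨v, tendsto_iff_norm_sub_tendsto_zero.1 hv⟩
  have hN := isPointwiseSeminorm_cotangentNorm (p := p) (m := m)
  exact
    { mem_Lp := cotangentNorm_mem_Lp
      nonneg := hN.nonneg
      ne_zero := hne
      triangle := hN.triangle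
      smul := hN.smul
      complete := hcomplete
      glueing := exists_glue_of_complete Fact.out hN cotangentNorm_mem_Lp hne hcomplete }

/-- Approximate `h` uniformly by `h - r` with countably many values. On a level set, `(h - r) df` is
a constant multiple of `df`, and the error is at most `‖r‖_∞ ‖df‖`. -/
lemma of_mem_closure_gluedForms (h : Linfty m) (f : dirichletSpace p m) :
    ((FormalForm.of p m h f : FormalForm p m) : CotangentModule p m)
      ∈ closure (gluedForms p m) := by
  rw [Metric.mem_closure_iff]
  intro ε hε
  set C := ‖differential p m f‖
  have hC : 0 ≤ C := norm_nonneg _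
  obtain ⟨r, E, hE, c, hd, hu, hr, hc⟩ := exists_floor_approx h
    (show 0 < ε / (C + 1) by positivity)
  have hof : ∀ k : Linfty m, ((FormalForm.of p m k f : FormalForm p m) : CotangentModule p m)
      = k • differential p m f := fun k => by
    refine Eq.trans ?_ (UniformSpace.Completion.coe_smul k (FormalForm.of p m 1 f))
    refine congrArg _ ?_
    change k ⊗ₜ[ℝ] f = (k * 1) ⊗ₜ[ℝ] f
    rw [mul_one]
  refine ⟨(h - r) • differential p m f, ⟨E, hE, fun n => differential p m (c n • f), hd, hu,
    fun n => Submodule.subset_span ⟨_, rfl⟩, fun n => ?_⟩, ?_⟩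
  · rw [← mul_smul, hc, ← hof]
    refine Eq.trans ?_ (UniformSpace.Completion.coe_smul _ (FormalForm.of p m 1 (c n • f)))
    refine congrArg _ ?_
    change (c n • charFun m (E n) (hE n)) ⊗ₜ[ℝ] f = (charFun m (E n) (hE n) * 1) ⊗ₜ[ℝ] (c n • f)
    rw [mul_one, TensorProduct.smul_tmul]
  · rw [hof, dist_eq_norm, ← sub_smul, sub_sub_cancel, ← normLp_cotangentNorm,
      isPointwiseSeminorm_cotangentNorm.smul]
    refine (normLp_mul_le (abs_mem_Lp r.2) (cotangentNorm_mem_Lp _)).trans_lt ?_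
    rw [normLp_abs, normLp_cotangentNorm]
    change _ * C < ε
    calc normLp ∞ (r : X →ₘ[m] ℝ) * C ≤ ε / (C + 1) * C := by gcongr
      _ < ε := by
        rw [div_mul_eq_mul_div, div_lt_iff₀ (by positivity)]
        nlinarith

lemma closure_gluedForms : closure (gluedForms p m) = univ := by
  refine eq_univ_of_forall fun ω => ?_
  have hadd : ∀ w ∈ closure (gluedForms p m), ∀ w' ∈ closure (gluedForms p m),
      w + w' ∈ closure (gluedForms p m) := fun w hw w' hw' =>
    map_mem_closure₂ continuous_add hw hw' fun a ha b hb => add_mem_gluedForms ha hb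
  induction ω using UniformSpace.Completion.induction_on with
  | hp => exact isClosed_closure
  | ih t =>
    obtain ⟨l, rfl⟩ := exists_listForm p m t
    induction l with
    | nil =>
      have h := of_mem_closure_gluedForms (p := p) (m := m) 0 0
      have h0 : FormalForm.of p m 0 0 = listForm p m [] := TensorProduct.zero_tmul _ _
      rwa [h0] at h
    | cons a l ih =>
      have h1 : listForm p m (a :: l) = FormalForm.of p m a.1 a.2 + listForm p m l := by
        simp [listForm]
      rw [h1, UniformSpace.Completion.coe_add]
      exact hadd _ (of_mem_closure_gluedForms a.1 a.2) _ ih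

lemma generates_differential :
    Generates p m (cotangentNorm p m) (range (differential p m)) := by
  have hp0 : p ≠ 0 := (zero_lt_one.trans_le Fact.out).ne'
  intro ω ε hε
  obtain ⟨w, ⟨E, hE, v, hd, hu, hs, hg⟩, hw⟩ := Metric.mem_closure_iff.1
    (closure_gluedForms (p := p) (m := m) ▸ mem_univ ω : ω ∈ closure (gluedForms p m)) ε hε
  refine ⟨E, hE, v, w, hd, hu, hs, ?_, hg, ?_⟩
  -- The pieces are those of an existing element `w`, so the `ℓ^p` condition is that `|w|` is in
  -- `L^p`.
  · simp only [← hg, isPointwiseSeminorm_cotangentNorm.charFun_smul]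
    exact memℓp_of_mem_Lp hp0 Fact.out hE hd (cotangentNorm_mem_Lp w)
  · rwa [normLp_cotangentNorm, ← dist_eq_norm]

end CotangentNorm

/-! ### Hölder's inequality for multiplication operators -/

section Holder

variable {X : Type*} [MeasurableSpace X] {m : Measure X} {p q : ℝ≥0∞}

/-- Multiplication by an element of `L^p(m)`, from `L^q(m)` to `L¹(m)`. -/
def mulL1 [Fact (1 ≤ q)] (hpq : p.HolderConjugate q) (k : Lp ℝ p m) :
    Lp ℝ q m →L[ℝ] Lp ℝ 1 m :=
  LinearMap.mkContinuous
    { toFun := fun f => ⟨(f : X →ₘ[m] ℝ) * k, mul_mem_L1 hpq f.2 k.2⟩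
      map_add' := fun _ _ => Subtype.ext (add_mul _ _ _)
      map_smul' := fun c _ => Subtype.ext (smul_mul_assoc c _ _) }
    (normLp p (k : X →ₘ[m] ℝ)) fun f => by
      rw [mul_comm]
      exact normLp_mul_le_mul hpq f.2 k.2

lemma eq_zero_of_abs_le_zero {f : X →ₘ[m] ℝ} (h : |f| ≤ 0) : f = 0 :=
  le_antisymm ((le_abs_self f).trans h) (neg_nonpos.1 ((neg_le_abs f).trans h))

end Holder

/-! ### Sobolev derivations form a Banach module -/

section DerivationNorm

variable {X : Type*} [MetricSpace X] [MeasurableSpace X]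
variable {p q : ℝ≥0∞} [Fact (1 ≤ p)] [Fact (p ≠ ∞)] {m : Measure X}

lemma directedOn_derivationBounds (δ : sobolevSpace p m →ₗ[ℝ] LpModule 1 m) :
    DirectedOn (· ≥ ·) (derivationBounds p q m δ) := by
  rintro g ⟨hg, hg0, hgδ⟩ h ⟨hh, hh0, hhδ⟩
  refine ⟨g ⊓ h, ⟨mem_Lp_of_abs_le hg ?_, le_inf hg0 hh0, fun f => ?_⟩, inf_le_left, inf_le_right⟩
  · rw [abs_of_nonneg (le_inf hg0 hh0), abs_of_nonneg hg0]
    exact inf_le_left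
  · rw [aeeqFun_le_iff]
    filter_upwards [aeeqFun_le_iff.1 (hgδ f), aeeqFun_le_iff.1 (hhδ f),
      AEEqFun.coeFn_mul g (minGrad p m f : X →ₘ[m] ℝ),
      AEEqFun.coeFn_mul h (minGrad p m f : X →ₘ[m] ℝ),
      AEEqFun.coeFn_mul (g ⊓ h) (minGrad p m f : X →ₘ[m] ℝ), AEEqFun.coeFn_inf g h]
      with x e1 e2 e3 e4 e5 e6
    rw [e5, Pi.mul_apply, e6]
    rw [e3, Pi.mul_apply] at e1
    rw [e4, Pi.mul_apply] at e2
    rcases min_choice (g x) (h x) with h | h <;> rw [h] <;> assumption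

lemma coe_sub_derivation (δ ε : SobolevDerivation p q m) : (δ - ε).1 = δ.1 - ε.1 := rfl

variable [SigmaFinite m]

/-- The set of bounds is directed downwards, so its infimum is an a.e. limit of admissible
functions; the pointwise inequality survives the limit and the infimum is itself admissible. -/
lemma isLeast_derivationNorm (δ : SobolevDerivation p q m) :
    IsLeast (derivationBounds p q m δ.1) (derivationNorm p q m δ) := by
  obtain ⟨g, u, hg, hu, -, hlim⟩ := exists_isGLB_of_directedOn
    (δ.2 : (derivationBounds p q m δ.1).Nonempty) (directedOn_derivationBounds δ.1)
    ⟨0, fun k hk => hk.2.1⟩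
  have hspec : IsGLB (derivationBounds p q m δ.1) (derivationNorm p q m δ) :=
    Classical.epsilon_spec (p := fun g => IsGLB (derivationBounds p q m δ.1) g) ⟨g, hg⟩
  rw [← hg.unique hspec]
  have hg0 : 0 ≤ g := hg.2 fun k hk => hk.2.1
  refine ⟨⟨mem_Lp_of_abs_le (hu 0).1 ?_, hg0, fun f => ?_⟩, hg.1⟩
  · rw [abs_of_nonneg hg0, abs_of_nonneg (hu 0).2.1]
    exact hg.1 (hu 0)
  · have h1 : ∀ᵐ x ∂m, ∀ n, |(δ.1 f : X →ₘ[m] ℝ)| x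
        ≤ u n x * (minGrad p m f : X →ₘ[m] ℝ) x := ae_all_iff.2 fun n => by
      filter_upwards [aeeqFun_le_iff.1 ((hu n).2.2 f),
        AEEqFun.coeFn_mul (u n) (minGrad p m f : X →ₘ[m] ℝ)] with x e1 e2
      rwa [e2] at e1
    rw [aeeqFun_le_iff]
    filter_upwards [h1, hlim, AEEqFun.coeFn_mul g (minGrad p m f : X →ₘ[m] ℝ)] with x e1 e2 e3
    rw [e3]
    exact ge_of_tendsto (e2.mul_const _) (Eventually.of_forall e1)

lemma derivationNorm_nonneg (δ : SobolevDerivation p q m) : 0 ≤ derivationNorm p q m δ :=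
  (isLeast_derivationNorm δ).1.2.1

lemma derivationNorm_mem_Lp (δ : SobolevDerivation p q m) :
    derivationNorm p q m δ ∈ Lp ℝ q m := (isLeast_derivationNorm δ).1.1

lemma abs_apply_le_derivationNorm (δ : SobolevDerivation p q m) (f : sobolevSpace p m) :
    |(δ.1 f : X →ₘ[m] ℝ)| ≤ derivationNorm p q m δ * (minGrad p m f : X →ₘ[m] ℝ) :=
  (isLeast_derivationNorm δ).1.2.2 f

lemma isPointwiseSeminorm_derivationNorm :
    IsPointwiseSeminorm (derivationNorm p q m : SobolevDerivation p q m → X →ₘ[m] ℝ) := by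
  have htri : ∀ δ ε : SobolevDerivation p q m,
      derivationNorm p q m (δ + ε) ≤ derivationNorm p q m δ + derivationNorm p q m ε := by
    refine fun δ ε => (isLeast_derivationNorm (δ + ε)).2 ⟨(Lp ℝ q m).add_mem
      (derivationNorm_mem_Lp δ) (derivationNorm_mem_Lp ε), add_nonneg (derivationNorm_nonneg δ)
      (derivationNorm_nonneg ε), fun f => ?_⟩
    rw [add_mul]
    exact (abs_add_le (δ.1 f : X →ₘ[m] ℝ) (ε.1 f : X →ₘ[m] ℝ)).trans
      (add_le_add (abs_apply_le_derivationNorm δ f) (abs_apply_le_derivationNorm ε f))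
  have hsmul : ∀ (h : Linfty m) (δ : SobolevDerivation p q m),
      derivationNorm p q m (h • δ) ≤ |(h : X →ₘ[m] ℝ)| * derivationNorm p q m δ := by
    refine fun h δ => (isLeast_derivationNorm (h • δ)).2 ⟨mul_mem_Lp (abs_mem_Lp h.2)
      (derivationNorm_mem_Lp δ), mul_nonneg (abs_nonneg _) (derivationNorm_nonneg δ), fun f => ?_⟩
    change |(h : X →ₘ[m] ℝ) * (δ.1 f : X →ₘ[m] ℝ)| ≤ _
    rw [aeeqFun_abs_mul, mul_assoc]
    exact mul_le_mul_of_nonneg_left (abs_apply_le_derivationNorm δ f) (abs_nonneg _)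
  exact ⟨derivationNorm_nonneg, htri, nrm_smul_eq_of_le derivationNorm_nonneg htri hsmul⟩

lemma derivationNorm_ne_zero (δ : SobolevDerivation p q m) (hδ : δ ≠ 0) :
    derivationNorm p q m δ ≠ 0 := by
  intro h
  refine hδ (Subtype.ext (LinearMap.ext fun f => Subtype.ext ?_))
  have h1 := abs_apply_le_derivationNorm δ f
  rw [h, zero_mul] at h1
  exact eq_zero_of_abs_le_zero h1

/-- By Hölder the values at each `f` are Cauchy in `L¹`, which gives a limit map `δ₀`. To control `u
i - δ₀` by a function in `L^q`, the bounds `|u i - u j|` are passed to their limit in `j`. -/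
lemma derivation_complete (hpq : p.HolderConjugate q) (u : ℕ → SobolevDerivation p q m)
    (hu : ∀ ε : ℝ, 0 < ε →
      ∃ N, ∀ i ≥ N, ∀ j ≥ N, normLp q (derivationNorm p q m (u i - u j)) < ε) :
    ∃ δ, Tendsto (fun i => normLp q (derivationNorm p q m (u i - δ))) atTop (𝓝 0) := by
  have hq1 : Fact (1 ≤ q) := ⟨hpq.symm.one_le⟩
  have hN := isPointwiseSeminorm_derivationNorm (p := p) (q := q) (m := m)
  let F : ℕ → sobolevSpace p m → Lp ℝ 1 m := fun i f => ⟨((u i).1 f : X →ₘ[m] ℝ), ((u i).1 f).2⟩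
  have hFle : ∀ i j f, |((F i f - F j f : Lp ℝ 1 m) : X →ₘ[m] ℝ)|
      ≤ derivationNorm p q m (u i - u j) * (minGrad p m f : X →ₘ[m] ℝ) := fun i j f =>
    abs_apply_le_derivationNorm (u i - u j) f
  have hFlim : ∀ f, ∃ k, Tendsto (fun i => F i f) atTop (𝓝 k) := fun f => by
    refine cauchySeq_tendsto_of_complete (Metric.cauchySeq_iff.2 fun ε hε => ?_)
    set C := ‖minGrad p m (f : X →ₘ[m] ℝ)‖
    have hC : 0 ≤ C := norm_nonneg _
    obtain ⟨N, hN'⟩ := hu (ε / (C + 1)) (by positivity)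
    refine ⟨N, fun i hi j hj => ?_⟩
    rw [dist_eq_norm]
    have h1 : ‖F i f - F j f‖ ≤ normLp q (derivationNorm p q m (u i - u j)) * C := by
      refine le_trans (normLp_mono (mul_mem_L1 hpq (derivationNorm_mem_Lp (u i - u j))
        (minGrad p m (f : X →ₘ[m] ℝ)).2) ((hFle i j f).trans (le_abs_self _)))
        (normLp_mul_le_mul hpq (derivationNorm_mem_Lp (u i - u j)) (minGrad p m _).2)
    refine h1.trans_lt ?_
    calc _ ≤ ε / (C + 1) * C := mul_le_mul_of_nonneg_right (hN' i hi j hj).le hC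
      _ < ε := by
        rw [div_mul_eq_mul_div, div_lt_iff₀ (by positivity)]
        nlinarith
  choose D hD using hFlim
  obtain ⟨δ₀, hδ₀⟩ : ∃ δ₀ : sobolevSpace p m →ₗ[ℝ] LpModule 1 m,
      ∀ f, (δ₀ f : X →ₘ[m] ℝ) = D f := ⟨
    { toFun := fun f => ⟨(D f : X →ₘ[m] ℝ), (D f).2⟩
      map_add' := fun f g => by
        have h := tendsto_nhds_unique (hD (f + g)) ((hD f).add (hD g) |>.congr fun i => by
          refine Subtype.ext ?_
          exact (congrArg Subtype.val ((u i).1.map_add f g)).symm)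
        exact Subtype.ext (congrArg Subtype.val h)
      map_smul' := fun c f => by
        have h := tendsto_nhds_unique (hD (c • f)) ((hD f).const_smul c |>.congr fun i => by
          refine Subtype.ext ?_
          exact (congrArg Subtype.val ((u i).1.map_smul c f)).symm)
        exact Subtype.ext (congrArg Subtype.val h) }, fun f => rfl⟩
  -- For fixed `i` this is Cauchy in `j` by the reverse triangle inequality. Its limit `G i` is
  -- admissible for `u i - δ₀`, and its norm is small for large `i`.
  let b : ℕ → ℕ → Lp ℝ q m := fun i j => ⟨derivationNorm p q m (u i - u j), derivationNorm_mem_Lp _⟩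
  have hb : ∀ i, ∃ G, Tendsto (b i) atTop (𝓝 G) := fun i => by
    refine cauchySeq_tendsto_of_complete (Metric.cauchySeq_iff.2 fun ε hε => ?_)
    obtain ⟨N, hN'⟩ := hu ε hε
    refine ⟨N, fun j hj k hk => ?_⟩
    rw [dist_eq_norm]
    refine lt_of_le_of_lt (normLp_mono (derivationNorm_mem_Lp (u k - u j)) ?_) (hN' k hk j hj)
    refine ((hN.abs_sub_le (u i - u j) (u i - u k)).trans_eq ?_).trans (le_abs_self _)
    rw [sub_sub_sub_cancel_left]
  choose G hG using hb
  have hG0 : ∀ i, 0 ≤ G i := fun i =>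
    ge_of_tendsto (hG i) (Eventually.of_forall fun j => derivationNorm_nonneg (u i - u j))
  have hbound : ∀ i, (G i : X →ₘ[m] ℝ) ∈ derivationBounds p q m ((u i).1 - δ₀) := fun i => by
    refine ⟨(G i).2, hG0 i, fun f => ?_⟩
    have h1 : Tendsto (fun j => |F i f - F j f|) atTop (𝓝 |F i f - D f|) :=
      (tendsto_const_nhds.sub (hD f)).sup_nhds (tendsto_const_nhds.sub (hD f)).neg
    have h2 := ((mulL1 hpq (minGrad p m (f : X →ₘ[m] ℝ))).continuous.tendsto (G i)).comp (hG i)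
    have h3 := le_of_tendsto_of_tendsto' h1 h2 fun j => by
      change |((F i f - F j f : Lp ℝ 1 m) : X →ₘ[m] ℝ)| ≤ _
      exact hFle i j f
    change |((u i).1 f : X →ₘ[m] ℝ) - (δ₀ f : X →ₘ[m] ℝ)| ≤ _
    rw [hδ₀]
    exact h3
  have hmem : ∀ i, (u i).1 - δ₀ ∈ SobolevDerivation p q m := fun i => ⟨_, hbound i⟩
  obtain ⟨δ, hδ⟩ : ∃ δ : SobolevDerivation p q m, δ.1 = δ₀ := ⟨⟨δ₀, by
    have h := (SobolevDerivation p q m).sub_mem (u 0).2 (hmem 0)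
    rwa [sub_sub_cancel] at h⟩, rfl⟩
  refine ⟨δ, ?_⟩
  rw [Metric.tendsto_atTop]
  intro ε hε
  obtain ⟨N, hN'⟩ := hu (ε / 2) (half_pos hε)
  refine ⟨N, fun i hi => ?_⟩
  rw [Real.dist_eq, sub_zero, abs_of_nonneg (normLp_nonneg _ _)]
  refine lt_of_le_of_lt ?_ (half_lt_self hε)
  have h1 : normLp q (derivationNorm p q m (u i - δ)) ≤ ‖G i‖ := by
    refine normLp_mono (G i).2 ?_
    rw [abs_of_nonneg (derivationNorm_nonneg _)]
    refine le_trans ?_ (le_abs_self _)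
    refine (isLeast_derivationNorm (u i - δ)).2 ?_
    rw [coe_sub_derivation, hδ]
    exact hbound i
  refine h1.trans (le_of_tendsto (hG i).norm ?_)
  filter_upwards [eventually_ge_atTop N] with j hj
  exact (hN' i hi j hj).le

/-- The values and the bounds are glued pointwise, without infinite sums or limits in norm; unlike
`exists_glue_of_complete` this includes `q = ∞`. -/
lemma derivation_glueing (hpq : p.HolderConjugate q)
    (E : ℕ → Set X) (hE : ∀ n, MeasurableSet (E n)) (v : ℕ → SobolevDerivation p q m)
    (hdisj : Pairwise fun i j => Disjoint (E i) (E j)) (huniv : (⋃ n, E n) = univ)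
    (hv : Memℓp (fun n => normLp q (derivationNorm p q m (charFun m (E n) (hE n) • v n))) q) :
    ∃ w : SobolevDerivation p q m,
      ∀ n, charFun m (E n) (hE n) • w = charFun m (E n) (hE n) • v n := by
  have hq1 : Fact (1 ≤ q) := ⟨hpq.symm.one_le⟩
  have hN := isPointwiseSeminorm_derivationNorm (p := p) (q := q) (m := m)
  obtain ⟨g, hg⟩ := exists_glue (m := m) E hE (fun n => derivationNorm p q m (v n)) hdisj
  have hgL : g ∈ Lp ℝ q m := mem_Lp_of_glue (zero_lt_one.trans_le hq1.out).ne' hE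
    (fun n => derivationNorm_mem_Lp (v n)) hdisj huniv
    (by simpa only [hN.charFun_smul] using hv) hg
  have hcov : ∀ x, ∃ n, x ∈ E n := fun x => mem_iUnion.1 (huniv ▸ mem_univ x)
  have hg0 : 0 ≤ g := by
    rw [aeeqFun_nonneg_iff]
    filter_upwards [hg, ae_all_iff.2 fun n => aeeqFun_nonneg_iff.1 (hN.nonneg (v n))]
      with x e1 e2
    obtain ⟨n, hn⟩ := hcov x
    rw [e1 n hn]
    exact e2 n
  choose k hk using fun f : sobolevSpace p m =>
    exists_glue (m := m) E hE (fun n => ((v n).1 f : X →ₘ[m] ℝ)) hdisj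
  have hkg : ∀ f, |k f| ≤ g * (minGrad p m f : X →ₘ[m] ℝ) := fun f => by
    have h1 := ae_all_iff.2 fun n => aeeqFun_le_iff.1 (abs_apply_le_derivationNorm (v n) f)
    have h2 := ae_all_iff.2 fun n => AEEqFun.coeFn_abs ((v n).1 f : X →ₘ[m] ℝ)
    have h3 := ae_all_iff.2 fun n =>
      AEEqFun.coeFn_mul (derivationNorm p q m (v n)) (minGrad p m f : X →ₘ[m] ℝ)
    rw [aeeqFun_le_iff]
    filter_upwards [h1, h2, h3, hk f, hg, AEEqFun.coeFn_abs (k f),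
      AEEqFun.coeFn_mul g (minGrad p m f : X →ₘ[m] ℝ)] with x e1 e2 e3 e4 e5 e6 e7
    obtain ⟨n, hn⟩ := hcov x
    rw [e6, e7, Pi.mul_apply, e4 n hn, e5 n hn, ← e2 n]
    exact (e1 n).trans_eq (e3 n)
  have hkL : ∀ f, k f ∈ Lp ℝ 1 m := fun f =>
    mem_Lp_of_abs_le (mul_mem_L1 hpq hgL (minGrad p m (f : X →ₘ[m] ℝ)).2)
      ((hkg f).trans (le_abs_self _))
  let δ₀ : sobolevSpace p m →ₗ[ℝ] LpModule 1 m :=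
    { toFun := fun f => ⟨k f, hkL f⟩
      map_add' := fun f f' => by
        refine Subtype.ext (AEEqFun.ext ?_)
        filter_upwards [hk f, hk f', hk (f + f'), AEEqFun.coeFn_add (k f) (k f'),
          ae_all_iff.2 fun n => AEEqFun.coeFn_add ((v n).1 f : X →ₘ[m] ℝ) ((v n).1 f')]
          with x e1 e2 e3 e4 e5
        obtain ⟨n, hn⟩ := hcov x
        refine Eq.trans ?_ e4.symm
        rw [Pi.add_apply, e1 n hn, e2 n hn]
        refine (e3 n hn).trans ?_
        rw [map_add]
        exact e5 n
      map_smul' := fun c f => by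
        refine Subtype.ext (AEEqFun.ext ?_)
        filter_upwards [hk f, hk (c • f), AEEqFun.coeFn_smul c (k f),
          ae_all_iff.2 fun n => AEEqFun.coeFn_smul c ((v n).1 f : X →ₘ[m] ℝ)]
          with x e1 e3 e4 e5
        obtain ⟨n, hn⟩ := hcov x
        refine Eq.trans ?_ e4.symm
        rw [Pi.smul_apply, e1 n hn]
        refine (e3 n hn).trans ?_
        rw [map_smul]
        exact e5 n }
  refine ⟨⟨δ₀, ⟨g, hgL, hg0, hkg⟩⟩, fun n => ?_⟩
  refine Subtype.ext (LinearMap.ext fun f => Subtype.ext (AEEqFun.ext ?_))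
  filter_upwards [hk f, coeFn_charFun_mul (E n) (hE n) (k f),
    coeFn_charFun_mul (E n) (hE n) ((v n).1 f : X →ₘ[m] ℝ)] with x e1 e2 e3
  refine e2.trans (Eq.trans ?_ e3.symm)
  by_cases hx : x ∈ E n
  · rw [indicator_of_mem hx, indicator_of_mem hx, e1 n hx]
  · rw [indicator_of_notMem hx, indicator_of_notMem hx]

lemma isLpBanachModule_sobolevDerivation (hpq : p.HolderConjugate q) :
    IsLpBanachModule q m (SobolevDerivation p q m) (derivationNorm p q m) := by
  have hN := isPointwiseSeminorm_derivationNorm (p := p) (q := q) (m := m)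
  constructor
  · exact derivationNorm_mem_Lp
  · exact derivationNorm_nonneg
  · exact derivationNorm_ne_zero
  · exact hN.triangle
  · exact hN.smul
  · exact derivation_complete hpq
  · exact derivation_glueing hpq

end DerivationNorm

/-! ### Converse Hölder inequality and the pointwise norm of the dual -/

section Dual

variable {X : Type*} [MeasurableSpace X] {m : Measure X} {p q : ℝ≥0∞}

/-- The converse of Hölder's inequality. -/
lemma eLpNorm_le_of_forall_mul_le [SigmaFinite m] (hpq : p.HolderConjugate q) (hp' : p ≠ ∞)
    {k : X →ₘ[m] ℝ} (hk : k ∈ Lp ℝ 1 m) {C : ℝ} (hC : 0 ≤ C)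
    (h : ∀ φ : Linfty m, (φ : X →ₘ[m] ℝ) ∈ Lp ℝ p m →
      normLp 1 ((φ : X →ₘ[m] ℝ) * k) ≤ C * normLp p (φ : X →ₘ[m] ℝ)) :
    eLpNorm k q m ≤ ENNReal.ofReal C := by
  have hp0 : p ≠ 0 := (zero_lt_one.trans_le hpq.one_le).ne'
  have hq0 : q ≠ 0 := (zero_lt_one.trans_le hpq.symm.one_le).ne'
  -- The hypothesis for honest bounded functions supported in a set of finite measure, in terms of
  -- integrals.
  have key : ∀ (φ : X → ℝ) (B : Set X) (N : ℝ), Measurable φ → MeasurableSet B → m B ≠ ∞ →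
      (∀ x, |φ x| ≤ N) → (∀ x ∉ B, φ x = 0) →
      ∫⁻ x, ‖φ x‖ₑ ^ p.toReal ∂m ≠ ∞ ∧
      ∫⁻ x, ‖φ x‖ₑ * ‖k x‖ₑ ∂m
        ≤ ENNReal.ofReal C * (∫⁻ x, ‖φ x‖ₑ ^ p.toReal ∂m) ^ (1 / p.toReal) := by
    intro φ B N hφ hB hmB hN hφB
    have hLinf : MemLp φ ∞ m := memLp_top_of_bound hφ.aestronglyMeasurable N
      (Eventually.of_forall hN)
    have hLp : MemLp φ p m := by
      refine MemLp.mono (memLp_indicator_const p hB N (Or.inr hmB)) hφ.aestronglyMeasurable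
        (Eventually.of_forall fun x => ?_)
      by_cases hx : x ∈ B
      · rw [indicator_of_mem hx]
        exact (hN x).trans (le_abs_self _)
      · rw [hφB x hx, norm_zero]
        exact norm_nonneg _
    have hmk := AEEqFun.coeFn_mk φ (hφ.aestronglyMeasurable (μ := m))
    let φ' : Linfty m := ⟨AEEqFun.mk φ hφ.aestronglyMeasurable,
      Lp.mem_Lp_iff_memLp.2 (hLinf.ae_eq hmk.symm)⟩
    have hφ' : (φ' : X →ₘ[m] ℝ) ∈ Lp ℝ p m := Lp.mem_Lp_iff_memLp.2 (hLp.ae_eq hmk.symm)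
    have h1 := h φ' hφ'
    have h2 : (φ' : X →ₘ[m] ℝ) * k ∈ Lp ℝ 1 m := mul_mem_Lp φ'.2 hk
    have e1 : eLpNorm ((φ' : X →ₘ[m] ℝ) * k : X →ₘ[m] ℝ) 1 m = ∫⁻ x, ‖φ x‖ₑ * ‖k x‖ₑ ∂m := by
      rw [eLpNorm_one_eq_lintegral_enorm]
      refine lintegral_congr_ae ?_
      filter_upwards [AEEqFun.coeFn_mul (φ' : X →ₘ[m] ℝ) k, hmk] with x h3 h4
      rw [h3, Pi.mul_apply, enorm_mul]
      exact congrArg (fun t : ℝ => ‖t‖ₑ * ‖k x‖ₑ) h4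
    have e2 : eLpNorm (φ' : X →ₘ[m] ℝ) p m = (∫⁻ x, ‖φ x‖ₑ ^ p.toReal ∂m) ^ (1 / p.toReal) := by
      rw [eLpNorm_congr_ae hmk, eLpNorm_eq_lintegral_rpow_enorm_toReal hp0 hp']
    refine ⟨((eLpNorm_lt_top_iff_lintegral_rpow_enorm_lt_top hp0 hp').1 hLp.2).ne, ?_⟩
    rw [← e1, ← e2, ← ENNReal.ofReal_toReal (Lp.mem_Lp_iff_memLp.1 h2).2.ne,
      ← ENNReal.ofReal_toReal (Lp.mem_Lp_iff_memLp.1 hφ').2.ne, ← ENNReal.ofReal_mul hC]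
    exact ENNReal.ofReal_le_ofReal h1
  have hkm := k.measurable
  rcases eq_or_ne q ∞ with rfl | hq'
  · have hp1 : p = 1 := by
      have := hpq
      exact (ENNReal.HolderConjugate.eq_top_iff_eq_one ∞ p).1 rfl
    subst hp1
    rw [eLpNorm_exponent_top]
    refine eLpNormEssSup_le_of_ae_enorm_bound ?_
    -- Here `p = 1`: testing with the indicator of this set `A` gives `∫_A |k| ≤ C m(A)`, which
    -- contradicts `|k| > C` on `A` unless `A` is null.
    have hnull : ∀ N, m ({x | ENNReal.ofReal C < ‖k x‖ₑ} ∩ spanningSets m N) = 0 := by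
      intro N
      set A := {x | ENNReal.ofReal C < ‖k x‖ₑ} ∩ spanningSets m N
      have hA : MeasurableSet A :=
        (measurableSet_lt measurable_const hkm.enorm).inter (measurableSet_spanningSets m N)
      have hAfin : m A ≠ ∞ :=
        ((measure_mono inter_subset_right).trans_lt (measure_spanningSets_lt_top m N)).ne
      by_contra h0
      have h1 := (key (A.indicator fun _ => 1) A 1 (measurable_const.indicator hA) hA hAfin
        (fun x => by by_cases hx : x ∈ A <;> simp [hx]) (fun x hx => by simp [hx])).2
      have e1 : ∀ x, ‖A.indicator (fun _ => (1 : ℝ)) x‖ₑ * ‖k x‖ₑ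
          = A.indicator (fun x => ‖k x‖ₑ) x := fun x => by
        by_cases hx : x ∈ A <;> simp [hx]
      have e2 : ∀ x, ‖A.indicator (fun _ => (1 : ℝ)) x‖ₑ = A.indicator (fun _ => 1) x :=
        fun x => by by_cases hx : x ∈ A <;> simp [hx]
      rw [lintegral_congr e1] at h1
      simp only [ENNReal.toReal_one, ENNReal.rpow_one, e2, div_one] at h1
      rw [lintegral_indicator hA, lintegral_indicator hA, setLIntegral_const, one_mul,
        ← setLIntegral_const] at h1
      refine (setLIntegral_strict_mono hA h0 hkm.enorm ?_ ?_).not_ge h1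
      · rw [setLIntegral_const]
        exact ENNReal.mul_ne_top ENNReal.ofReal_ne_top hAfin
      · exact Eventually.of_forall fun x hx => hx.1
    have h2 : m {x | ENNReal.ofReal C < ‖k x‖ₑ} = 0 := by
      have h3 := measure_iUnion_null hnull
      rwa [← inter_iUnion, iUnion_spanningSets, inter_univ] at h3
    filter_upwards [measure_eq_zero_iff_ae_notMem.1 h2] with x hx
    exact not_lt.1 hx
  · have hconj : p.toReal.HolderConjugate q.toReal :=
      ENNReal.HolderConjugate.toReal_of_ne_top hp' hq'
    set P := p.toReal
    set Q := q.toReal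
    -- Test with `κ N ^ (Q - 1)`. Since `(Q - 1) P = Q`, the integral `I` of `κ N ^ Q` is finite and
    -- satisfies `I ≤ C I ^ (1 / P)`; dividing gives `I ^ (1 / Q) ≤ C`, and Fatou removes the
    -- truncation.
    let κ : ℕ → X → ℝ := fun N => (spanningSets m N).indicator fun x => min |k x| N
    have hκm : ∀ N, Measurable (κ N) := fun N =>
      ((continuous_abs.measurable.comp hkm).min measurable_const).indicator
        (measurableSet_spanningSets m N)
    have hκ0 : ∀ N x, 0 ≤ κ N x := fun N x =>
      indicator_apply_nonneg fun _ => le_min (abs_nonneg _) N.cast_nonneg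
    have hκN : ∀ N x, κ N x ≤ N := fun N x =>
      indicator_apply_le' (fun _ => min_le_right _ _) fun _ => N.cast_nonneg
    have hκk : ∀ N x, κ N x ≤ |k x| := fun N x =>
      indicator_apply_le' (fun _ => min_le_left _ _) fun _ => abs_nonneg _
    have hκ : ∀ N, eLpNorm (κ N) q m ≤ ENNReal.ofReal C := by
      intro N
      rw [eLpNorm_eq_lintegral_rpow_enorm_toReal hq0 hq']
      have hen : ∀ x, ‖κ N x ^ (Q - 1)‖ₑ = ‖κ N x‖ₑ ^ (Q - 1) := fun x => by
        rw [Real.enorm_eq_ofReal (Real.rpow_nonneg (hκ0 N x) _), Real.enorm_eq_ofReal (hκ0 N x),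
          ENNReal.ofReal_rpow_of_nonneg (hκ0 N x) hconj.symm.sub_one_pos.le]
      obtain ⟨h1, h2⟩ := key (fun x => κ N x ^ (Q - 1)) (spanningSets m N) ((N : ℝ) ^ (Q - 1))
        ((hκm N).pow_const _) (measurableSet_spanningSets m N) (measure_spanningSets_lt_top m N).ne
        (fun x => by
          rw [abs_of_nonneg (Real.rpow_nonneg (hκ0 N x) _)]
          exact Real.rpow_le_rpow (hκ0 N x) (hκN N x) hconj.symm.sub_one_pos.le)
        (fun x hx => by
          simp only [κ, indicator_of_notMem hx]
          exact Real.zero_rpow hconj.symm.sub_one_pos.ne')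
      simp only [hen, ← ENNReal.rpow_mul, hconj.symm.sub_one_mul_conj] at h1 h2
      set I := ∫⁻ x, ‖κ N x‖ₑ ^ Q ∂m
      have h3 : I ≤ ENNReal.ofReal C * I ^ (1 / P) := by
        refine le_trans (lintegral_mono fun x => ?_) h2
        have e : ‖κ N x‖ₑ ^ Q = ‖κ N x‖ₑ ^ (Q - 1) * ‖κ N x‖ₑ := by
          conv_lhs => rw [← sub_add_cancel Q 1]
          rw [ENNReal.rpow_add_of_nonneg _ _ hconj.symm.sub_one_pos.le zero_le_one,
            ENNReal.rpow_one]
        rw [e]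
        gcongr
        rw [Real.enorm_eq_ofReal (hκ0 N x), Real.enorm_eq_ofReal_abs]
        exact ENNReal.ofReal_le_ofReal (hκk N x)
      rcases eq_or_ne I 0 with h0 | h0
      · rw [h0, ENNReal.zero_rpow_of_pos (by simpa using hconj.symm.pos)]
        exact bot_le
      · have h4 : I = I ^ (1 / Q) * I ^ (1 / P) := by
          rw [← ENNReal.rpow_add _ _ h0 h1, one_div, one_div, hconj.symm.inv_add_inv_eq_one,
            ENNReal.rpow_one]
        conv_lhs at h3 => rw [h4]
        refine (ENNReal.mul_le_mul_iff_left ?_ ?_).1 h3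
        · exact (ENNReal.rpow_pos (pos_iff_ne_zero.2 h0) h1).ne'
        · exact ENNReal.rpow_ne_top_of_nonneg (by simpa using hconj.pos.le) h1
    have hlim : ∀ x, Tendsto (fun N => κ N x) atTop (𝓝 |k x|) := fun x => by
      obtain ⟨N₁, hN₁⟩ := exists_nat_ge |k x|
      obtain ⟨N₂, hN₂⟩ := mem_iUnion.1 (iUnion_spanningSets m ▸ mem_univ x :
        x ∈ ⋃ N, spanningSets m N)
      refine tendsto_atTop_of_eventually_const (i₀ := max N₁ N₂) fun N hN => ?_
      have e1 : x ∈ spanningSets m N :=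
        monotone_spanningSets m ((le_max_right _ _).trans hN) hN₂
      simp only [κ, indicator_of_mem e1]
      exact min_eq_left (hN₁.trans (Nat.cast_le.2 ((le_max_left _ _).trans hN)))
    have h1 := Lp.eLpNorm_lim_le_liminf_eLpNorm (p := q)
      (fun N => (hκm N).aestronglyMeasurable (μ := m)) (fun x => |k x|)
      (Eventually.of_forall hlim)
    rw [show eLpNorm (fun x => |k x|) q m = eLpNorm k q m from
      eLpNorm_congr_norm_ae (Eventually.of_forall fun x => by
        rw [Real.norm_eq_abs, Real.norm_eq_abs, abs_abs])] at h1
    refine h1.trans ((liminf_le_liminf (Eventually.of_forall hκ)).trans_eq ?_)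
    exact liminf_const _

variable {M : Type*} [AddCommGroup M] [Module (Linfty m) M] {nrm : M → (X →ₘ[m] ℝ)}

/-- By `L^∞`-linearity `φ T(v) = T(φ v)` with `|φ v| ≤ |φ|`, so the operator bound is the hypothesis
of the converse Hölder inequality, with a constant independent of `v`. -/
lemma eLpNorm_dual_le [SigmaFinite m] (hpq : p.HolderConjugate q) (hp' : p ≠ ∞)
    (hN : IsPointwiseSeminorm nrm) (T : M →ₗ[Linfty m] LpModule 1 m) {C : ℝ} (hC : 0 ≤ C)
    (hT : ∀ v : M, normLp 1 (T v : X →ₘ[m] ℝ) ≤ C * normLp p (nrm v)) {v : M} (hv : nrm v ≤ 1) :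
    eLpNorm (T v : X →ₘ[m] ℝ) q m ≤ ENNReal.ofReal C := by
  refine eLpNorm_le_of_forall_mul_le hpq hp' (T v).2 hC fun φ hφ => ?_
  have h1 := hT (φ • v)
  rw [map_smul] at h1
  refine le_trans h1 (mul_le_mul_of_nonneg_left (normLp_mono hφ ?_) hC)
  rw [hN.smul, aeeqFun_abs_mul, abs_abs, abs_of_nonneg (hN.nonneg v)]
  calc |(φ : X →ₘ[m] ℝ)| * nrm v ≤ |(φ : X →ₘ[m] ℝ)| * 1 :=
        mul_le_mul_of_nonneg_left hv (abs_nonneg _)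
    _ = _ := mul_one _

/-- Take `v` where `T v` is the larger value and `w` elsewhere: the combination still has norm at
most one, and its value is the pointwise maximum. -/
lemma directedOn_dualValues (hN : IsPointwiseSeminorm nrm) (T : dualModule p m nrm) :
    DirectedOn (· ≤ ·) (dualValues p m nrm T) := by
  rintro _ ⟨v, hv, rfl⟩ _ ⟨w, hw, rfl⟩
  set k : X →ₘ[m] ℝ := (T.1 v).1
  set l : X →ₘ[m] ℝ := (T.1 w).1
  set A : Set X := {x | l x ≤ k x}
  have hA : MeasurableSet A := measurableSet_le l.measurable k.measurable
  have hval : (T.1 (charFun m A hA • v + charFun m Aᶜ hA.compl • w) : X →ₘ[m] ℝ)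
      = (charFun m A hA : X →ₘ[m] ℝ) * k + (charFun m Aᶜ hA.compl : X →ₘ[m] ℝ) * l := by
    rw [map_add, map_smul, map_smul]; rfl
  refine ⟨_, ⟨charFun m A hA • v + charFun m Aᶜ hA.compl • w, ?_, rfl⟩, ?_, ?_⟩
  · refine (hN.triangle _ _).trans ?_
    rw [hN.charFun_smul, hN.charFun_smul, aeeqFun_le_iff]
    filter_upwards [AEEqFun.coeFn_add ((charFun m A hA : X →ₘ[m] ℝ) * nrm v)
      ((charFun m Aᶜ hA.compl : X →ₘ[m] ℝ) * nrm w), coeFn_charFun_mul A hA (nrm v),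
      coeFn_charFun_mul Aᶜ hA.compl (nrm w), aeeqFun_le_iff.1 hv, aeeqFun_le_iff.1 hw]
      with x e1 e2 e3 e4 e5
    rw [e1, Pi.add_apply, e2, e3]
    by_cases hx : x ∈ A <;> simpa [hx]
  all_goals
    change _ ≤ (T.1 (charFun m A hA • v + charFun m Aᶜ hA.compl • w) : X →ₘ[m] ℝ)
    rw [hval, aeeqFun_le_iff]
    filter_upwards [AEEqFun.coeFn_add ((charFun m A hA : X →ₘ[m] ℝ) * k)
      ((charFun m Aᶜ hA.compl : X →ₘ[m] ℝ) * l), coeFn_charFun_mul A hA k,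
      coeFn_charFun_mul Aᶜ hA.compl l] with x e1 e2 e3
    rw [e1, Pi.add_apply, e2, e3]
    by_cases hx : x ∈ A
    · have hx' : l x ≤ k x := hx
      simp [hx, hx']
    · have hx' : k x < l x := not_le.1 hx
      simp [hx, hx'.le]

/-- No upper bound in `L⁰(m)` is known in advance. The uniform `L^q` bound replaces it: by Fatou
monotone sequences of values stay bounded a.e., and the supremum inherits the `L^q` bound. -/
lemma exists_isLUB_dualValues [SigmaFinite m] (hpq : p.HolderConjugate q) (hp' : p ≠ ∞)
    (hN : IsPointwiseSeminorm nrm) (T : dualModule p m nrm) :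
    ∃ g ∈ Lp ℝ q m, IsLUB (dualValues p m nrm T) g := by
  have hq0 : q ≠ 0 := (zero_lt_one.trans_le hpq.symm.one_le).ne'
  obtain ⟨C₀, hC₀⟩ := T.2
  set C := max C₀ 0
  have hC : 0 ≤ C := le_max_right _ _
  have hT : ∀ v : M, normLp 1 (T.1 v : X →ₘ[m] ℝ) ≤ C * normLp p (nrm v) := fun v =>
    (hC₀ v).trans (mul_le_mul_of_nonneg_right (le_max_left _ _) (normLp_nonneg _ _))
  set S := -dualValues p m nrm T
  have hbound : ∀ k ∈ S, eLpNorm k q m ≤ ENNReal.ofReal C := by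
    rintro k ⟨v, hv, hk⟩
    have h1 : k = -(T.1 v : X →ₘ[m] ℝ) := by rw [← hk, neg_neg]
    rw [h1, eLpNorm_congr_ae (AEEqFun.coeFn_neg _), eLpNorm_neg]
    exact eLpNorm_dual_le hpq hp' hN T.1 hC hT hv
  obtain ⟨g, u, hg, hu, -, hlim⟩ := exists_isGLB_of_directedOn_of_ae_bddBelow (S := S)
    ⟨-0, by
      rw [Set.neg_mem_neg]
      exact ⟨0, by rw [hN.map_zero]; exact zero_le_one, by rw [map_zero]; rfl⟩⟩
    (fun a ha b hb => by
      obtain ⟨c, hc, h1, h2⟩ := directedOn_dualValues hN T _ ha _ hb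
      exact ⟨-c, Set.neg_mem_neg.2 hc, neg_le.1 h1, neg_le.1 h2⟩)
    -- At a.e. point `liminf |u n|` is finite, so beyond any `n` there is `j` with `|u j| < K`;
    -- since `u` decreases, `u n ≥ u j > -K`.
    (fun u hu hua => by
      have h1 : ∀ᵐ x ∂m, ∀ n, u (n + 1) x ≤ u n x :=
        ae_all_iff.2 fun n => aeeqFun_le_iff.1 (hua n.le_succ)
      filter_upwards [h1, ae_bdd_liminf_atTop_of_eLpNorm_bdd (R := C.toNNReal) hq0
        (fun n => (u n).measurable) fun n => hbound _ (hu n)] with x h2 h3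
      have hanti := antitone_nat_of_succ_le (f := fun n => u n x) h2
      obtain ⟨K, hK⟩ := ENNReal.lt_iff_exists_nnreal_btwn.1 h3
      have h4 := frequently_lt_of_liminf_lt (by isBoundedDefault) hK.1
      refine ⟨-K, ?_⟩
      rintro _ ⟨n, rfl⟩
      obtain ⟨j, hj, hjK⟩ := (frequently_atTop.1 h4) n
      have h5 : |u j x| < K := by
        rw [Real.enorm_eq_ofReal_abs, ENNReal.ofReal_lt_coe_iff (abs_nonneg _)] at hjK
        exact hjK
      exact (abs_lt.1 h5).1.le.trans (hanti hj))
  refine ⟨-g, (Lp ℝ q m).neg_mem (Lp.mem_Lp_iff_memLp.2 ⟨g.aestronglyMeasurable, ?_⟩), ?_⟩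
  · refine (Lp.eLpNorm_lim_le_liminf_eLpNorm (p := q)
      (fun n => (u n).aestronglyMeasurable) g hlim).trans_lt ?_
    refine lt_of_le_of_lt ((liminf_le_liminf (Eventually.of_forall fun n =>
      hbound _ (hu n))).trans_eq (liminf_const _)) ENNReal.ofReal_lt_top
  · have := hg.neg
    rwa [neg_neg] at this

lemma isLUB_dualNorm_and_mem [SigmaFinite m] (hpq : p.HolderConjugate q) (hp' : p ≠ ∞)
    (hN : IsPointwiseSeminorm nrm) (T : dualModule p m nrm) :
    IsLUB (dualValues p m nrm T) (dualNorm p m nrm T) ∧ dualNorm p m nrm T ∈ Lp ℝ q m := by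
  obtain ⟨g, hgL, hg⟩ := exists_isLUB_dualValues hpq hp' hN T
  have hspec : IsLUB (dualValues p m nrm T) (dualNorm p m nrm T) :=
    Classical.epsilon_spec (p := fun g => IsLUB (dualValues p m nrm T) g) ⟨g, hg⟩
  exact ⟨hspec, hspec.unique hg ▸ hgL⟩

/-- Where `|v|` is bounded away from zero, divide `v` by `|v|` to obtain an element of norm at most
one; where `|v| = 0`, continuity and `L^∞`-linearity force `T(v) = 0`. -/
lemma abs_le_mul_of_isLUB (hN : IsPointwiseSeminorm nrm) (T : dualModule p m nrm)
    {g : X →ₘ[m] ℝ} (hg : IsLUB (dualValues p m nrm T) g) (v : M) :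
    |((T.1 v).1 : X →ₘ[m] ℝ)| ≤ g * nrm v := by
  have hle : ∀ w, nrm w ≤ 1 → |((T.1 w).1 : X →ₘ[m] ℝ)| ≤ g := fun w hw => by
    refine abs_le'.2 ⟨hg.1 ⟨w, hw, rfl⟩, hg.1 ⟨-w, by rwa [hN.map_neg], ?_⟩⟩
    rw [map_neg]; rfl
  obtain ⟨E, hE, k, hcov, hk⟩ := exists_bounded_inverse (nrm v)
  have hpos : ∀ n, ∀ᵐ x ∂m, x ∈ E n → 0 < nrm v x ∧ (k n : X →ₘ[m] ℝ) x = (nrm v x)⁻¹ := by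
    intro n
    have h2 := AEEqFun.coeFn_mul (k n : X →ₘ[m] ℝ) (nrm v)
    rw [hk n] at h2
    filter_upwards [h2, coeFn_charFun (m := m) (E n) (hE n), aeeqFun_nonneg_iff.1 (hN.nonneg v)]
      with x e1 e2 e3 hx
    rw [e2, indicator_of_mem hx, Pi.mul_apply] at e1
    exact ⟨lt_of_le_of_ne e3 fun h0 => by simp [← h0] at e1, eq_inv_of_mul_eq_one_left e1.symm⟩
  have h1 : ∀ n, ∀ᵐ x ∂m, x ∈ E n →
      |((T.1 v).1 : X →ₘ[m] ℝ)| x ≤ g x * nrm v x := by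
    intro n
    -- The bounded inverse satisfies `k n * |v| = 1_{E n}`; the extra indicator confines the element
    -- to `E n`.
    have e0 : nrm ((k n * charFun m (E n) (hE n)) • v) ≤ 1 := by
      have e : |((k n * charFun m (E n) (hE n) : Linfty m) : X →ₘ[m] ℝ)| * nrm v
          = charFun m (E n) (hE n) := by
        rw [Subalgebra.coe_mul, aeeqFun_abs_mul, abs_charFun, mul_comm |(k n : X →ₘ[m] ℝ)|,
          mul_assoc, ← abs_of_nonneg (hN.nonneg v), ← aeeqFun_abs_mul, hk, abs_charFun]
        exact congrArg Subtype.val (charFun_mul_self (m := m) (E n) (hE n))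
      rw [hN.smul, e, aeeqFun_le_iff]
      filter_upwards [coeFn_charFun (m := m) (E n) (hE n), AEEqFun.coeFn_one (β := ℝ) (μ := m)]
        with x e1 e2
      rw [e1, e2]
      exact indicator_apply_le' (fun _ => le_rfl) fun _ => zero_le_one
    have e1 := hle _ e0
    rw [map_smul] at e1
    change |((k n : X →ₘ[m] ℝ) * (charFun m (E n) (hE n) : X →ₘ[m] ℝ)) * (T.1 v).1| ≤ g at e1
    rw [aeeqFun_abs_mul] at e1
    filter_upwards [aeeqFun_le_iff.1 e1, AEEqFun.coeFn_mul
      |(k n : X →ₘ[m] ℝ) * (charFun m (E n) (hE n) : X →ₘ[m] ℝ)| |(T.1 v).1|,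
      AEEqFun.coeFn_abs ((k n : X →ₘ[m] ℝ) * (charFun m (E n) (hE n) : X →ₘ[m] ℝ)),
      AEEqFun.coeFn_mul (k n : X →ₘ[m] ℝ) (charFun m (E n) (hE n) : X →ₘ[m] ℝ),
      coeFn_charFun (m := m) (E n) (hE n), hpos n] with x a1 a2 a3 a4 a5 a6 hx
    obtain ⟨a7, a8⟩ := a6 hx
    rw [a2, Pi.mul_apply, a3, a4, Pi.mul_apply, a5, indicator_of_mem hx, mul_one, a8,
      abs_of_pos (inv_pos.2 a7), ← div_eq_inv_mul, div_le_iff₀ a7] at a1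
    exact a1
  have h2 : ∀ᵐ x ∂m, nrm v x = 0 → |((T.1 v).1 : X →ₘ[m] ℝ)| x = 0 := by
    set Z : Set X := {x | nrm v x = 0}
    have hZ : MeasurableSet Z := (nrm v).measurable (measurableSet_singleton 0)
    have e0 : nrm (charFun m Z hZ • v) = 0 := by
      rw [hN.charFun_smul]
      refine AEEqFun.ext ?_
      filter_upwards [coeFn_charFun_mul Z hZ (nrm v), AEEqFun.coeFn_zero (β := ℝ) (μ := m)]
        with x e1 e2
      rw [e1, e2]
      by_cases hx : x ∈ Z
      · rw [indicator_of_mem hx]; exact hx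
      · rw [indicator_of_notMem hx]; rfl
    obtain ⟨C, hC⟩ := T.2
    have e1 := hC (charFun m Z hZ • v)
    rw [e0, normLp_zero, mul_zero] at e1
    have e2 := normLp_eq_zero one_ne_zero (T.1 (charFun m Z hZ • v)).2
      (le_antisymm e1 (normLp_nonneg _ _))
    rw [map_smul] at e2
    change (charFun m Z hZ : X →ₘ[m] ℝ) * (T.1 v).1 = 0 at e2
    have e3 := coeFn_charFun_mul Z hZ (T.1 v).1
    rw [e2] at e3
    filter_upwards [e3, AEEqFun.coeFn_zero (β := ℝ) (μ := m), AEEqFun.coeFn_abs (T.1 v).1]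
      with x a1 a2 a3 hx
    have hx' : x ∈ Z := hx
    rw [a2, indicator_of_mem hx'] at a1
    rw [a3, ← a1]
    exact abs_zero
  rw [aeeqFun_le_iff]
  filter_upwards [ae_all_iff.2 h1, h2, AEEqFun.coeFn_mul g (nrm v)] with x a1 a2 a3
  rw [a3, Pi.mul_apply]
  by_cases hx : nrm v x = 0
  · rw [a2 hx, hx, mul_zero]
  · obtain ⟨n, hn⟩ := hcov x hx
    exact a1 n hn

lemma mem_upperBounds_dualValues (T : dualModule p m nrm) {g : X →ₘ[m] ℝ} (hg : 0 ≤ g)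
    (h : ∀ v, |((T.1 v).1 : X →ₘ[m] ℝ)| ≤ g * nrm v) :
    g ∈ upperBounds (dualValues p m nrm T) := by
  rintro _ ⟨v, hv, rfl⟩
  calc (T.1 v).1 ≤ g * nrm v := (le_abs_self _).trans (h v)
    _ ≤ g * 1 := mul_le_mul_of_nonneg_left hv hg
    _ = g := mul_one g

lemma nonneg_of_isLUB_dualValues (hN : IsPointwiseSeminorm nrm) (T : dualModule p m nrm)
    {g : X →ₘ[m] ℝ} (hg : IsLUB (dualValues p m nrm T) g) : 0 ≤ g :=
  hg.1 ⟨0, by rw [hN.map_zero]; exact zero_le_one, by rw [map_zero]; rfl⟩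

end Dual

/-! ### Locality and extension of derivations to Dirichlet functions -/

section Extension

variable {X : Type*} [MetricSpace X] [MeasurableSpace X] [BorelSpace X]
variable {p q : ℝ≥0∞} [Fact (1 ≤ p)] [Fact (p ≠ ∞)] {m : Measure X} [SigmaFinite m]

/-- Locality of the minimal weak upper gradient. -/
lemma minGrad_eq_of_eq (f f' : dirichletSpace p m) :
    ∀ᵐ x ∂m, (f : X →ₘ[m] ℝ) x = (f' : X →ₘ[m] ℝ) x →
      (minGrad p m f : X →ₘ[m] ℝ) x = (minGrad p m f' : X →ₘ[m] ℝ) x := by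
  have key : ∀ a b : dirichletSpace p m, ∀ᵐ x ∂m, (a : X →ₘ[m] ℝ) x = (b : X →ₘ[m] ℝ) x →
      (minGrad p m a : X →ₘ[m] ℝ) x ≤ (minGrad p m b : X →ₘ[m] ℝ) x := fun a b => by
    have h1 := minGrad_add_le (a - b) b
    rw [sub_add_cancel] at h1
    filter_upwards [aeeqFun_le_iff.1 h1, minGrad_eq_zero_of_eq_zero (a - b),
      AEEqFun.coeFn_sub (a : X →ₘ[m] ℝ) (b : X →ₘ[m] ℝ),
      AEEqFun.coeFn_add (minGrad p m ((a - b : dirichletSpace p m) : X →ₘ[m] ℝ) : X →ₘ[m] ℝ)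
        (minGrad p m b)] with x e1 e2 e3 e4 hx
    have e5 : ((a - b : dirichletSpace p m) : X →ₘ[m] ℝ) x = 0 := by
      refine e3.trans ?_
      rw [Pi.sub_apply, hx, sub_self]
    rw [e4, Pi.add_apply, e2 e5, zero_add] at e1
    exact e1
  filter_upwards [key f f', key f' f] with x e1 e2 hx
  exact le_antisymm (e1 hx) (e2 hx.symm)

/-- Locality of derivations. -/
lemma derivation_eq_of_eq (δ : SobolevDerivation p q m) (f f' : sobolevSpace p m) :
    ∀ᵐ x ∂m, (f : X →ₘ[m] ℝ) x = (f' : X →ₘ[m] ℝ) x → (δ.1 f).1 x = (δ.1 f').1 x := by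
  have h1 := abs_apply_le_derivationNorm δ (f - f')
  rw [map_sub] at h1
  change |(δ.1 f).1 - (δ.1 f').1| ≤ _ at h1
  filter_upwards [aeeqFun_le_iff.1 h1, AEEqFun.coeFn_abs ((δ.1 f).1 - (δ.1 f').1),
    AEEqFun.coeFn_sub (δ.1 f).1 (δ.1 f').1,
    AEEqFun.coeFn_mul (derivationNorm p q m δ)
      (minGrad p m ((f - f' : sobolevSpace p m) : X →ₘ[m] ℝ)),
    minGrad_eq_zero_of_eq_zero (⟨(f - f' : sobolevSpace p m), (f - f').2.1⟩ : dirichletSpace p m),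
    AEEqFun.coeFn_sub (f : X →ₘ[m] ℝ) (f' : X →ₘ[m] ℝ)] with x e1 e2 e3 e4 e5 e6 hx
  have e7 : ((f - f' : sobolevSpace p m) : X →ₘ[m] ℝ) x = 0 := by
    refine e6.trans ?_
    rw [Pi.sub_apply, hx, sub_self]
  rw [e2, e3, Pi.sub_apply, e4, Pi.mul_apply, e5 e7, mul_zero] at e1
  exact sub_eq_zero.1 (abs_nonpos_iff.1 e1)

/-- The values `δ(u n)` at the truncations are glued along the sets `{u n = f}`, made disjoint. By
locality the outcome agrees with `δ h` on `{f = h}` for every Sobolev `h`, so it does not depend on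
the truncations and can be compared with any other choice. -/
lemma exists_local_extension
    (hm : ∀ B : Set X, Bornology.IsBounded B → MeasurableSet B → m B < ∞)
    (δ : SobolevDerivation p q m) (f : dirichletSpace p m) :
    ∃ k : X →ₘ[m] ℝ, ∀ h : sobolevSpace p m,
      ∀ᵐ x ∂m, (f : X →ₘ[m] ℝ) x = (h : X →ₘ[m] ℝ) x → k x = (δ.1 h).1 x := by
  obtain ⟨u, hu⟩ := exists_sobolev_truncation hm f
  let A : ℕ → Set X := fun n => {x | (u n : X →ₘ[m] ℝ) x = (f : X →ₘ[m] ℝ) x}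
  have hA : ∀ n, MeasurableSet (A n) := fun n =>
    measurableSet_eq_fun (u n : X →ₘ[m] ℝ).measurable (f : X →ₘ[m] ℝ).measurable
  obtain ⟨k, hk⟩ := exists_glue (m := m) (disjointed A) (MeasurableSet.disjointed hA)
    (fun n => (δ.1 (u n)).1) (disjoint_disjointed A)
  refine ⟨k, fun h => ?_⟩
  filter_upwards [hu, hk, ae_all_iff.2 fun n => derivation_eq_of_eq δ (u n) h] with x e1 e2 e3 hx
  obtain ⟨N, hN⟩ := e1.exists
  have hxA : x ∈ ⋃ n, disjointed A n := by
    rw [iUnion_disjointed]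
    exact mem_iUnion.2 ⟨N, hN⟩
  obtain ⟨n, hn⟩ := mem_iUnion.1 hxA
  have hn' : (u n : X →ₘ[m] ℝ) x = (f : X →ₘ[m] ℝ) x := disjointed_subset A n hn
  rw [e2 n hn, e3 n (hn'.trans hx)]

/-- Derivations extend from the Sobolev space to the Dirichlet space. -/
lemma exists_dirichlet_extension (hpq : p.HolderConjugate q)
    (hm : ∀ B : Set X, Bornology.IsBounded B → MeasurableSet B → m B < ∞)
    (δ : SobolevDerivation p q m) :
    ∃ D : dirichletSpace p m →ₗ[ℝ] LpModule 1 m,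
      (∀ f : sobolevSpace p m, D ⟨f.1, f.2.1⟩ = δ.1 f) ∧
      ∀ f, |((D f).1 : X →ₘ[m] ℝ)| ≤ derivationNorm p q m δ * (minGrad p m f : X →ₘ[m] ℝ) := by
  choose k hk using exists_local_extension hm δ
  -- At a point where `u n = f`, both `k f` and `|Df|` coincide with the corresponding quantities of
  -- the Sobolev function `u n`.
  have hle : ∀ f, |k f| ≤ derivationNorm p q m δ * (minGrad p m f : X →ₘ[m] ℝ) := fun f => by
    obtain ⟨u, hu⟩ := exists_sobolev_truncation hm f
    have h1 := ae_all_iff.2 fun n => aeeqFun_le_iff.1 (abs_apply_le_derivationNorm δ (u n))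
    have h2 := ae_all_iff.2 fun n => AEEqFun.coeFn_abs (δ.1 (u n)).1
    have h3 := ae_all_iff.2 fun n =>
      AEEqFun.coeFn_mul (derivationNorm p q m δ) (minGrad p m (u n) : X →ₘ[m] ℝ)
    rw [aeeqFun_le_iff]
    filter_upwards [hu, h1, h2, h3, ae_all_iff.2 fun n => hk f (u n), AEEqFun.coeFn_abs (k f),
      AEEqFun.coeFn_mul (derivationNorm p q m δ) (minGrad p m f : X →ₘ[m] ℝ),
      ae_all_iff.2 fun n => minGrad_eq_of_eq f ⟨(u n).1, (u n).2.1⟩]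
      with x e1 e2 e3 e4 e5 e6 e7 e8
    obtain ⟨n, hn⟩ := e1.exists
    rw [e6, e7, Pi.mul_apply, e5 n hn.symm, e8 n hn.symm, ← e3 n]
    exact (e2 n).trans_eq (e4 n)
  have hkL : ∀ f, k f ∈ Lp ℝ 1 m := fun f =>
    mem_Lp_of_abs_le (mul_mem_L1 hpq (derivationNorm_mem_Lp δ) (minGrad p m (f : X →ₘ[m] ℝ)).2)
      ((hle f).trans (le_abs_self _))
  refine ⟨
    { toFun := fun f => ⟨k f, hkL f⟩
      map_add' := fun f f' => Subtype.ext (AEEqFun.ext ?_)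
      map_smul' := fun c f => Subtype.ext (AEEqFun.ext ?_) }, fun f => ?_, hle⟩
  -- At a.e. point a single `n` satisfies `u n = f` and `u' n = f'`, hence also `u n + u' n = f +
  -- f'`, and additivity of `δ` on Sobolev functions applies.
  · obtain ⟨u, hu⟩ := exists_sobolev_truncation hm f
    obtain ⟨u', hu'⟩ := exists_sobolev_truncation hm f'
    filter_upwards [hu, hu', ae_all_iff.2 fun n => hk f (u n), ae_all_iff.2 fun n => hk f' (u' n),
      ae_all_iff.2 fun n => hk (f + f') (u n + u' n), AEEqFun.coeFn_add (k f) (k f'),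
      AEEqFun.coeFn_add (f : X →ₘ[m] ℝ) (f' : X →ₘ[m] ℝ),
      ae_all_iff.2 fun n => AEEqFun.coeFn_add (u n : X →ₘ[m] ℝ) (u' n : X →ₘ[m] ℝ),
      ae_all_iff.2 fun n => AEEqFun.coeFn_add (δ.1 (u n)).1 (δ.1 (u' n)).1]
      with x e1 e2 e3 e4 e5 e6 e7 e8 e9
    obtain ⟨n, hn, hn'⟩ := (e1.and e2).exists
    refine Eq.trans ?_ e6.symm
    rw [Pi.add_apply, e3 n hn.symm, e4 n hn'.symm]
    refine (e5 n ?_).trans ?_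
    · refine e7.trans (Eq.trans ?_ (e8 n).symm)
      rw [Pi.add_apply, Pi.add_apply, hn, hn']
    · rw [map_add]
      exact e9 n
  · obtain ⟨u, hu⟩ := exists_sobolev_truncation hm f
    filter_upwards [hu, ae_all_iff.2 fun n => hk f (u n),
      ae_all_iff.2 fun n => hk (c • f) (c • u n), AEEqFun.coeFn_smul c (k f),
      AEEqFun.coeFn_smul c (f : X →ₘ[m] ℝ),
      ae_all_iff.2 fun n => AEEqFun.coeFn_smul c (u n : X →ₘ[m] ℝ),
      ae_all_iff.2 fun n => AEEqFun.coeFn_smul c (δ.1 (u n)).1]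
      with x e1 e3 e5 e6 e7 e8 e9
    obtain ⟨n, hn⟩ := e1.exists
    refine Eq.trans ?_ e6.symm
    rw [Pi.smul_apply, e3 n hn.symm]
    refine (e5 n ?_).trans ?_
    · refine e7.trans (Eq.trans ?_ (e8 n).symm)
      rw [Pi.smul_apply, Pi.smul_apply, hn]
    · rw [map_smul]
      exact e9 n
  · refine Subtype.ext (AEEqFun.ext ?_)
    filter_upwards [hk ⟨f.1, f.2.1⟩ f] with x hx
    exact hx rfl

end Extension

/-! ### Factorisation through the differential -/

section Lift

variable {X : Type*} [MetricSpace X] [MeasurableSpace X]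
variable {p q : ℝ≥0∞} [Fact (1 ≤ p)] [Fact (p ≠ ∞)] {m : Measure X}

/-- The `L^∞(m)`-linear map `g df ↦ g D(f)` on formal forms. -/
def formalLift (D : dirichletSpace p m →ₗ[ℝ] LpModule 1 m) :
    FormalForm p m →ₗ[Linfty m] LpModule 1 m :=
  LinearMap.liftBaseChange (Linfty m) D

lemma formalLift_of (D : dirichletSpace p m →ₗ[ℝ] LpModule 1 m) (h : Linfty m)
    (f : dirichletSpace p m) : formalLift D (FormalForm.of p m h f) = h • D f :=
  LinearMap.liftBaseChange_tmul _ _ _ _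

lemma abs_formalLift_listForm_le {D : dirichletSpace p m →ₗ[ℝ] LpModule 1 m} {g : X →ₘ[m] ℝ}
    (hD : ∀ f, |((D f).1 : X →ₘ[m] ℝ)| ≤ g * (minGrad p m f : X →ₘ[m] ℝ))
    (l : List (Linfty m × dirichletSpace p m)) :
    |((formalLift D (listForm p m l)).1 : X →ₘ[m] ℝ)| ≤ g * listBound p m l := by
  induction l with
  | nil =>
    have h1 : listBound p m [] = 0 := rfl
    have h2 : listForm p m [] = 0 := rfl
    rw [h1, h2, mul_zero, map_zero]
    exact (abs_zero (α := X →ₘ[m] ℝ)).le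
  | cons a l ih =>
    have h1 : listBound p m (a :: l) = |(a.1 : X →ₘ[m] ℝ)| * (minGrad p m a.2 : X →ₘ[m] ℝ)
      + listBound p m l := rfl
    have h2 : listForm p m (a :: l) = FormalForm.of p m a.1 a.2 + listForm p m l := by
      simp [listForm]
    rw [h1, h2, map_add, formalLift_of]
    refine (abs_add_le ((a.1 : X →ₘ[m] ℝ) * (D a.2).1) (formalLift D (listForm p m l)).1).trans ?_
    rw [mul_add]
    refine add_le_add ?_ ih
    rw [aeeqFun_abs_mul, mul_left_comm]
    exact mul_le_mul_of_nonneg_left (hD a.2) (abs_nonneg _)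

variable [BorelSpace X] [SigmaFinite m]

/-- The left-hand side depends only on the form, not on its representation, so the bounds for the
individual representations can be replaced by their infimum. -/
lemma abs_formalLift_le {D : dirichletSpace p m →ₗ[ℝ] LpModule 1 m} {g : X →ₘ[m] ℝ}
    (hD : ∀ f, |((D f).1 : X →ₘ[m] ℝ)| ≤ g * (minGrad p m f : X →ₘ[m] ℝ)) (t : FormalForm p m) :
    |((formalLift D t).1 : X →ₘ[m] ℝ)| ≤ g * formalNorm t := by
  obtain ⟨u, hu, -, hlim⟩ := exists_seq_formalNorm t
  have h1 : ∀ᵐ x ∂m, ∀ n, |((formalLift D t).1 : X →ₘ[m] ℝ)| x ≤ g x * u n x := by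
    refine ae_all_iff.2 fun n => ?_
    obtain ⟨l, hl, hl'⟩ := hu n
    have h2 := abs_formalLift_listForm_le hD l
    rw [hl, ← hl'] at h2
    filter_upwards [aeeqFun_le_iff.1 h2, AEEqFun.coeFn_mul g (u n)] with x e1 e2
    rwa [e2] at e1
  rw [aeeqFun_le_iff]
  filter_upwards [h1, hlim, AEEqFun.coeFn_mul g (formalNorm t)] with x e1 e2 e3
  rw [e3]
  exact ge_of_tendsto (e2.const_mul _) (Eventually.of_forall e1)

/-- Linear maps on the Dirichlet space dominated by `g |Df|`, `g ∈ L^q(m)`, factor through the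
differential. -/
lemma exists_lift (hpq : p.HolderConjugate q) (D : dirichletSpace p m →ₗ[ℝ] LpModule 1 m)
    {g : X →ₘ[m] ℝ} (hg : g ∈ Lp ℝ q m)
    (hD : ∀ f, |((D f).1 : X →ₘ[m] ℝ)| ≤ g * (minGrad p m f : X →ₘ[m] ℝ)) :
    ∃ T : CotangentModule p m →ₗ[Linfty m] LpModule 1 m,
      (∀ f, T (differential p m f) = D f) ∧
      ∀ ω, |((T ω).1 : X →ₘ[m] ℝ)| ≤ g * cotangentNorm p m ω := by
  let G : Lp ℝ q m := ⟨g, hg⟩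
  let F : FormalForm p m → Lp ℝ 1 m := fun t => ⟨(formalLift D t).1, (formalLift D t).2⟩
  have hF : LipschitzWith (normLp q g).toNNReal F := by
    refine LipschitzWith.of_dist_le_mul fun s t => ?_
    rw [dist_eq_norm, dist_eq_norm, Real.coe_toNNReal _ (normLp_nonneg _ _),
      ← norm_formalNormLp (s - t)]
    have h1 : ((F s - F t : Lp ℝ 1 m) : X →ₘ[m] ℝ) = (formalLift D (s - t)).1 := by
      rw [map_sub]; rfl
    refine le_trans ?_ (normLp_mul_le_mul hpq hg (formalNorm_mem_Lp (s - t)))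
    change normLp 1 ((F s - F t : Lp ℝ 1 m) : X →ₘ[m] ℝ) ≤ _
    rw [h1]
    exact normLp_mono (mul_mem_L1 hpq hg (formalNorm_mem_Lp (s - t)))
      ((abs_formalLift_le hD (s - t)).trans (le_abs_self _))
  let Φ : CotangentModule p m → Lp ℝ 1 m := UniformSpace.Completion.extension F
  have hΦc : Continuous Φ := UniformSpace.Completion.continuous_extension
  have hΦ : ∀ t : FormalForm p m, Φ (t : CotangentModule p m) = F t :=
    UniformSpace.Completion.extension_coe hF.uniformContinuous
  have hadd : ∀ ω η, Φ (ω + η) = Φ ω + Φ η := fun ω η => by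
    induction ω, η using UniformSpace.Completion.induction_on₂ with
    | hp =>
      exact isClosed_eq (hΦc.comp continuous_add)
        ((hΦc.comp continuous_fst).add (hΦc.comp continuous_snd))
    | ih s t =>
      rw [← UniformSpace.Completion.coe_add, hΦ, hΦ, hΦ]
      exact Subtype.ext (congrArg Subtype.val ((formalLift D).map_add s t))
  have hsmul : ∀ (h : Linfty m) ω, Φ (h • ω) = mulLp 1 h (Φ ω) := fun h ω => by
    induction ω using UniformSpace.Completion.induction_on with
    | hp =>
      exact isClosed_eq (hΦc.comp (continuous_const_smul h))
        ((ContinuousLinearMap.continuous _).comp hΦc)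
    | ih t =>
      rw [← UniformSpace.Completion.coe_smul, hΦ, hΦ]
      exact Subtype.ext (congrArg Subtype.val ((formalLift D).map_smul h t))
  refine ⟨
    { toFun := fun ω => ⟨(Φ ω : X →ₘ[m] ℝ), (Φ ω).2⟩
      map_add' := fun ω η => Subtype.ext (congrArg Subtype.val (hadd ω η))
      map_smul' := fun h ω => Subtype.ext (congrArg Subtype.val (hsmul h ω)) },
    fun f => ?_, fun ω => ?_⟩
  · refine Subtype.ext ((congrArg Subtype.val (hΦ _)).trans ?_)
    refine (congrArg Subtype.val (formalLift_of D 1 f)).trans ?_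
    rw [one_smul]
  · change |(Φ ω : X →ₘ[m] ℝ)| ≤ _
    rw [cotangentNorm_eq]
    have hq1 : Fact (1 ≤ q) := ⟨hpq.symm.one_le⟩
    -- Written with the lattice operations of `L¹` and with multiplication by `G` as a continuous
    -- map `L^p → L¹`, the pointwise bound is a closed condition on `ω` and need only be checked on
    -- formal forms.
    have h : Φ ω ⊔ -Φ ω ≤ mulL1 hpq.symm G (cotangentNormLp ω) := by
      induction ω using UniformSpace.Completion.induction_on with
      | hp =>
        exact isClosed_le (hΦc.sup hΦc.neg)
          ((ContinuousLinearMap.continuous _).comp continuous_cotangentNormLp)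
      | ih t =>
        rw [hΦ, cotangentNormLp_coe]
        have h1 := abs_formalLift_le hD t
        rw [mul_comm] at h1
        exact h1
    have h' : |(Φ ω : X →ₘ[m] ℝ)| ≤ (cotangentNormLp ω : X →ₘ[m] ℝ) * g := h
    rwa [mul_comm] at h'

end Lift

/-! ### Transport of the Banach module structure along an isomorphism -/

section Transport

variable {X : Type*} [MeasurableSpace X] {m : Measure X} {q : ℝ≥0∞}

/-- Gives the tangent module its completeness and glueing, which are thus proved only once, for
derivations. -/
lemma IsLpBanachModule.of_bijective {M N : Type*} [AddCommGroup M] [Module (Linfty m) M]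
    [AddCommGroup N] [Module (Linfty m) N] {nM : M → (X →ₘ[m] ℝ)} {nN : N → (X →ₘ[m] ℝ)}
    (h : IsLpBanachModule q m M nM) (I : M →ₗ[Linfty m] N) (hI : Function.Bijective I)
    (hn : ∀ v, nN (I v) = nM v) : IsLpBanachModule q m N nN := by
  constructor
  · intro w
    obtain ⟨v, rfl⟩ := hI.2 w
    rw [hn]; exact h.mem_Lp v
  · intro w
    obtain ⟨v, rfl⟩ := hI.2 w
    rw [hn]; exact h.nonneg v
  · intro w hw
    obtain ⟨v, rfl⟩ := hI.2 w
    rw [hn]; exact h.ne_zero v fun h0 => hw (by rw [h0, map_zero])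
  · intro w w'
    obtain ⟨v, rfl⟩ := hI.2 w
    obtain ⟨v', rfl⟩ := hI.2 w'
    rw [← map_add, hn, hn, hn]; exact h.triangle v v'
  · intro f w
    obtain ⟨v, rfl⟩ := hI.2 w
    rw [← map_smul, hn, hn]; exact h.smul f v
  · intro u hu
    choose v hv using fun n => hI.2 (u n)
    obtain ⟨w, hw⟩ := h.complete v fun ε hε => by
      obtain ⟨N, hN⟩ := hu ε hε
      refine ⟨N, fun i hi j hj => ?_⟩
      have := hN i hi j hj
      rwa [← hv, ← hv, ← map_sub, hn] at this
    refine ⟨I w, ?_⟩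
    simp only [← hv, ← map_sub, hn]
    exact hw
  · intro E hE u hd hu hmem
    choose v hv using fun n => hI.2 (u n)
    obtain ⟨w, hw⟩ := h.glueing E hE v hd hu (by
      simpa only [← hv, ← map_smul, hn] using hmem)
    refine ⟨I w, fun n => ?_⟩
    rw [← hv, ← map_smul, ← map_smul, hw]

end Transport

/-! ### The isomorphism between derivations and tangent fields -/

section Isomorphism

variable {X : Type*} [MetricSpace X] [MeasurableSpace X] [BorelSpace X]
variable {p q : ℝ≥0∞} [Fact (1 ≤ p)] [Fact (p ≠ ∞)] {m : Measure X} [SigmaFinite m]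

lemma cotangentNorm_sobolevDifferential (f : sobolevSpace p m) :
    cotangentNorm p m (sobolevDifferential p m f) = (minGrad p m f : X →ₘ[m] ℝ) :=
  cotangentNorm_differential _

/-- Formal forms are `L^∞`-combinations of differentials and are dense, and `v` is `L^∞`-linear and
continuous. -/
lemma tangent_eq_zero_of_differential (v : TangentModule p m)
    (h : ∀ f, v.1 (differential p m f) = 0) : v = 0 := by
  obtain ⟨C, hC⟩ := v.2
  let Φ : CotangentModule p m →+ Lp ℝ 1 m :=
    { toFun := fun ω => ⟨(v.1 ω).1, (v.1 ω).2⟩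
      map_zero' := Subtype.ext (congrArg Subtype.val v.1.map_zero)
      map_add' := fun ω η => Subtype.ext (congrArg Subtype.val (v.1.map_add ω η)) }
  have hΦ : Continuous Φ := AddMonoidHomClass.continuous_of_bound Φ C fun ω => by
    rw [← normLp_cotangentNorm]
    exact hC ω
  have hzero : ∀ ω, Φ ω = 0 := fun ω => by
    induction ω using UniformSpace.Completion.induction_on with
    | hp => exact isClosed_eq hΦ continuous_const
    | ih t =>
      obtain ⟨l, rfl⟩ := exists_listForm p m t
      induction l with
      | nil => exact Φ.map_zero
      | cons a l ih =>
        have h1 : listForm p m (a :: l) = a.1 • FormalForm.of p m 1 a.2 + listForm p m l := by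
          have h2 : a.1 • FormalForm.of p m 1 a.2 = FormalForm.of p m a.1 a.2 := by
            change (a.1 * 1) ⊗ₜ[ℝ] a.2 = a.1 ⊗ₜ[ℝ] a.2
            rw [mul_one]
          rw [h2]
          simp [listForm]
        rw [h1, UniformSpace.Completion.coe_add, map_add, ih, add_zero,
          UniformSpace.Completion.coe_smul]
        have h3 := v.1.map_smul a.1 (differential p m a.2)
        rw [h, smul_zero] at h3
        exact Subtype.ext (congrArg Subtype.val h3)
  refine Subtype.ext (LinearMap.ext fun ω => Subtype.ext ?_)
  exact congrArg Subtype.val (hzero ω)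

/-- Tangent fields are determined by their values on the differentials of Sobolev functions. -/
lemma tangent_eq_zero_of_sobolevDifferential
    (hm : ∀ B : Set X, Bornology.IsBounded B → MeasurableSet B → m B < ∞) (v : TangentModule p m)
    (h : ∀ f, v.1 (sobolevDifferential p m f) = 0) : v = 0 := by
  refine tangent_eq_zero_of_differential v fun f => ?_
  obtain ⟨u, hu⟩ := exists_sobolev_truncation hm f
  let w : ℕ → dirichletSpace p m := fun n => ⟨(u n).1, (u n).2.1⟩
  let A : ℕ → Set X := fun n => {x | (u n : X →ₘ[m] ℝ) x = (f : X →ₘ[m] ℝ) x}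
  have hA : ∀ n, MeasurableSet (A n) := fun n =>
    measurableSet_eq_fun (u n : X →ₘ[m] ℝ).measurable (f : X →ₘ[m] ℝ).measurable
  -- On `A n` the function `f - w n` vanishes, hence so does `|d(f - w n)|`. The sets `A n` cover
  -- a.e. point, so the values on Sobolev differentials determine `v(df)`.
  have h1 : ∀ n, charFun m (A n) (hA n) • differential p m f
      = charFun m (A n) (hA n) • differential p m (w n) := fun n => by
    rw [← sub_eq_zero, ← smul_sub, ← map_sub, ← norm_eq_zero, ← normLp_cotangentNorm,
      isPointwiseSeminorm_cotangentNorm.charFun_smul, cotangentNorm_differential]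
    rw [← normLp_zero (m := m) p]
    congr 1
    refine AEEqFun.ext ?_
    filter_upwards [coeFn_charFun_mul (A n) (hA n)
      (minGrad p m ((f - w n : dirichletSpace p m) : X →ₘ[m] ℝ) : X →ₘ[m] ℝ),
      minGrad_eq_zero_of_eq_zero (f - w n), AEEqFun.coeFn_zero (β := ℝ) (μ := m),
      AEEqFun.coeFn_sub (f : X →ₘ[m] ℝ) (w n : X →ₘ[m] ℝ)] with x e1 e2 e3 e4
    rw [e1, e3]
    by_cases hx : x ∈ A n
    · rw [indicator_of_mem hx]
      have hx' : (u n : X →ₘ[m] ℝ) x = (f : X →ₘ[m] ℝ) x := hx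
      refine e2 (e4.trans ?_)
      rw [Pi.sub_apply]
      exact sub_eq_zero.2 hx'.symm
    · rw [indicator_of_notMem hx]; rfl
  have h2 : ∀ n, (charFun m (A n) (hA n) : X →ₘ[m] ℝ) * (v.1 (differential p m f)).1 = 0 := by
    intro n
    have h3 := v.1.map_smul (charFun m (A n) (hA n)) (differential p m f)
    rw [h1 n, map_smul] at h3
    have h4 : v.1 (differential p m (w n)) = 0 := h (u n)
    rw [h4, smul_zero] at h3
    exact (congrArg Subtype.val h3).symm
  refine Subtype.ext (AEEqFun.ext ?_)
  filter_upwards [hu, AEEqFun.coeFn_zero (β := ℝ) (μ := m), ae_all_iff.2 fun n =>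
    (coeFn_charFun_mul (A n) (hA n) (v.1 (differential p m f)).1).symm.trans
      (Filter.EventuallyEq.of_eq (congrArg _ (h2 n)))] with x e1 e2 e3
  obtain ⟨n, hn⟩ := e1.exists
  have e4 := e3 n
  rw [indicator_of_mem (show x ∈ A n from hn)] at e4
  exact e4

lemma tangent_ext (hm : ∀ B : Set X, Bornology.IsBounded B → MeasurableSet B → m B < ∞)
    {v w : TangentModule p m}
    (h : ∀ f, v.1 (sobolevDifferential p m f) = w.1 (sobolevDifferential p m f)) : v = w :=
  sub_eq_zero.1 (tangent_eq_zero_of_sobolevDifferential hm (v - w) fun f => sub_eq_zero.2 (h f))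

/-- The restriction of a tangent field to the differentials of Sobolev functions. -/
def restrictTangent (v : TangentModule p m) : sobolevSpace p m →ₗ[ℝ] LpModule 1 m where
  toFun f := v.1 (sobolevDifferential p m f)
  map_add' f g := by
    rw [← map_add]
    exact congrArg v.1 ((differential p m).map_add ⟨f.1, f.2.1⟩ ⟨g.1, g.2.1⟩)
  map_smul' c f := by
    rw [RingHom.id_apply, ← LinearMap.map_smul_of_tower]
    exact congrArg v.1 ((differential p m).map_smul c ⟨f.1, f.2.1⟩)

lemma mem_derivationBounds_restrictTangent (hpq : p.HolderConjugate q) (v : TangentModule p m) :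
    tangentNorm p m v ∈ derivationBounds p q m (restrictTangent v) := by
  have hN := isPointwiseSeminorm_cotangentNorm (p := p) (m := m)
  obtain ⟨h1, h2⟩ := isLUB_dualNorm_and_mem hpq Fact.out hN v
  refine ⟨h2, nonneg_of_isLUB_dualValues hN v h1, fun f => ?_⟩
  have h3 := abs_le_mul_of_isLUB hN v h1 (sobolevDifferential p m f)
  rw [cotangentNorm_sobolevDifferential] at h3
  exact h3

lemma exists_tangent (hpq : p.HolderConjugate q)
    (hm : ∀ B : Set X, Bornology.IsBounded B → MeasurableSet B → m B < ∞)
    (δ : SobolevDerivation p q m) :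
    ∃ v : TangentModule p m, (∀ f, v.1 (sobolevDifferential p m f) = δ.1 f) ∧
      ∀ ω, |((v.1 ω).1 : X →ₘ[m] ℝ)| ≤ derivationNorm p q m δ * cotangentNorm p m ω := by
  obtain ⟨D, hD, hD'⟩ := exists_dirichlet_extension hpq hm δ
  obtain ⟨T, hT, hT'⟩ := exists_lift hpq D (derivationNorm_mem_Lp δ) hD'
  refine ⟨⟨T, normLp q (derivationNorm p q m δ), fun ω => ?_⟩, fun f => ?_, hT'⟩
  · exact (normLp_mono (mul_mem_L1 hpq (derivationNorm_mem_Lp δ) (cotangentNorm_mem_Lp ω))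
      ((hT' ω).trans (le_abs_self _))).trans
      (normLp_mul_le_mul hpq (derivationNorm_mem_Lp δ) (cotangentNorm_mem_Lp ω))
  · exact (hT _).trans (hD f)

lemma exists_isomorphism (hpq : p.HolderConjugate q)
    (hm : ∀ B : Set X, Bornology.IsBounded B → MeasurableSet B → m B < ∞) :
    ∃ I : SobolevDerivation p q m →ₗ[Linfty m] TangentModule p m,
      (∀ (δ : SobolevDerivation p q m) (f : sobolevSpace p m),
        (I δ).1 (sobolevDifferential p m f) = δ.1 f) ∧
      Function.Bijective I ∧
      ∀ δ : SobolevDerivation p q m, tangentNorm p m (I δ) = derivationNorm p q m δ := by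
  have hN := isPointwiseSeminorm_cotangentNorm (p := p) (m := m)
  choose I hI hI' using exists_tangent (p := p) (q := q) (m := m) hpq hm
  refine ⟨
    { toFun := I
      map_add' := fun δ ε => tangent_ext hm fun f => ?_
      map_smul' := fun h δ => tangent_ext hm fun f => ?_ }, hI, ⟨fun δ ε h => ?_, fun v => ?_⟩,
    fun δ => ?_⟩
  -- Linearity is a consequence of uniqueness: both sides have the same values on Sobolev
  -- differentials.
  · refine (hI (δ + ε) f).trans ?_
    exact (congrArg₂ (· + ·) (hI δ f) (hI ε f)).symm
  · refine (hI (h • δ) f).trans ?_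
    exact (congrArg (h • ·) (hI δ f)).symm
  · refine Subtype.ext (LinearMap.ext fun f => ?_)
    have h' : I δ = I ε := h
    rw [← hI δ f, ← hI ε f, h']
  · exact ⟨⟨restrictTangent v, _, mem_derivationBounds_restrictTangent hpq v⟩,
      tangent_ext hm fun f => hI _ f⟩
  · change tangentNorm p m (I δ) = _
    obtain ⟨h1, -⟩ := isLUB_dualNorm_and_mem hpq Fact.out hN (I δ)
    -- `|δ|` bounds all values of `I δ` on forms of norm at most one, and conversely `|I δ|` is
    -- admissible for `δ`, which is the restriction of `I δ` to Sobolev differentials.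
    refine le_antisymm
      (h1.2 (mem_upperBounds_dualValues (I δ) (derivationNorm_nonneg δ) (hI' δ))) ?_
    refine (isLeast_derivationNorm δ).2 ?_
    have h2 : restrictTangent (I δ) = δ.1 := LinearMap.ext fun f => hI δ f
    rw [← h2]
    exact mem_derivationBounds_restrictTangent hpq (I δ)

end Isomorphism

end

end SobolevTangent

theorem mainTheorem12 {X : Type*} [MetricSpace X] [CompleteSpace X]
    [TopologicalSpace.SeparableSpace X] [MeasurableSpace X] [BorelSpace X]
    (m : Measure X) (hm : ∀ B : Set X, Bornology.IsBounded B → MeasurableSet B → m B < ∞)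
    (p q : ℝ≥0∞) [Fact (1 ≤ p)] [Fact (p ≠ ∞)] (hq : 1 < q) (hpq : p.HolderConjugate q) :
    -- minimal weak upper gradients are well defined
    (∀ f : dirichletSpace p m, IsLeast (upperGradientClasses p m f) (minGrad p m f)) ∧
    -- the cotangent module and the differential have their characterising properties
    IsLpBanachModule p m (CotangentModule p m) (cotangentNorm p m) ∧
    (∀ f : dirichletSpace p m,
      cotangentNorm p m (differential p m f) = (minGrad p m f : X →ₘ[m] ℝ)) ∧
    Generates p m (cotangentNorm p m) (range (differential p m)) ∧
    -- the tangent module and the module of Sobolev derivations are Banach modules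
    (∀ v : TangentModule p m, IsLUB (dualValues p m (cotangentNorm p m) v) (tangentNorm p m v)) ∧
    IsLpBanachModule q m (TangentModule p m) (tangentNorm p m) ∧
    (∀ δ : SobolevDerivation p q m, IsGLB (derivationBounds p q m δ.1) (derivationNorm p q m δ)) ∧
    IsLpBanachModule q m (SobolevDerivation p q m) (derivationNorm p q m) ∧
    -- every Sobolev derivation factors uniquely through the differential
    (∀ δ : SobolevDerivation p q m, ∃! v : TangentModule p m,
      ∀ f : sobolevSpace p m, v.1 (sobolevDifferential p m f) = δ.1 f) ∧
    -- the resulting map is an isomorphism of Banach modules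
    ∃ I : SobolevDerivation p q m →ₗ[Linfty m] TangentModule p m,
      (∀ (δ : SobolevDerivation p q m) (f : sobolevSpace p m),
        (I δ).1 (sobolevDifferential p m f) = δ.1 f) ∧
      Function.Bijective I ∧
      ∀ δ : SobolevDerivation p q m, tangentNorm p m (I δ) = derivationNorm p q m δ := by
  have hσ : SigmaFinite m := sigmaFinite_of_finite_on_bounded hm
  have hN := isPointwiseSeminorm_cotangentNorm (p := p) (m := m)
  have hD := isLpBanachModule_sobolevDerivation (p := p) (q := q) (m := m) hpq
  obtain ⟨I, hI, hbij, hnorm⟩ := exists_isomorphism (p := p) (q := q) (m := m) hpq hm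
  exact ⟨isLeast_minGrad, isLpBanachModule_cotangentModule, cotangentNorm_differential,
    generates_differential, fun v => (isLUB_dualNorm_and_mem hpq Fact.out hN v).1,
    hD.of_bijective I hbij hnorm, fun δ => (isLeast_derivationNorm δ).isGLB, hD,
    fun δ => ⟨I δ, hI δ, fun w hw => tangent_ext hm fun f => (hw f).trans (hI δ f).symm⟩,
    I, hI, hbij, hnorm⟩
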